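/- Let $S$ be a normal closed analytic variety in a complex manifold $M$, let $U$ be a connected open subset of $S$, and let $f, g$ be meromorphic functions on $U$ such that $df\wedge dg\not\equiv 0$. Let $H$ be an irreducible closed analytic subvariety of $U$ of codimension $1$. Then there exists $h\in\mathcal{K}$ that is non-constant on $H$, where $\mathcal{K}$ is the field generated by $f$, $g$ and the constant functions (a subfield of the field of meromorphic functions on $U$). Here $h$ is non-constant on $H$ if it takes two distinct finite values at points of $H$ at which $h$ is holomorphic; in particular, $H$ is not contained in the polar set of $h$. -/

import Mathlib

open scoped Manifold ContDiff Topology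

namespace AnalyticVariety

section

variable (E : Type*) [NormedAddCommGroup E] [NormedSpace ℂ E]
  {M : Type*} [TopologicalSpace M] [ChartedSpace E M]

/-- The function `F`, defined on a complex manifold `M` modelled on `E`, is holomorphic at `x`,
i.e. in a neighbourhood of `x`. -/
def HolAt (F : M → ℂ) (x : M) : Prop :=
  ContMDiffAt 𝓘(ℂ, E) 𝓘(ℂ, ℂ) ω F x

variable {E} in
theorem HolAt.add {F G : M → ℂ} {x : M} (hF : HolAt E F x) (hG : HolAt E G x) :
    HolAt E (F + G) x :=
  ContMDiffAt.add hF hG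

variable {E} in
theorem HolAt.mul {F G : M → ℂ} {x : M} (hF : HolAt E F x) (hG : HolAt E G x) :
    HolAt E (F * G) x :=
  ContMDiffAt.mul hF hG

theorem HolAt.const (c : ℂ) (x : M) : HolAt E (fun _ : M => c) x :=
  contMDiffAt_const

/-- `A` is a closed analytic subset of `U`, where `U ⊆ M` carries the complex structure induced
by `M`: locally at every point of `U`, the set `A` is the common zero set in `U` of finitely many
holomorphic functions. For `U = Set.univ` this is a closed analytic subset of `M`. -/
def IsAnalyticSubset (U A : Set M) : Prop :=
  A ⊆ U ∧ ∀ p ∈ U, ∃ (k : ℕ) (F : Fin k → M → ℂ), (∀ i, HolAt E (F i) p) ∧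
    ∀ᶠ y in 𝓝[U] p, (y ∈ A ↔ ∀ i, F i y = 0)

/-- The analytic set `H` is irreducible: it is non-empty and not the union of two proper closed
analytic subsets. -/
def IsIrreducibleAnalytic (H : Set M) : Prop :=
  H.Nonempty ∧ ∀ A B : Set M, IsAnalyticSubset E H A → IsAnalyticSubset E H B →
    A ∪ B = H → A = H ∨ B = H

/-- The `ℂ`-algebra structure of a ring of germs of `ℂ`-valued functions (constant functions). -/
instance germAlgebra {X : Type*} (l : Filter X) : Algebra ℂ (Filter.Germ l ℂ) where
  algebraMap :=
    { toFun := fun c => ((fun _ => c : X → ℂ) : Filter.Germ l ℂ)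
      map_one' := rfl
      map_mul' := fun _ _ => rfl
      map_zero' := rfl
      map_add' := fun _ _ => rfl }
  commutes' _ _ := mul_comm _ _
  smul_def' c φ := by
    induction φ using Filter.Germ.inductionOn
    rfl

/-- The local ring `𝒪_{A,x}` of the (reduced) analytic set `A` at `x`: germs at `x` of functions
on `A` that are restrictions of holomorphic functions defined near `x` in `M`. -/
def stalk (A : Set M) (x : M) : Subalgebra ℂ (Filter.Germ (𝓝[A] x) ℂ) where
  carrier := {φ | ∃ F : M → ℂ, HolAt E F x ∧ φ = (F : Filter.Germ (𝓝[A] x) ℂ)}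
  mul_mem' := by
    rintro _ _ ⟨F, hF, rfl⟩ ⟨G, hG, rfl⟩
    exact ⟨F * G, hF.mul hG, rfl⟩
  add_mem' := by
    rintro _ _ ⟨F, hF, rfl⟩ ⟨G, hG, rfl⟩
    exact ⟨F + G, hF.add hG, rfl⟩
  algebraMap_mem' c := ⟨fun _ => c, HolAt.const E c x, rfl⟩

/-- The analytic set `A` is normal: each of its local rings is a domain that is integrally closed
in its field of fractions. -/
def IsNormalAnalytic (A : Set M) : Prop :=
  ∀ x ∈ A, IsDomain (stalk E A x) ∧ IsIntegrallyClosed (stalk E A x)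

/-- The dimension of the analytic set `A` at its point `x`: the Krull dimension of `𝒪_{A,x}`. -/
noncomputable def localDim (A : Set M) (x : M) : WithBot ℕ∞ :=
  ringKrullDim (stalk E A x)

/-- `H ⊆ U` has codimension `1` in `U` (at each of its points). -/
def HasCodimOne (U H : Set M) : Prop :=
  ∀ x ∈ H, localDim E U x = localDim E H x + 1

/-- `s x` is the germ at `x` of the quotient `a / b`, where `a` and `b` are holomorphic at `x` and
the germ of `b` is not a zero divisor. -/
def IsQuotientAt {U : Set M} {x : U} (s : FractionRing (stalk E U x)) (a b : M → ℂ) : Prop :=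
  ∃ α β : stalk E U x, (α : Filter.Germ (𝓝[U] (x : M)) ℂ) = (a : Filter.Germ (𝓝[U] (x : M)) ℂ) ∧
    (β : Filter.Germ (𝓝[U] (x : M)) ℂ) = (b : Filter.Germ (𝓝[U] (x : M)) ℂ) ∧
    β ∈ nonZeroDivisors (stalk E U x) ∧
    s * algebraMap (stalk E U x) (FractionRing (stalk E U x)) β =
      algebraMap (stalk E U x) (FractionRing (stalk E U x)) α

/-- The `ℂ`-algebra of meromorphic functions on `U`, i.e. of global sections of the sheaf of total
rings of fractions of `𝒪_U`: families of elements of the total rings of fractions of the local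
rings `𝒪_{U,x}`, `x ∈ U`, that are locally given by one quotient `a / b` of holomorphic
functions. -/
noncomputable def meromorphic (U : Set M) :
    Subalgebra ℂ (∀ x : U, FractionRing (stalk E U x)) where
  carrier := {s | ∀ x : U, ∃ a b : M → ℂ, HolAt E a x ∧ HolAt E b x ∧
    ∀ᶠ y : U in 𝓝 x, IsQuotientAt E (s y) a b}
  mul_mem' := by
    intro s t hs ht x
    obtain ⟨a, b, ha, hb, h⟩ := hs x
    obtain ⟨a', b', ha', hb', h'⟩ := ht x
    refine ⟨a * a', b * b', ha.mul ha', hb.mul hb', ?_⟩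
    filter_upwards [h, h'] with y hy hy'
    obtain ⟨α, β, e1, e2, e3, e4⟩ := hy
    obtain ⟨α', β', e1', e2', e3', e4'⟩ := hy'
    refine ⟨α * α', β * β', ?_, ?_, mul_mem e3 e3', ?_⟩
    · simp [e1, e1']
    · simp [e2, e2']
    · simp only [Pi.mul_apply, map_mul, ← e4, ← e4']
      ring
  add_mem' := by
    intro s t hs ht x
    obtain ⟨a, b, ha, hb, h⟩ := hs x
    obtain ⟨a', b', ha', hb', h'⟩ := ht x
    refine ⟨a * b' + a' * b, b * b', (ha.mul hb').add (ha'.mul hb), hb.mul hb', ?_⟩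
    filter_upwards [h, h'] with y hy hy'
    obtain ⟨α, β, e1, e2, e3, e4⟩ := hy
    obtain ⟨α', β', e1', e2', e3', e4'⟩ := hy'
    refine ⟨α * β' + α' * β, β * β', ?_, ?_, mul_mem e3 e3', ?_⟩
    · simp [e1, e1', e2, e2']
    · simp [e2, e2']
    · simp only [Pi.add_apply, map_mul, map_add, ← e4, ← e4']
      ring
  algebraMap_mem' c := by
    intro x
    refine ⟨fun _ => c, fun _ => 1, HolAt.const E c _, HolAt.const E 1 _, ?_⟩
    filter_upwards with y
    refine ⟨algebraMap ℂ _ c, 1, rfl, rfl, one_mem _, ?_⟩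
    rw [Pi.algebraMap_apply, map_one, mul_one]
    exact IsScalarTower.algebraMap_apply ℂ (stalk E U y) _ c

variable {E}

/-- The field generated by the meromorphic functions `f`, `g` and the constants: the smallest
`ℂ`-subalgebra of the algebra of meromorphic functions on `U` that contains `f` and `g` and is
closed under inverses. (If `U` is normal and connected, the meromorphic functions on `U` form a
field.) -/
noncomputable def generatedField {U : Set M} (f g : meromorphic E U) :
    Subalgebra ℂ (meromorphic E U) :=
  sInf {K | f ∈ K ∧ g ∈ K ∧ ∀ a ∈ K, ∀ b, a * b = 1 → b ∈ K}

/-- The meromorphic function `h` is holomorphic at `x ∈ U`, and `F` is a holomorphic function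
defined near `x` in `M` that extends it. -/
def RepresentedAt {U : Set M} (h : meromorphic E U) (x : U) (F : M → ℂ) : Prop :=
  HolAt E F x ∧ ∃ φ : stalk E U x,
    (φ : Filter.Germ (𝓝[U] (x : M)) ℂ) = (F : Filter.Germ (𝓝[U] (x : M)) ℂ) ∧
    h.1 x = algebraMap (stalk E U x) (FractionRing (stalk E U x)) φ

/-- The meromorphic function `h` is non-constant on `H ⊆ U`: it takes two distinct (finite) values
at points of `H` where it is holomorphic. In particular `H` is not contained in the polar set
of `h`. -/
def NonconstantOn {U : Set M} (h : meromorphic E U) (H : Set M) : Prop :=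
  ∃ x y : U, (x : M) ∈ H ∧ (y : M) ∈ H ∧ ∃ F G : M → ℂ,
    RepresentedAt h x F ∧ RepresentedAt h y G ∧ F x ≠ G y

variable (E) in
/-- `φ` is a local holomorphic parametrization of `U` at `x` by `ℂ ^ d`: an immersion at `0` that
maps the neighbourhoods of `0` onto the neighbourhoods of `x` in `U`. It exists if and only if `U`
is near `x` a complex submanifold of dimension `d`, i.e. `x` is a regular point of `U`. -/
def IsParametrization (U : Set M) (x : M) {d : ℕ} (φ : EuclideanSpace ℂ (Fin d) → M) : Prop :=
  φ 0 = x ∧ ContMDiffAt 𝓘(ℂ, EuclideanSpace ℂ (Fin d)) 𝓘(ℂ, E) ω φ 0 ∧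
    Function.Injective (mfderiv 𝓘(ℂ, EuclideanSpace ℂ (Fin d)) 𝓘(ℂ, E) φ 0) ∧
    Filter.map φ (𝓝 0) = 𝓝[U] x

/-- `df ∧ dg ≢ 0`: at some regular point `x` of `U` at which `f` and `g` are holomorphic, the
`2`-form `df ∧ dg` does not vanish; it is computed in a local parametrization, on two tangent
vectors `v`, `w`. -/
def WedgeNotIdenticallyZero {U : Set M} (f g : meromorphic E U) : Prop :=
  ∃ (x : U) (d : ℕ) (φ : EuclideanSpace ℂ (Fin d) → M) (F G : M → ℂ),
    IsParametrization E U x φ ∧ RepresentedAt f x F ∧ RepresentedAt g x G ∧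
    ∃ v w : EuclideanSpace ℂ (Fin d),
      fderiv ℂ (F ∘ φ) 0 v * fderiv ℂ (G ∘ φ) 0 w -
        fderiv ℂ (F ∘ φ) 0 w * fderiv ℂ (G ∘ φ) 0 v ≠ 0

end

end AnalyticVariety

/-!
Let `x` be a point of `H`. The local ring `R` of `U` at `x` is a noetherian local domain that is
integrally closed: it is a quotient of the ring of germs of analytic functions, which is
noetherian by Weierstrass division (`weierstrass_division`, `AnalyticGerm.isNoetherianRing`), and
the rest is normality. As `H` has codimension one at `x`, the germs vanishing on `H` lie in a
prime ideal `P` of height one (`exists_isPrime_of_ringKrullDim_eq`), and the localization `R_P` is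
a discrete valuation ring (`isDiscreteValuationRing_of_height_one`).

Let `K` be the field generated by `f`, `g` and the constants, as a field of quotients of `R`.
Suppose that all elements of `K` in `R_P` are constant modulo `P`. Then, unless `K` consists of
constants, every element of `K` in `R_P` is, to any order along `P`, a polynomial with constant
coefficients in an element `τ` of `K` of smallest positive valuation. For derivations `D₁`, `D₂`
of `R`, the derivation `D₁ τ • D₂ - D₂ τ • D₁`, or `D₁` itself if `D₁ τ = 0`, is then zero on `τ`,
hence on all of `K`, so that `D₁ f * D₂ g - D₂ f * D₁ g = 0`
(`Derivation.eq_zero_of_forall_eq_add_mul`, `exists_forall_isUnit_sub`). If some pair of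
derivations does not kill `df ∧ dg`, there is therefore a quotient `a / s` in `K` with `s` not in
`P` that is not constant modulo `P` (`exists_quotient_notMem`). It takes two different values on
`H` near `x`: if it had the constant value `c` wherever `s` does not vanish, `(a - c * s) * s`
would vanish on `H` near `x` and lie in `P` (`AnalyticVariety.nonconstantOn_of_quotient`).

It remains to find derivations of the local ring at `x` that detect `df ∧ dg`, although `df ∧ dg`
is only known not to vanish somewhere on `U`, at a point where `U` is a manifold. This is the
local structure of the zero locus `Z` of a prime ideal of germs. After a linear change of
coordinates the local ring is finite over the germs on a base `E'` (Noether normalization,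
`AnalyticGerm.hasNormalizations`). A root of a minimal polynomial over points of the base tending
to `0` is a homomorphism into an ultraproduct of copies of `ℂ`, which is algebraically closed; the
homomorphism extends to the local ring, and this lifts the points to `Z`
(`AnalyticGerm.IsNormalization.exists_lift_ultrafilter`). Hence the projection to the base is open
at all points of `Z` near `0` (`AnalyticGerm.IsNormalization.eventually_nhds_le_map`), and outside
the zero set of a germ `Δ` it is a local isomorphism, so that the coordinate fields on the base,
multiplied by `Δ`, lift to vector fields along `Z` with analytic coefficients
(`AnalyticGerm.IsNormalization.exists_parametrizations`). The local ring is a domain, so the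
numerator of `df ∧ dg` with respect to these derivations either vanishes identically near `x` or
is nonzero at generic points near `x` (`AnalyticGerm.IsZeroLocus.exists_derivations_wedge`). The
closure of the set where `df ∧ dg` is nonzero is thus open, and it is all of the connected set `U`
(`AnalyticVariety.IsLocallyNormal.closure_wedgeLocus`).

The openness of the projection rests on the ring of germs being integrally closed, which makes
minimal polynomials over it have coefficients in it. By the same local structure a function that
does not vanish identically on `U` near `x` does not do so near any point of `U` close to `x`, so
that a meromorphic function on `U` that is not zero has an inverse
(`AnalyticVariety.IsLocallyNormal.exists_mul_eq_one`).
-/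

/-! ### Families of functions as maps into spaces of continuous functions -/

section Curry

variable {K : Type*} [TopologicalSpace K] [CompactSpace K]
  {E : Type*} [NormedAddCommGroup E] [NormedSpace ℂ E]
  {F : Type*} [NormedAddCommGroup F] [NormedSpace ℂ F]

/-- A continuous family of operators `E → F`, as an operator from `E` to continuous families. -/
noncomputable def familyToOperator : C(K, E →L[ℂ] F) →L[ℂ] (E →L[ℂ] C(K, F)) :=
  LinearMap.mkContinuous₂
    (LinearMap.mk₂ ℂ (fun (c : C(K, E →L[ℂ] F)) (v : E) =>
      (⟨fun k => c k v, by fun_prop⟩ : C(K, F)))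
      (fun _ _ _ => by ext; simp) (fun _ _ _ => by ext; simp)
      (fun _ _ _ => by ext; simp) (fun _ _ _ => by ext; simp)) 1 (by
    intro c v
    rw [one_mul, ContinuousMap.norm_le _ (by positivity)]
    intro k
    exact ((c k).le_opNorm v).trans (by gcongr; exact c.norm_coe_le_norm k))

@[simp] theorem familyToOperator_apply (c : C(K, E →L[ℂ] F)) (v : E) (k : K) :
    familyToOperator c v k = c k v := rfl

/-- Uniformity over the compact parameter space makes pointwise derivatives a derivative of the
`C(K, F)`-valued map. -/
theorem hasFDerivAt_of_forall_apply {g : E → C(K, F)} {D : E → C(K, E →L[ℂ] F)} {u : Set E}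
    {x : E} (hu : u ∈ 𝓝 x) (hg : ∀ z ∈ u, ∀ k, HasFDerivAt (fun z => g z k) (D z k) z)
    (hD : ContinuousAt D x) : HasFDerivAt g (familyToOperator (D x)) x := by
  rw [hasFDerivAt_iff_isLittleO_nhds_zero, Asymptotics.isLittleO_iff]
  intro ε hε
  have h1 : ∀ᶠ z in 𝓝 x, dist (D z) (D x) < ε :=
    Metric.tendsto_nhds.1 hD.tendsto ε hε
  obtain ⟨δ, hδ, hball⟩ := Metric.eventually_nhds_iff_ball.1 (h1.and hu)
  have h2 : ∀ᶠ h : E in 𝓝 0, h ∈ Metric.ball (0 : E) δ := Metric.ball_mem_nhds _ hδ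
  filter_upwards [h2] with h hh
  rw [ContinuousMap.norm_le _ (by positivity)]
  intro k
  have key := (convex_ball x δ).norm_image_sub_le_of_norm_hasFDerivWithin_le'
    (f := fun z => g z k) (f' := fun z => D z k) (φ := D x k) (C := ε) (x := x) (y := x + h)
    (fun z hz => (hg z (hball z hz).2 k).hasFDerivWithinAt)
    (fun z hz => by
      rw [← dist_eq_norm]
      exact (ContinuousMap.dist_apply_le_dist k).trans (hball z hz).1.le)
    (Metric.mem_ball_self hδ) (by simpa using hh)
  simpa using key

theorem contDiffAt_one_of_forall_apply {g : E → C(K, F)} {D : E → C(K, E →L[ℂ] F)} {u : Set E}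
    {x : E} (hu : u ∈ 𝓝 x) (hg : ∀ z ∈ u, ∀ k, HasFDerivAt (fun z => g z k) (D z k) z)
    (hD : ContinuousOn D u) : ContDiffAt ℂ 1 g x := by
  rw [contDiffAt_one_iff]
  refine ⟨fun z => familyToOperator (D z), interior u, interior_mem_nhds.2 hu, ?_, ?_⟩
  · exact familyToOperator.continuous.comp_continuousOn (hD.mono interior_subset)
  · intro z hz
    have hz' : u ∈ 𝓝 z := mem_interior_iff_mem_nhds.1 hz
    exact hasFDerivAt_of_forall_apply hz' hg (hD.continuousAt hz')

end Curry

section Osgood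

variable {E : Type*} [NormedAddCommGroup E] [NormedSpace ℂ E]
  {F : Type*} [NormedAddCommGroup F] [NormedSpace ℂ F]

/-- The restriction of `f (z, ·)` to the compact set `K`; the value is `0` if this restriction is
not continuous. -/
noncomputable def sliceOn (K : Set ℂ) (f : E × ℂ → F) (z : E) : C(K, F) :=
  open Classical in
  if h : Continuous (fun k : K => f (z, k)) then ⟨_, h⟩ else 0

omit [NormedAddCommGroup E] [NormedSpace ℂ E] [NormedSpace ℂ F] in
theorem sliceOn_apply {K : Set ℂ} {f : E × ℂ → F} {z : E}
    (h : Continuous (fun k : K => f (z, k))) (k : K) : sliceOn K f z k = f (z, k) := by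
  rw [sliceOn, dif_pos h]; rfl

/-- A function that is continuously differentiable along `{x} × K` gives a continuously
differentiable map into `C(K, F)`. -/
theorem contDiffAt_sliceOn {K : Set ℂ} (hK : IsCompact K) [CompactSpace K] {f : E × ℂ → F} {x : E}
    (hf : ∀ k ∈ K, ContDiffAt ℂ 1 f (x, k)) :
    ContDiffAt ℂ 1 (sliceOn K f) x ∧
      ∀ᶠ z in 𝓝 x, ∀ k : K, sliceOn K f z k = f (z, k) := by
  have h1 : ∀ k ∈ K, ∀ᶠ p in 𝓝 (x, k), ContDiffAt ℂ 1 f p := fun k hk =>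
    (hf k hk).eventually (by simp)
  -- the tube lemma
  have h2 : ∀ᶠ z in 𝓝 x, ∀ k ∈ K, ContDiffAt ℂ 1 f (z, k) :=
    hK.eventually_forall_of_forall_eventually h1
  obtain ⟨u, hu, huo, hxu⟩ := eventually_nhds_iff.1 h2
  have hc : ∀ z ∈ u, Continuous (fun k : K => f (z, k)) := fun z hz =>
    continuous_iff_continuousAt.2 fun k =>
      ContinuousAt.comp (g := f) (f := fun k : K => (z, (k : ℂ)))
        (hu z hz k k.2).continuousAt (by fun_prop)
  let D₀ : E → K → (E →L[ℂ] F) := fun z k => (fderiv ℂ f (z, k)).comp (.inl ℂ E ℂ)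
  have hD₀ : ContinuousOn (Function.uncurry D₀) (u ×ˢ Set.univ) := by
    rintro ⟨z, k⟩ ⟨hz, -⟩
    have h3 : ContinuousAt (fderiv ℂ f) (z, (k : ℂ)) :=
      ((hu z hz k k.2).fderiv_right (m := 0) (by simp)).continuousAt
    have h4 : ContinuousAt (fun p : E × K => fderiv ℂ f (p.1, (p.2 : ℂ))) (z, k) :=
      ContinuousAt.comp (g := fderiv ℂ f) (f := fun p : E × K => (p.1, (p.2 : ℂ))) h3
        (by fun_prop)
    exact (h4.clm_comp continuousAt_const).continuousWithinAt
  have hD1 : ∀ z ∈ u, Continuous (D₀ z) := fun z hz => by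
    rw [← continuousOn_univ]
    exact hD₀.comp (f := fun k : K => (z, k)) (by fun_prop) (fun k _ => ⟨hz, trivial⟩)
  classical
  let D : E → C(K, E →L[ℂ] F) := fun z => if h : Continuous (D₀ z) then ⟨_, h⟩ else 0
  have hDa : ∀ z ∈ u, ∀ k, D z k = D₀ z k := fun z hz k => by simp [D, hD1 z hz]
  have hDc : ContinuousOn D u := by
    refine ContinuousMap.continuousOn_of_continuousOn_uncurry D (hD₀.congr ?_)
    rintro ⟨z, k⟩ ⟨hz, -⟩
    exact hDa z hz k
  refine ⟨contDiffAt_one_of_forall_apply (huo.mem_nhds hxu) (D := D) ?_ hDc, ?_⟩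
  · intro z hz k
    rw [hDa z hz]
    have h5 : HasFDerivAt f (fderiv ℂ f (z, (k : ℂ))) (z, (k : ℂ)) :=
      ((hu z hz k k.2).differentiableAt (by simp)).hasFDerivAt
    have h6 := h5.comp (f := fun z : E => (z, (k : ℂ))) z (hasFDerivAt_prodMk_left z (k : ℂ))
    refine h6.congr_of_eventuallyEq ?_
    filter_upwards [huo.mem_nhds hz] with z' hz'
    exact sliceOn_apply (hc z' hz') k
  · filter_upwards [huo.mem_nhds hxu] with z hz k
    exact sliceOn_apply (hc z hz) k

end Osgood

/-! ### The Cauchy integral as a functional on continuous functions -/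

section CauchyFunctional

open MeasureTheory Metric

variable {F : Type*} [NormedAddCommGroup F] [NormedSpace ℂ F]

/-- The normalized circle integral, as a continuous linear functional on the continuous functions
on the circle. -/
noncomputable def circleFunctional (c : ℂ) {ρ : ℝ} (hρ : 0 ≤ ρ) : C(sphere c ρ, F) →L[ℂ] F :=
  LinearMap.mkContinuous
    { toFun := fun h => (2 * Real.pi * Complex.I : ℂ)⁻¹ •
        ∫ θ in (0 : ℝ)..2 * Real.pi,
          deriv (circleMap c ρ) θ • h ⟨circleMap c ρ θ, circleMap_mem_sphere c hρ θ⟩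
      map_add' := fun g h => by
        rw [← smul_add, ← intervalIntegral.integral_add]
        · simp
        · refine Continuous.intervalIntegrable ?_ _ _
          have : deriv (circleMap c ρ) = fun θ => circleMap 0 ρ θ * Complex.I := by
            ext θ; rw [deriv_circleMap]
          rw [this]; fun_prop
        · refine Continuous.intervalIntegrable ?_ _ _
          have : deriv (circleMap c ρ) = fun θ => circleMap 0 ρ θ * Complex.I := by
            ext θ; rw [deriv_circleMap]
          rw [this]; fun_prop
      map_smul' := fun a h => by
        simp only [ContinuousMap.smul_apply, RingHom.id_apply]
        rw [smul_comm a, ← intervalIntegral.integral_smul a]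
        refine congrArg _ (intervalIntegral.integral_congr fun θ _ => ?_)
        exact smul_comm (deriv (circleMap c ρ) θ) a
          (h ⟨circleMap c ρ θ, circleMap_mem_sphere c hρ θ⟩) }
    (‖(2 * Real.pi * Complex.I : ℂ)⁻¹‖ * (ρ * |2 * Real.pi - 0|)) (by
      intro h
      change ‖(2 * Real.pi * Complex.I : ℂ)⁻¹ • ∫ θ in (0 : ℝ)..2 * Real.pi,
          deriv (circleMap c ρ) θ • h ⟨circleMap c ρ θ, circleMap_mem_sphere c hρ θ⟩‖ ≤ _
      rw [norm_smul, mul_assoc ‖_‖]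
      refine mul_le_mul_of_nonneg_left ?_ (norm_nonneg _)
      rw [mul_right_comm]
      refine intervalIntegral.norm_integral_le_of_norm_le_const fun θ _ => ?_
      rw [norm_smul, deriv_circleMap]
      gcongr
      · simp [abs_of_nonneg hρ]
      · exact h.norm_coe_le_norm _)

theorem circleFunctional_eq {c : ℂ} {ρ : ℝ} (hρ : 0 ≤ ρ) {h : C(sphere c ρ, F)} {f : ℂ → F}
    (hf : ∀ k : sphere c ρ, h k = f k) :
    circleFunctional c hρ h = (2 * Real.pi * Complex.I : ℂ)⁻¹ • ∮ z in C(c, ρ), f z := by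
  simp [circleFunctional, circleIntegral, hf]

/-- The kernel `ζ ↦ (ζ - w)⁻¹` as an element of the Banach algebra of continuous functions on the
circle. -/
noncomputable def cauchyKernel (c : ℂ) (ρ : ℝ) (w : ℂ) : C(sphere c ρ, ℂ) :=
  Ring.inverse ((⟨fun ζ => (ζ : ℂ), by fun_prop⟩ : C(sphere c ρ, ℂ)) - algebraMap ℂ _ w)

theorem isUnit_of_forall_ne_zero {K : Type*} [TopologicalSpace K] (f : C(K, ℂ))
    (hf : ∀ k, f k ≠ 0) : IsUnit f :=
  (ContinuousMap.isUnit_iff_forall_ne_zero f).2 hf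

theorem ring_inverse_apply {K : Type*} [TopologicalSpace K] (f : C(K, ℂ)) (hf : ∀ k, f k ≠ 0)
    (k : K) : Ring.inverse f k = (f k)⁻¹ := by
  have h := Ring.mul_inverse_cancel f (isUnit_of_forall_ne_zero f hf)
  have h' := DFunLike.congr_fun h k
  rw [ContinuousMap.mul_apply, ContinuousMap.one_apply] at h'
  exact eq_inv_of_mul_eq_one_right h'

theorem sub_ne_zero_of_mem_sphere {c w : ℂ} {ρ : ℝ} (hw : w ∈ ball c ρ) (k : sphere c ρ) :
    (k : ℂ) - w ≠ 0 := by
  intro h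
  rw [sub_eq_zero] at h
  have h1 : dist (k : ℂ) c = ρ := k.2
  have h2 : dist w c < ρ := hw
  rw [h] at h1
  exact h2.ne h1

theorem cauchyKernel_apply {c w : ℂ} {ρ : ℝ} (hw : w ∈ ball c ρ) (k : sphere c ρ) :
    cauchyKernel c ρ w k = ((k : ℂ) - w)⁻¹ := by
  rw [cauchyKernel, ring_inverse_apply]
  · simp
  · intro k
    simpa using sub_ne_zero_of_mem_sphere hw k

theorem analyticAt_cauchyKernel {c w : ℂ} {ρ : ℝ} (hw : w ∈ ball c ρ) :
    AnalyticAt ℂ (cauchyKernel c ρ) w := by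
  have hu : IsUnit ((⟨fun ζ => (ζ : ℂ), by fun_prop⟩ : C(sphere c ρ, ℂ)) - algebraMap ℂ _ w) :=
    isUnit_of_forall_ne_zero _ fun k => by simpa using sub_ne_zero_of_mem_sphere hw k
  obtain ⟨v, hv⟩ := hu
  have h1 : AnalyticAt ℂ Ring.inverse (v : C(sphere c ρ, ℂ)) := analyticAt_inverse v
  rw [hv] at h1
  refine AnalyticAt.comp (g := Ring.inverse) (f := fun w =>
    (⟨fun ζ => (ζ : ℂ), by fun_prop⟩ : C(sphere c ρ, ℂ)) - algebraMap ℂ _ w) h1 ?_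
  exact analyticAt_const.sub
    ((Algebra.linearMap ℂ C(sphere c ρ, ℂ)).toContinuousLinearMap.analyticAt w)

/-- The product of a scalar function and a vector valued function on the circle. -/
noncomputable def smulFunctional (K : Type*) [TopologicalSpace K] [CompactSpace K] :
    C(K, ℂ) →L[ℂ] C(K, F) →L[ℂ] C(K, F) :=
  LinearMap.mkContinuous₂
    (LinearMap.mk₂ ℂ (fun (c : C(K, ℂ)) (v : C(K, F)) =>
      (⟨fun k => c k • v k, by fun_prop⟩ : C(K, F)))
      (fun _ _ _ => by ext; simp [add_smul]) (fun _ _ _ => by ext; simp [mul_smul])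
      (fun _ _ _ => by ext; simp) (fun a c v => by ext k; simp [smul_comm a])) 1 (by
    intro c v
    rw [one_mul, ContinuousMap.norm_le _ (by positivity)]
    intro k
    simp only [LinearMap.mk₂_apply, ContinuousMap.coe_mk, norm_smul]
    gcongr
    · exact c.norm_coe_le_norm k
    · exact v.norm_coe_le_norm k)

@[simp] theorem smulFunctional_apply (K : Type*) [TopologicalSpace K] [CompactSpace K]
    (c : C(K, ℂ)) (v : C(K, F)) (k : K) : smulFunctional K c v k = c k • v k := rfl

/-- The Cauchy integral of a continuous function on the circle, at the point `w`. -/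
noncomputable def cauchyIntegral (c : ℂ) {ρ : ℝ} (hρ : 0 ≤ ρ) (w : ℂ) : C(sphere c ρ, F) →L[ℂ] F :=
  (circleFunctional c hρ).comp (smulFunctional _ (cauchyKernel c ρ w))

theorem cauchyIntegral_eq [CompleteSpace F] {c w : ℂ} {ρ : ℝ} (hρ : 0 ≤ ρ) (hw : w ∈ ball c ρ)
    {h : C(sphere c ρ, F)} {f : ℂ → F} (hf : ∀ k : sphere c ρ, h k = f k)
    (hd : DiffContOnCl ℂ f (ball c ρ)) : cauchyIntegral c hρ w h = f w := by
  rw [cauchyIntegral, ContinuousLinearMap.comp_apply,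
    circleFunctional_eq hρ (f := fun z => (z - w)⁻¹ • f z)]
  · exact hd.two_pi_i_inv_smul_circleIntegral_sub_inv_smul hw
  · intro k
    rw [smulFunctional_apply, cauchyKernel_apply hw, hf]

theorem analyticAt_cauchyIntegral_apply {E : Type*} [NormedAddCommGroup E] [NormedSpace ℂ E]
    {c w : ℂ} {ρ : ℝ} (hρ : 0 ≤ ρ) (hw : w ∈ ball c ρ) {g : E → C(sphere c ρ, F)} {x : E}
    (hg : AnalyticAt ℂ g x) :
    AnalyticAt ℂ (fun p : E × ℂ => cauchyIntegral c hρ p.2 (g p.1)) (x, w) := by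
  have h1 : AnalyticAt ℂ (fun p : E × ℂ => smulFunctional (F := F) (sphere c ρ)
      (cauchyKernel c ρ p.2) (g p.1)) (x, w) := by
    refine ((smulFunctional (F := F) (sphere c ρ)).analyticAt_bilinear
      (cauchyKernel c ρ w, g x)).fun_comp (x := ((x, w) : E × ℂ))
      (f := fun p : E × ℂ => (cauchyKernel c ρ p.2, g p.1))
      (AnalyticAt.prod ?_ ?_)
    · exact AnalyticAt.comp (g := cauchyKernel c ρ) (f := fun p : E × ℂ => p.2)
        (analyticAt_cauchyKernel hw) analyticAt_snd
    · exact AnalyticAt.comp (g := g) (f := fun p : E × ℂ => p.1) hg analyticAt_fst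
  exact ((circleFunctional c hρ).analyticAt _).comp h1

end CauchyFunctional

/-! ### Osgood's lemma -/

section Osgood

open Metric

universe u

/-- The induction step of Osgood's lemma: the function `f` is the Cauchy integral in the last
variable of a map into the Banach space of continuous functions on a circle, which is analytic by
the hypothesis on `E`. -/
theorem analyticAt_prod_of_contDiffAt_one {E : Type*} [NormedAddCommGroup E] [NormedSpace ℂ E]
    (hE : ∀ (F : Type u) [NormedAddCommGroup F] [NormedSpace ℂ F] [CompleteSpace F] (g : E → F)
      (x : E), ContDiffAt ℂ 1 g x → AnalyticAt ℂ g x)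
    {F : Type u} [NormedAddCommGroup F] [NormedSpace ℂ F] [CompleteSpace F] {f : E × ℂ → F}
    {x : E × ℂ} (hf : ContDiffAt ℂ 1 f x) : AnalyticAt ℂ f x := by
  obtain ⟨x, w⟩ := x
  have h1 : ∀ᶠ p in 𝓝 (x, w), ContDiffAt ℂ 1 f p := hf.eventually (by simp)
  obtain ⟨ρ', hρ', hb⟩ := Metric.eventually_nhds_iff_ball.1 h1
  obtain ⟨ρ, hρ, hρρ⟩ := exists_between hρ'
  have hb' : ∀ z ∈ ball x ρ', ∀ k ∈ closedBall w ρ, ContDiffAt ℂ 1 f (z, k) := by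
    intro z hz k hk
    apply hb
    rw [← ball_prod_same]
    exact ⟨hz, lt_of_le_of_lt hk hρρ⟩
  have h2 := contDiffAt_sliceOn (isCompact_sphere w ρ) (f := f) (x := x) fun k hk =>
    hb' x (mem_ball_self hρ') k (sphere_subset_closedBall hk)
  have h3 := analyticAt_cauchyIntegral_apply hρ.le (mem_ball_self hρ : w ∈ ball w ρ)
    (hE _ _ _ h2.1)
  refine h3.congr ?_
  have h4 : ∀ᶠ p : E × ℂ in 𝓝 (x, w), p.2 ∈ ball w ρ :=
    continuous_snd.continuousAt.eventually (ball_mem_nhds _ hρ)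
  have h5 : ∀ᶠ p : E × ℂ in 𝓝 (x, w), p.1 ∈ ball x ρ' :=
    continuous_fst.continuousAt.eventually (ball_mem_nhds _ hρ')
  have h6 := (continuous_fst (X := E) (Y := ℂ)).continuousAt (x := (x, w)) |>.eventually h2.2
  filter_upwards [h4, h5, h6] with p hp4 hp5 hp6
  refine cauchyIntegral_eq hρ.le hp4 (f := fun k => f (p.1, k)) hp6 ?_
  have h7 : DifferentiableOn ℂ (fun k => f (p.1, k)) (closedBall w ρ) := fun k hk =>
    (DifferentiableAt.comp (g := f) (f := fun k => (p.1, k)) k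
      ((hb' _ hp5 k hk).differentiableAt (by simp)) (by fun_prop)).differentiableWithinAt
  exact h7.diffContOnCl_ball subset_rfl

theorem analyticAt_of_contDiffAt_one_pi (n : ℕ) : ∀ (F : Type u) [NormedAddCommGroup F]
    [NormedSpace ℂ F] [CompleteSpace F] (f : (Fin n → ℂ) → F) (x : Fin n → ℂ),
    ContDiffAt ℂ 1 f x → AnalyticAt ℂ f x := by
  induction n with
  | zero =>
    intro F _ _ _ f x _
    have : f = fun _ => f x := by ext y; rw [Subsingleton.elim y x]
    rw [this]
    exact analyticAt_const
  | succ n ih =>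
    intro F _ _ _ f x hf
    have e : ((Fin n → ℂ) × ℂ) ≃L[ℂ] (Fin (n + 1) → ℂ) :=
      ContinuousLinearEquiv.ofFinrankEq (by simp)
    have h1 : ContDiffAt ℂ 1 (f ∘ e) (e.symm x) :=
      ContDiffAt.comp _ (by simpa using hf) e.contDiff.contDiffAt
    have h2 := analyticAt_prod_of_contDiffAt_one ih h1
    have h3 := AnalyticAt.comp (g := f ∘ e) (f := e.symm) h2
      (e.symm.analyticAt x)
    simpa [Function.comp_def] using h3

/-- **Osgood's lemma**: a continuously complex differentiable function of several variables is
analytic. -/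
theorem analyticAt_of_contDiffAt_one {E : Type*} [NormedAddCommGroup E] [NormedSpace ℂ E]
    [FiniteDimensional ℂ E] {F : Type u} [NormedAddCommGroup F] [NormedSpace ℂ F]
    [CompleteSpace F] {f : E → F} {x : E} (hf : ContDiffAt ℂ 1 f x) : AnalyticAt ℂ f x := by
  have e : (Fin (Module.finrank ℂ E) → ℂ) ≃L[ℂ] E :=
    ContinuousLinearEquiv.ofFinrankEq (by simp)
  have h1 : ContDiffAt ℂ 1 (f ∘ e) (e.symm x) :=
    ContDiffAt.comp _ (by simpa using hf) e.contDiff.contDiffAt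
  have h3 := AnalyticAt.comp (g := f ∘ e) (f := e.symm)
    (analyticAt_of_contDiffAt_one_pi _ _ _ _ h1) (e.symm.analyticAt x)
  simpa [Function.comp_def] using h3

/-- A function that is analytic along `{x} × K` gives an analytic map into `C(K, ℂ)`. -/
theorem analyticAt_sliceOn {E : Type*} [NormedAddCommGroup E] [NormedSpace ℂ E]
    [FiniteDimensional ℂ E] {K : Set ℂ} (hK : IsCompact K) [CompactSpace K] {f : E × ℂ → ℂ} {x : E}
    (hf : ∀ k ∈ K, AnalyticAt ℂ f (x, k)) : AnalyticAt ℂ (sliceOn K f) x :=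
  analyticAt_of_contDiffAt_one (contDiffAt_sliceOn hK fun k hk => (hf k hk).contDiffAt).1

end Osgood

/-! ### Weierstrass division -/

section DiscAlgebra

open Metric Polynomial

/-- The coordinate function on the circle. -/
noncomputable def circleCoord (ρ : ℝ) : C(sphere (0 : ℂ) ρ, ℂ) := ⟨fun ζ => (ζ : ℂ), by fun_prop⟩

@[simp] theorem circleCoord_apply {ρ : ℝ} (k : sphere (0 : ℂ) ρ) : circleCoord ρ k = k := rfl

theorem aeval_circleCoord_apply {ρ : ℝ} (p : ℂ[X]) (k : sphere (0 : ℂ) ρ) :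
    aeval (circleCoord ρ) p k = p.eval (k : ℂ) := by
  induction p using Polynomial.induction_on' with
  | add p q hp hq => simp [hp, hq]
  | monomial n a => simp [aeval_monomial]

/-- The disc algebra: the uniform closure of the polynomials on the circle. -/
noncomputable def discAlgebra (ρ : ℝ) : Subalgebra ℂ C(sphere (0 : ℂ) ρ, ℂ) :=
  (Algebra.adjoin ℂ {circleCoord ρ}).topologicalClosure

theorem isClosed_discAlgebra (ρ : ℝ) : IsClosed (discAlgebra ρ : Set C(sphere (0 : ℂ) ρ, ℂ)) :=
  Subalgebra.isClosed_topologicalClosure _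

theorem aeval_mem_discAlgebra {ρ : ℝ} (p : ℂ[X]) : aeval (circleCoord ρ) p ∈ discAlgebra ρ :=
  Subalgebra.le_topologicalClosure _ (by
    rw [Algebra.adjoin_singleton_eq_range_aeval]; exact ⟨p, rfl⟩)

/-- A closed condition on the elements of the disc algebra has to be checked for polynomials only.
-/
theorem discAlgebra_induction {ρ : ℝ} {s : Set C(sphere (0 : ℂ) ρ, ℂ)} (hs : IsClosed s)
    (hp : ∀ p : ℂ[X], aeval (circleCoord ρ) p ∈ s) {h : C(sphere (0 : ℂ) ρ, ℂ)}
    (hh : h ∈ discAlgebra ρ) : h ∈ s := by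
  have h1 : closure (Algebra.adjoin ℂ {circleCoord ρ} : Set C(sphere (0 : ℂ) ρ, ℂ)) ⊆ s := by
    refine closure_minimal ?_ hs
    rw [Algebra.adjoin_singleton_eq_range_aeval]
    rintro _ ⟨p, rfl⟩
    exact hp p
  exact h1 hh

/-- The restriction to the circle of a function that is holomorphic on a larger disc lies in the
disc algebra: its Taylor polynomials converge uniformly on the circle. -/
theorem mem_discAlgebra_of_differentiableOn {ρ R : ℝ} (hρ : 0 ≤ ρ) (hR : ρ < R) {φ : ℂ → ℂ}
    (hφ : DifferentiableOn ℂ φ (ball 0 R)) {h : C(sphere (0 : ℂ) ρ, ℂ)} (hh : ∀ k, h k = φ k) :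
    h ∈ discAlgebra ρ := by
  obtain ⟨R₁, h1, h1'⟩ := exists_between hR
  obtain ⟨R₂, h2, h2'⟩ := exists_between h1
  lift R₁ to NNReal using (hρ.trans h1.le)
  lift R₂ to NNReal using (hρ.trans h2.le)
  have hs : HasFPowerSeriesOnBall φ (cauchyPowerSeries φ 0 R₁) 0 R₁ :=
    (hφ.mono (closedBall_subset_ball h1')).hasFPowerSeriesOnBall
      (by exact_mod_cast lt_of_le_of_lt hρ h1)
  have hu := hs.tendstoUniformlyOn (r' := R₂) (by exact_mod_cast h2')
  rw [discAlgebra, ← SetLike.mem_coe, Subalgebra.topologicalClosure_coe, Metric.mem_closure_iff]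
  intro ε hε
  rw [Metric.tendstoUniformlyOn_iff] at hu
  obtain ⟨n, hn⟩ := (hu (ε / 2) (half_pos hε)).exists
  let p : ℂ[X] := ∑ i ∈ Finset.range n, C ((cauchyPowerSeries φ 0 R₁).coeff i) * X ^ i
  refine ⟨aeval (circleCoord ρ) p, ?_, ?_⟩
  · rw [Algebra.adjoin_singleton_eq_range_aeval]; exact ⟨p, rfl⟩
  · refine lt_of_le_of_lt ((ContinuousMap.dist_le (half_pos hε).le).2 fun k => ?_) (half_lt_self hε)
    have hk : (k : ℂ) ∈ ball (0 : ℂ) R₂ := by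
      have : dist (k : ℂ) 0 = ρ := k.2
      rw [mem_ball, this]; exact h2
    have := hn k hk
    rw [zero_add] at this
    rw [hh, aeval_circleCoord_apply]
    refine (le_of_eq ?_).trans this.le
    congr 1
    simp only [p, FormalMultilinearSeries.partialSum, eval_finsetSum]
    refine Finset.sum_congr rfl fun i _ => ?_
    rw [FormalMultilinearSeries.apply_eq_pow_smul_coeff, eval_mul, eval_C, eval_pow, eval_X,
      smul_eq_mul, mul_comm]

theorem cauchyIntegral_aeval {ρ : ℝ} (hρ : 0 < ρ) {w : ℂ} (hw : w ∈ ball (0 : ℂ) ρ) (p : ℂ[X])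
    {F : C(sphere (0 : ℂ) ρ, ℂ)} {φ : ℂ → ℂ} (hF : ∀ k, F k = φ k)
    (hφ : DiffContOnCl ℂ φ (ball 0 ρ)) :
    cauchyIntegral 0 hρ.le w (aeval (circleCoord ρ) p * F) = p.eval w * φ w := by
  refine cauchyIntegral_eq hρ.le hw (f := fun w => p.eval w * φ w) ?_ ?_
  · intro k
    rw [ContinuousMap.mul_apply, aeval_circleCoord_apply, hF]
  · exact DiffContOnCl.smul p.differentiable.diffContOnCl hφ

/-- The Cauchy integral is multiplicative on the products of an element `q` of the disc algebra with
the boundary values of a holomorphic function. -/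
theorem cauchyIntegral_mul {ρ : ℝ} (hρ : 0 < ρ) {w : ℂ} (hw : w ∈ ball (0 : ℂ) ρ)
    {F q : C(sphere (0 : ℂ) ρ, ℂ)} (hq : q ∈ discAlgebra ρ) {φ : ℂ → ℂ} (hF : ∀ k, F k = φ k)
    (hφ : DiffContOnCl ℂ φ (ball 0 ρ)) :
    cauchyIntegral 0 hρ.le w (q * F) = cauchyIntegral 0 hρ.le w q * φ w := by
  refine discAlgebra_induction (s := {q | cauchyIntegral 0 hρ.le w (q * F) =
    cauchyIntegral 0 hρ.le w q * φ w}) ?_ ?_ hq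
  · exact isClosed_eq (by fun_prop) (by fun_prop)
  · intro p
    have h1 := cauchyIntegral_aeval hρ hw p (F := 1) (φ := fun _ => 1) (fun _ => rfl)
      diffContOnCl_const
    rw [mul_one, mul_one] at h1
    rw [Set.mem_ofPred_eq, cauchyIntegral_aeval hρ hw p hF hφ, h1]

/-- The operator `h ↦ (h - h(0)) / t`, where `h(0)` is computed by the Cauchy integral. -/
noncomputable def divCoord {ρ : ℝ} (hρ : 0 < ρ) :
    C(sphere (0 : ℂ) ρ, ℂ) →L[ℂ] C(sphere (0 : ℂ) ρ, ℂ) :=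
  (ContinuousLinearMap.mul ℂ _ (cauchyKernel 0 ρ 0)).comp
    (ContinuousLinearMap.id ℂ _ - (cauchyIntegral 0 hρ.le 0).smulRight 1)

theorem circleCoord_mul_cauchyKernel {ρ : ℝ} (hρ : 0 < ρ) :
    circleCoord ρ * cauchyKernel 0 ρ 0 = 1 := by
  ext k
  have h0 := sub_ne_zero_of_mem_sphere (mem_ball_self hρ : (0 : ℂ) ∈ ball 0 ρ) k
  rw [ContinuousMap.mul_apply, cauchyKernel_apply (mem_ball_self hρ)]
  rw [sub_zero] at h0 ⊢
  simpa using mul_inv_cancel₀ h0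

theorem divCoord_apply {ρ : ℝ} (hρ : 0 < ρ) (h : C(sphere (0 : ℂ) ρ, ℂ)) :
    divCoord hρ h = cauchyKernel 0 ρ 0 * (h - cauchyIntegral 0 hρ.le 0 h • 1) := rfl

theorem eq_add_mul_divCoord {ρ : ℝ} (hρ : 0 < ρ) (h : C(sphere (0 : ℂ) ρ, ℂ)) :
    h = cauchyIntegral 0 hρ.le 0 h • 1 + circleCoord ρ * divCoord hρ h := by
  rw [divCoord_apply, ← mul_assoc, circleCoord_mul_cauchyKernel hρ, one_mul]
  abel

theorem eq_sum_add_mul_divCoord_pow {ρ : ℝ} (hρ : 0 < ρ) (k : ℕ) (h : C(sphere (0 : ℂ) ρ, ℂ)) :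
    h = ∑ i ∈ Finset.range k, cauchyIntegral 0 hρ.le 0 ((divCoord hρ ^ i) h) • circleCoord ρ ^ i +
      circleCoord ρ ^ k * (divCoord hρ ^ k) h := by
  induction k with
  | zero => simp
  | succ k ih =>
    conv_lhs => rw [ih, eq_add_mul_divCoord hρ ((divCoord hρ ^ k) h)]
    rw [Finset.sum_range_succ, pow_succ' (divCoord hρ), mul_apply_eq_comp,
      mul_add, mul_smul_comm, mul_one, ← mul_assoc, ← pow_succ, add_assoc]

theorem divCoord_mem {ρ : ℝ} (hρ : 0 < ρ) {h : C(sphere (0 : ℂ) ρ, ℂ)} (hh : h ∈ discAlgebra ρ) :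
    divCoord hρ h ∈ discAlgebra ρ := by
  refine discAlgebra_induction (s := divCoord hρ ⁻¹' (discAlgebra ρ)) ?_ ?_ hh
  · exact (isClosed_discAlgebra ρ).preimage (divCoord hρ).continuous
  · intro p
    have h1 := cauchyIntegral_aeval hρ (mem_ball_self hρ) p (F := 1) (φ := fun _ => 1)
      (fun _ => rfl) diffContOnCl_const
    rw [mul_one, mul_one] at h1
    have h2 : divCoord hρ (aeval (circleCoord ρ) p) = aeval (circleCoord ρ) p.divX := by
      rw [divCoord_apply, h1]
      conv_lhs => rw [← p.divX_mul_X_add]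
      simp only [map_add, map_mul, aeval_X, aeval_C, eval_add, eval_mul, eval_X, mul_zero, eval_C,
        zero_add, Algebra.algebraMap_eq_smul_one, add_sub_cancel_right]
      rw [mul_comm, mul_assoc, circleCoord_mul_cauchyKernel hρ, mul_one]
    rw [Set.mem_preimage, h2]
    exact aeval_mem_discAlgebra _

theorem divCoord_pow_mem {ρ : ℝ} (hρ : 0 < ρ) (k : ℕ) {h : C(sphere (0 : ℂ) ρ, ℂ)}
    (hh : h ∈ discAlgebra ρ) : (divCoord hρ ^ k) h ∈ discAlgebra ρ := by
  induction k with
  | zero => simpa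
  | succ k ih => rw [pow_succ', mul_apply_eq_comp]; exact divCoord_mem hρ ih

/-- For `F = t ^ k * u` with inverse `v` of `u`, this operator is the identity, by
`eq_sum_add_mul_divCoord_pow`; its inverse for nearby `F` performs the division by `F`. -/
noncomputable def divisionOperator {ρ : ℝ} (hρ : 0 < ρ) (k : ℕ) (v F : C(sphere (0 : ℂ) ρ, ℂ)) :
    C(sphere (0 : ℂ) ρ, ℂ) →L[ℂ] C(sphere (0 : ℂ) ρ, ℂ) :=
  ContinuousLinearMap.mul ℂ _ (F * v) * divCoord hρ ^ k +
    ∑ i ∈ Finset.range k,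
      ((cauchyIntegral 0 hρ.le 0).comp (divCoord hρ ^ i)).smulRight (circleCoord ρ ^ i)

theorem divisionOperator_apply {ρ : ℝ} (hρ : 0 < ρ) (k : ℕ) (v F h : C(sphere (0 : ℂ) ρ, ℂ)) :
    divisionOperator hρ k v F h = v * (divCoord hρ ^ k) h * F +
      ∑ i ∈ Finset.range k, cauchyIntegral 0 hρ.le 0 ((divCoord hρ ^ i) h) • circleCoord ρ ^ i := by
  simp only [divisionOperator, add_apply, mul_apply_eq_comp,
    ContinuousLinearMap.mul_apply', sum_apply,
    ContinuousLinearMap.smulRight_apply, ContinuousLinearMap.comp_apply]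
  congr 1
  ring

theorem divisionOperator_mem {ρ : ℝ} (hρ : 0 < ρ) (k : ℕ) {v F h : C(sphere (0 : ℂ) ρ, ℂ)}
    (hv : v ∈ discAlgebra ρ) (hF : F ∈ discAlgebra ρ) (hh : h ∈ discAlgebra ρ) :
    divisionOperator hρ k v F h ∈ discAlgebra ρ := by
  rw [divisionOperator_apply]
  have ht : circleCoord ρ ∈ discAlgebra ρ := by simpa using aeval_mem_discAlgebra (ρ := ρ) X
  exact add_mem (mul_mem (mul_mem hv (divCoord_pow_mem hρ k hh)) hF)
    (sum_mem fun i _ => Subalgebra.smul_mem _ (pow_mem ht i) _)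

/-- A closed subspace that is stable under an operator close to the identity is stable under its
inverse, by the Neumann series. -/
theorem ring_inverse_apply_mem {X : Type*} [NormedAddCommGroup X] [NormedSpace ℂ X]
    [CompleteSpace X] {H : Submodule ℂ X} (hH : IsClosed (H : Set X)) {A : X →L[ℂ] X}
    (hA : ‖1 - A‖ < 1) (hAH : ∀ h ∈ H, A h ∈ H) {h : X} (hh : h ∈ H) : Ring.inverse A h ∈ H := by
  have h1 : Ring.inverse A = ∑' n : ℕ, (1 - A) ^ n := by
    rw [geom_series_eq_inverse _ hA, sub_sub_cancel]
  have h2 : HasSum (fun n : ℕ => ((1 - A) ^ n) h) (Ring.inverse A h) := by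
    rw [h1]
    exact ((ContinuousLinearMap.apply ℂ X h).hasSum
      (summable_geometric_of_norm_lt_one hA).hasSum)
  refine hH.mem_of_tendsto h2 (Filter.Eventually.of_forall fun s => ?_)
  refine sum_mem fun n hn => ?_
  clear hn
  induction n with
  | zero => simpa
  | succ n ih =>
    rw [pow_succ', mul_apply_eq_comp]
    exact sub_mem ih (hAH _ ih)

end DiscAlgebra

section WeierstrassDivision

open Metric Polynomial

variable {E : Type*} [NormedAddCommGroup E] [NormedSpace ℂ E] [FiniteDimensional ℂ E]

omit [FiniteDimensional ℂ E] in
theorem analyticAt_divisionOperator {ρ : ℝ} (hρ : 0 < ρ) (k : ℕ) (v : C(sphere (0 : ℂ) ρ, ℂ))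
    {F : E → C(sphere (0 : ℂ) ρ, ℂ)} {x : E} (hF : AnalyticAt ℂ F x) :
    AnalyticAt ℂ (fun z => divisionOperator hρ k v (F z)) x := by
  have h1 : AnalyticAt ℂ (fun z => ContinuousLinearMap.mul ℂ C(sphere (0 : ℂ) ρ, ℂ) (F z * v)) x :=
    ((ContinuousLinearMap.mul ℂ C(sphere (0 : ℂ) ρ, ℂ)).analyticAt (F x * v)).fun_comp
      (f := fun z => F z * v) (hF.mul analyticAt_const)
  exact (h1.mul analyticAt_const).add analyticAt_const

/-- **Weierstrass division theorem.** If `f (0, ·)` has a zero of order `k`, so that it is `t ^ k *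
u t` with `u` invertible, then the `divisionOperator` of `u⁻¹` and `f (z, ·)` on a small circle is
the identity at `z = 0`, and hence invertible for `z` close to `0`, with an inverse that depends
analytically on `z`. Applied to `g (z, ·)` the inverse gives the boundary values on the circle of
the quotient and the coefficients of the remainder; the Cauchy integral extends the division from
the circle to the disc. -/
theorem weierstrass_division {f g : E × ℂ → ℂ} (hf : AnalyticAt ℂ f 0) (hg : AnalyticAt ℂ g 0)
    {k : ℕ} (hk : analyticOrderAt (fun t => f (0, t)) 0 = k) :
    ∃ (q : E × ℂ → ℂ) (r : ℕ → E → ℂ), AnalyticAt ℂ q 0 ∧ (∀ i, AnalyticAt ℂ (r i) 0) ∧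
      ∀ᶠ p in 𝓝 (0 : E × ℂ), g p = q p * f p + ∑ i ∈ Finset.range k, r i p.1 * p.2 ^ i := by
  have hf0 : AnalyticAt ℂ (fun t : ℂ => f (0, t)) 0 :=
    AnalyticAt.comp (g := f) (f := fun t : ℂ => ((0 : E), t)) hf
      (analyticAt_const.prod analyticAt_id)
  obtain ⟨u, hu, hu0, hfu⟩ := (hf0.analyticOrderAt_eq_natCast).1 hk
  obtain ⟨R₁, hR₁, hb₁⟩ := Metric.eventually_nhds_iff_ball.1
    ((hu.eventually_analyticAt.and (hu.continuousAt.eventually_ne hu0)).and hfu)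
  obtain ⟨R₂, hR₂, hb₂⟩ := Metric.eventually_nhds_iff_ball.1
    (hf.eventually_analyticAt.and hg.eventually_analyticAt)
  set R := min R₁ R₂ with hR
  have hR0 : 0 < R := lt_min hR₁ hR₂
  obtain ⟨ρ, hρ, hρR⟩ := exists_between hR0
  have hsub : sphere (0 : ℂ) ρ ⊆ ball 0 R := sphere_subset_ball hρR
  have han : ∀ z ∈ ball (0 : E) R, ∀ t ∈ ball (0 : ℂ) R,
      AnalyticAt ℂ f (z, t) ∧ AnalyticAt ℂ g (z, t) := by
    intro z hz t ht
    apply hb₂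
    rw [← Prod.mk_zero_zero, ← ball_prod_same]
    exact ⟨ball_subset_ball (min_le_right _ _) hz, ball_subset_ball (min_le_right _ _) ht⟩
  have hub : ∀ t ∈ ball (0 : ℂ) R, AnalyticAt ℂ u t ∧ u t ≠ 0 ∧ f (0, t) = t ^ k * u t := by
    intro t ht
    obtain ⟨⟨h1, h2⟩, h3⟩ := hb₁ t (ball_subset_ball (min_le_left _ _) ht)
    exact ⟨h1, h2, by simpa using h3⟩
  have h0R : (0 : E) ∈ ball (0 : E) R := mem_ball_self hR0
  let K := sphere (0 : ℂ) ρ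
  have hK : IsCompact K := isCompact_sphere 0 ρ
  let fz : E → C(K, ℂ) := sliceOn K f
  let gz : E → C(K, ℂ) := sliceOn K g
  have hfz : AnalyticAt ℂ fz 0 := analyticAt_sliceOn hK fun t ht => (han 0 h0R t (hsub ht)).1
  have hgz : AnalyticAt ℂ gz 0 := analyticAt_sliceOn hK fun t ht => (han 0 h0R t (hsub ht)).2
  have hfz' : ∀ z ∈ ball (0 : E) R, ∀ t : K, fz z t = f (z, t) := fun z hz =>
    sliceOn_apply (continuous_iff_continuousAt.2 fun t =>
      ContinuousAt.comp (g := f) (f := fun t : K => (z, (t : ℂ)))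
        (han z hz t (hsub t.2)).1.continuousAt (by fun_prop))
  have hgz' : ∀ z ∈ ball (0 : E) R, ∀ t : K, gz z t = g (z, t) := fun z hz =>
    sliceOn_apply (continuous_iff_continuousAt.2 fun t =>
      ContinuousAt.comp (g := g) (f := fun t : K => (z, (t : ℂ)))
        (han z hz t (hsub t.2)).2.continuousAt (by fun_prop))
  have hdf : ∀ z ∈ ball (0 : E) R, DifferentiableOn ℂ (fun t => f (z, t)) (ball 0 R) :=
    fun z hz t ht => (DifferentiableAt.comp (g := f) (f := fun t : ℂ => (z, t)) t
      (han z hz t ht).1.differentiableAt (by fun_prop)).differentiableWithinAt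
  have hdg : ∀ z ∈ ball (0 : E) R, DifferentiableOn ℂ (fun t => g (z, t)) (ball 0 R) :=
    fun z hz t ht => (DifferentiableAt.comp (g := g) (f := fun t : ℂ => (z, t)) t
      (han z hz t ht).2.differentiableAt (by fun_prop)).differentiableWithinAt
  have hcl : ∀ φ : ℂ → ℂ, DifferentiableOn ℂ φ (ball 0 R) → DiffContOnCl ℂ φ (ball 0 ρ) :=
    fun φ hφ => hφ.diffContOnCl_ball (closedBall_subset_ball hρR)
  have hfH : ∀ z ∈ ball (0 : E) R, fz z ∈ discAlgebra ρ := fun z hz =>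
    mem_discAlgebra_of_differentiableOn hρ.le hρR (hdf z hz) (hfz' z hz)
  have hgH : ∀ z ∈ ball (0 : E) R, gz z ∈ discAlgebra ρ := fun z hz =>
    mem_discAlgebra_of_differentiableOn hρ.le hρR (hdg z hz) (hgz' z hz)
  have hvc : Continuous fun t : K => (u t)⁻¹ := continuous_iff_continuousAt.2 fun t =>
    ContinuousAt.inv₀ (ContinuousAt.comp (g := u) (f := fun t : K => (t : ℂ))
      (hub t (hsub t.2)).1.continuousAt (by fun_prop)) (hub t (hsub t.2)).2.1
  let v : C(K, ℂ) := ⟨_, hvc⟩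
  have hv : v ∈ discAlgebra ρ := mem_discAlgebra_of_differentiableOn hρ.le hρR
    (φ := fun t => (u t)⁻¹)
    (fun t ht => ((hub t ht).1.differentiableAt.inv (hub t ht).2.1).differentiableWithinAt)
    fun _ => rfl
  let A : E → (C(K, ℂ) →L[ℂ] C(K, ℂ)) := fun z => divisionOperator hρ k v (fz z)
  have hA : AnalyticAt ℂ A 0 := analyticAt_divisionOperator hρ k v hfz
  have hA0 : A 0 = 1 := by
    have h1 : fz 0 * v = circleCoord ρ ^ k := by
      ext t
      have h2 := hub t (hsub t.2)
      simp only [ContinuousMap.mul_apply, ContinuousMap.pow_apply]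
      rw [hfz' 0 h0R, h2.2.2, mul_assoc]
      change _ * (u t * (u t)⁻¹) = _
      rw [mul_inv_cancel₀ h2.2.1, mul_one]
      rfl
    refine ContinuousLinearMap.ext fun h => ?_
    have h3 := eq_sum_add_mul_divCoord_pow hρ k h
    rw [← h1] at h3
    change divisionOperator hρ k v (fz 0) h = h
    rw [divisionOperator_apply]
    conv_rhs => rw [h3]
    ring
  have hA1 : ∀ᶠ z in 𝓝 (0 : E), ‖1 - A z‖ < 1 := by
    have h1 : ContinuousAt (fun z => ‖1 - A z‖) 0 := (continuousAt_const.sub hA.continuousAt).norm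
    exact h1.eventually_lt continuousAt_const (by simp [hA0])
  let hh : E → C(K, ℂ) := fun z => Ring.inverse (A z) (gz z)
  have hhA : AnalyticAt ℂ hh 0 := by
    have h1 : AnalyticAt ℂ (fun z => Ring.inverse (A z)) 0 :=
      AnalyticAt.comp (g := Ring.inverse) (f := A)
        (by rw [hA0]; exact analyticAt_inverse (𝕜 := ℂ) (A := C(K, ℂ) →L[ℂ] C(K, ℂ)) 1) hA
    exact ((ContinuousLinearMap.id ℂ (C(K, ℂ) →L[ℂ] C(K, ℂ))).analyticAt_bilinear
      (Ring.inverse (A 0), gz 0)).fun_comp (x := (0 : E)) (f := fun z => (Ring.inverse (A z), gz z))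
        (h1.prod hgz)
  refine ⟨fun p => cauchyIntegral 0 hρ.le p.2 (v * (divCoord hρ ^ k) (hh p.1)),
    fun i z => cauchyIntegral 0 hρ.le 0 ((divCoord hρ ^ i) (hh z)), ?_, ?_, ?_⟩
  · exact analyticAt_cauchyIntegral_apply (x := (0 : E))
      (g := fun z => v * (divCoord hρ ^ k) (hh z))
      hρ.le (mem_ball_self hρ : (0 : ℂ) ∈ ball 0 ρ)
      (analyticAt_const.mul (((divCoord hρ ^ k).analyticAt _).comp hhA))
  · intro i
    exact ((cauchyIntegral 0 hρ.le 0).analyticAt _).comp (((divCoord hρ ^ i).analyticAt _).comp hhA)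
  · have hfst : Filter.Tendsto (Prod.fst : E × ℂ → E) (𝓝 0) (𝓝 0) := continuous_fst.tendsto 0
    have hsnd : Filter.Tendsto (Prod.snd : E × ℂ → ℂ) (𝓝 0) (𝓝 0) := continuous_snd.tendsto 0
    filter_upwards [hfst.eventually hA1, hfst.eventually (ball_mem_nhds _ hR0),
      hsnd.eventually (ball_mem_nhds _ hρ)] with p hp1 hp2 hp3
    have hunit : IsUnit (A p.1) := by
      have := isUnit_one_sub_of_norm_lt_one (R := C(K, ℂ) →L[ℂ] C(K, ℂ)) hp1
      rwa [sub_sub_cancel] at this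
    have hmem : hh p.1 ∈ discAlgebra ρ :=
      ring_inverse_apply_mem (H := Subalgebra.toSubmodule (discAlgebra ρ)) (isClosed_discAlgebra ρ)
        hp1 (fun h hh => divisionOperator_mem hρ k hv (hfH _ hp2) hh) (hgH _ hp2)
    have h1 : gz p.1 = A p.1 (hh p.1) := by
      have := congrArg (fun B => B (gz p.1)) (Ring.mul_inverse_cancel _ hunit)
      exact this.symm
    have h2 := congrArg (cauchyIntegral 0 hρ.le p.2) h1
    change _ = cauchyIntegral 0 hρ.le p.2 (divisionOperator hρ k v (fz p.1) (hh p.1)) at h2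
    rw [divisionOperator_apply, map_add, map_sum, cauchyIntegral_mul hρ hp3
      (mul_mem hv (divCoord_pow_mem hρ k hmem)) (hfz' _ hp2) (hcl _ (hdf _ hp2)),
      cauchyIntegral_eq hρ.le hp3 (hgz' _ hp2) (hcl _ (hdg _ hp2))] at h2
    change g p = _ at h2
    rw [h2]
    congr 1
    refine Finset.sum_congr rfl fun i _ => ?_
    have h3 := cauchyIntegral_aeval hρ hp3 (X ^ i) (F := 1) (φ := fun _ => 1) (fun _ => rfl)
      diffContOnCl_const
    rw [map_smul, smul_eq_mul]
    congr 1
    simpa using h3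

end WeierstrassDivision

/-! ### The ring of germs of analytic functions -/

section AnalyticGerm

open Filter

variable (E : Type*) [NormedAddCommGroup E] [NormedSpace ℂ E]
  {E' : Type*} [NormedAddCommGroup E'] [NormedSpace ℂ E']
  {E'' : Type*} [NormedAddCommGroup E''] [NormedSpace ℂ E'']

/-- The germs at `0` of analytic functions on `E`, as a subring. -/
def analyticGermSubring : Subring (Germ (𝓝 (0 : E)) ℂ) where
  carrier := {φ | ∃ F : E → ℂ, AnalyticAt ℂ F 0 ∧ φ = (F : Germ (𝓝 (0 : E)) ℂ)}
  mul_mem' := by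
    rintro _ _ ⟨F, hF, rfl⟩ ⟨G, hG, rfl⟩
    exact ⟨F * G, hF.mul hG, rfl⟩
  add_mem' := by
    rintro _ _ ⟨F, hF, rfl⟩ ⟨G, hG, rfl⟩
    exact ⟨F + G, hF.add hG, rfl⟩
  one_mem' := ⟨fun _ => 1, analyticAt_const, rfl⟩
  zero_mem' := ⟨fun _ => 0, analyticAt_const, rfl⟩
  neg_mem' := by
    rintro _ ⟨F, hF, rfl⟩
    exact ⟨-F, hF.neg, rfl⟩

/-- The ring of germs at `0` of analytic functions on `E`. -/
def AnalyticGerm : Type _ := analyticGermSubring E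

noncomputable instance : CommRing (AnalyticGerm E) :=
  inferInstanceAs (CommRing (analyticGermSubring E))

variable {E}

namespace AnalyticGerm

/-- The inclusion into the ring of germs of all functions. -/
noncomputable def toGerm : AnalyticGerm E →+* Germ (𝓝 (0 : E)) ℂ := (analyticGermSubring E).subtype

theorem toGerm_injective : Function.Injective (toGerm (E := E)) := Subtype.val_injective

/-- The germ of an analytic function. -/
def mk (F : E → ℂ) (hF : AnalyticAt ℂ F 0) : AnalyticGerm E := ⟨F, F, hF, rfl⟩

/-- A function representing the germ. -/
noncomputable def rep (φ : AnalyticGerm E) : E → ℂ := φ.2.choose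

theorem analyticAt_rep (φ : AnalyticGerm E) : AnalyticAt ℂ φ.rep 0 := φ.2.choose_spec.1

theorem coe_rep (φ : AnalyticGerm E) : (φ.rep : Germ (𝓝 (0 : E)) ℂ) = toGerm φ :=
  φ.2.choose_spec.2.symm

@[simp] theorem mk_rep (φ : AnalyticGerm E) : mk φ.rep φ.analyticAt_rep = φ :=
  toGerm_injective φ.coe_rep

theorem mk_eq_mk_iff {F G : E → ℂ} {hF : AnalyticAt ℂ F 0} {hG : AnalyticAt ℂ G 0} :
    mk F hF = mk G hG ↔ F =ᶠ[𝓝 0] G :=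
  toGerm_injective.eq_iff.symm.trans Germ.coe_eq

theorem rep_mk (F : E → ℂ) (hF : AnalyticAt ℂ F 0) : (mk F hF).rep =ᶠ[𝓝 0] F := by
  rw [← mk_eq_mk_iff (hF := analyticAt_rep _) (hG := hF), mk_rep]

theorem mk_eq_zero_iff {F : E → ℂ} {hF : AnalyticAt ℂ F 0} :
    mk F hF = 0 ↔ ∀ᶠ x in 𝓝 0, F x = 0 :=
  mk_eq_mk_iff (hG := (analyticAt_const : AnalyticAt ℂ (fun _ : E => (0 : ℂ)) 0))

theorem eq_zero_iff {φ : AnalyticGerm E} : φ = 0 ↔ ∀ᶠ x in 𝓝 0, φ.rep x = 0 := by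
  conv_lhs => rw [← φ.mk_rep, mk_eq_zero_iff]

/-- Substitution of a function that tends to `0` into a germ. -/
noncomputable def evalAlong {α : Type*} {l : Filter α} (u : α → E) (hu : Tendsto u l (𝓝 0)) :
    AnalyticGerm E →+* Germ l ℂ where
  toFun φ := (toGerm φ).compTendsto u hu
  map_one' := rfl
  map_zero' := rfl
  map_mul' := by
    rintro ⟨_, F, hF, rfl⟩ ⟨_, G, hG, rfl⟩
    rfl
  map_add' := by
    rintro ⟨_, F, hF, rfl⟩ ⟨_, G, hG, rfl⟩
    rfl

theorem evalAlong_mk {α : Type*} {l : Filter α} (u : α → E) (hu : Tendsto u l (𝓝 0))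
    (F : E → ℂ) (hF : AnalyticAt ℂ F 0) : evalAlong u hu (mk F hF) = ((F ∘ u : α → ℂ) : Germ l ℂ) :=
  rfl

theorem evalAlong_eq {α : Type*} {l : Filter α} (u : α → E) (hu : Tendsto u l (𝓝 0))
    (φ : AnalyticGerm E) : evalAlong u hu φ = ((φ.rep ∘ u : α → ℂ) : Germ l ℂ) := by
  conv_lhs => rw [← φ.mk_rep, evalAlong_mk]

/-- The value of a germ at `0`. -/
noncomputable def value : AnalyticGerm E →+* ℂ :=
  Germ.valueRingHom.comp toGerm

@[simp] theorem value_mk (F : E → ℂ) (hF : AnalyticAt ℂ F 0) : value (mk F hF) = F 0 := rfl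

theorem value_eq (φ : AnalyticGerm E) : value φ = φ.rep 0 := by
  conv_lhs => rw [← φ.mk_rep, value_mk]

theorem isUnit_iff {φ : AnalyticGerm E} : IsUnit φ ↔ value φ ≠ 0 := by
  constructor
  · intro h
    exact (h.map value).ne_zero
  · intro h
    rw [value_eq] at h
    refine IsUnit.of_mul_eq_one (mk (fun x => (φ.rep x)⁻¹) (φ.analyticAt_rep.inv h)) ?_
    have h1 : ∀ᶠ x in 𝓝 (0 : E), φ.rep x ≠ 0 := φ.analyticAt_rep.continuousAt.eventually_ne h
    have h2 : mk (fun x => φ.rep x * (φ.rep x)⁻¹) (φ.analyticAt_rep.mul (φ.analyticAt_rep.inv h)) =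
        (1 : AnalyticGerm E) := by
      refine (mk_eq_mk_iff (hG := analyticAt_const (v := (1 : ℂ)))).2 ?_
      filter_upwards [h1] with x hx
      exact mul_inv_cancel₀ hx
    rw [← h2]
    nth_rw 1 [← φ.mk_rep]
    rfl

instance : Nontrivial (AnalyticGerm E) := value.domain_nontrivial

instance : IsLocalRing (AnalyticGerm E) := by
  refine IsLocalRing.of_nonunits_add fun a b ha hb => ?_
  simp only [mem_nonunits_iff, isUnit_iff, not_not] at *
  rw [map_add, ha, hb, add_zero]

theorem mem_maximalIdeal_iff {φ : AnalyticGerm E} :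
    φ ∈ IsLocalRing.maximalIdeal (AnalyticGerm E) ↔ value φ = 0 := by
  rw [IsLocalRing.mem_maximalIdeal, mem_nonunits_iff, isUnit_iff, not_not]

/-- An analytic function on a ball that vanishes near one point of the ball vanishes. -/
theorem _root_.AnalyticOnNhd.eqOn_zero_ball {F : E → ℂ} {x : E} {R : ℝ}
    (hF : AnalyticOnNhd ℂ F (Metric.ball x R)) {y : E} (hy : y ∈ Metric.ball x R)
    (h : ∀ᶠ z in 𝓝 y, F z = 0) : ∀ z ∈ Metric.ball x R, F z = 0 := fun _ hz =>
  hF.eqOn_zero_of_preconnected_of_eventuallyEq_zero (convex_ball x R).isPreconnected hy h hz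

theorem exists_ball (φ : AnalyticGerm E) : ∃ R > 0, AnalyticOnNhd ℂ φ.rep (Metric.ball 0 R) := by
  obtain ⟨R, hR, h⟩ := Metric.eventually_nhds_iff_ball.1 φ.analyticAt_rep.eventually_analyticAt
  exact ⟨R, hR, h⟩

/-- A germ that is not zero is not zero at nearby points. -/
theorem eventually_frequently_ne_zero {φ : AnalyticGerm E} (h : φ ≠ 0) :
    ∀ᶠ x in 𝓝 (0 : E), ∃ᶠ y in 𝓝 x, φ.rep y ≠ 0 := by
  obtain ⟨R, hR, hb⟩ := φ.exists_ball
  filter_upwards [Metric.ball_mem_nhds 0 hR] with x hx hn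
  simp only [not_not] at hn
  refine h (eq_zero_iff.2 ?_)
  filter_upwards [Metric.ball_mem_nhds 0 hR] with y hy
  exact hb.eqOn_zero_ball hx hn y hy

instance : IsDomain (AnalyticGerm E) := by
  have : NoZeroDivisors (AnalyticGerm E) := ⟨by
    intro a b hab
    by_contra! h
    have h1 : ∀ᶠ x in 𝓝 (0 : E), a.rep x * b.rep x = 0 := by
      have : a * b = 0 := hab
      rw [← a.mk_rep, ← b.mk_rep] at this
      exact Germ.coe_eq.1 (congrArg toGerm this)
    obtain ⟨x, hx1, hx2, hx3⟩ := ((eventually_frequently_ne_zero h.1).self_of_nhds.and_eventually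
      ((eventually_frequently_ne_zero h.2).and (eventually_eventually_nhds.2
        (h1.and a.analyticAt_rep.eventually_analyticAt)))).exists
    have h4 := (hx3.self_of_nhds.2.continuousAt.eventually_ne hx1)
    obtain ⟨y, hy1, hy2, hy3⟩ := (hx2.and_eventually (h4.and hx3)).exists
    exact (mul_ne_zero hy2 hy1) hy3.1⟩
  exact NoZeroDivisors.to_isDomain _

/-- Composition of germs with a continuous linear map. -/
noncomputable def pull (L : E →L[ℂ] E') : AnalyticGerm E' →+* AnalyticGerm E :=
  (evalAlong (l := 𝓝 (0 : E)) L (by simpa using L.continuous.tendsto 0)).codRestrict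
    (analyticGermSubring E) (by
      rintro ⟨_, F, hF, rfl⟩
      exact ⟨F ∘ L, AnalyticAt.comp (by simpa using hF) (L.analyticAt 0), rfl⟩)

theorem analyticAt_comp_clm {F : E' → ℂ} (hF : AnalyticAt ℂ F 0) (L : E →L[ℂ] E') :
    AnalyticAt ℂ (F ∘ L) 0 :=
  AnalyticAt.comp (by simpa using hF) (L.analyticAt 0)

theorem pull_mk (L : E →L[ℂ] E') (F : E' → ℂ) (hF : AnalyticAt ℂ F 0) :
    pull L (mk F hF) = mk (F ∘ L) (analyticAt_comp_clm hF L) := rfl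

theorem pull_pull (L : E →L[ℂ] E') (L' : E' →L[ℂ] E'') (φ : AnalyticGerm E'') :
    pull L (pull L' φ) = pull (L'.comp L) φ := by
  rw [← φ.mk_rep]; rfl

@[simp] theorem pull_id (φ : AnalyticGerm E) : pull (ContinuousLinearMap.id ℂ E) φ = φ := by
  rw [← φ.mk_rep]; rfl

theorem rep_pull (L : E →L[ℂ] E') (φ : AnalyticGerm E') :
    (pull L φ).rep =ᶠ[𝓝 0] φ.rep ∘ L := by
  conv_lhs => rw [← φ.mk_rep, pull_mk]
  exact rep_mk _ _

theorem evalAlong_pull {α : Type*} {l : Filter α} (u : α → E) (hu : Tendsto u l (𝓝 0))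
    (L : E →L[ℂ] E') (hL : Tendsto (L ∘ u) l (𝓝 0)) (φ : AnalyticGerm E') :
    evalAlong u hu (pull L φ) = evalAlong (L ∘ u) hL φ := by
  rw [← φ.mk_rep]; rfl

/-- The rings of germs of isomorphic spaces are isomorphic. -/
noncomputable def pullEquiv (L : E ≃L[ℂ] E') : AnalyticGerm E' ≃+* AnalyticGerm E :=
  RingEquiv.ofRingHom (pull (L : E →L[ℂ] E')) (pull (L.symm : E' →L[ℂ] E))
    (by ext1 φ; simp [pull_pull]) (by ext1 φ; simp [pull_pull])

/-- The germ of a linear functional. -/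
noncomputable def ofDual (ℓ : E →L[ℂ] ℂ) : AnalyticGerm E := mk ℓ (ℓ.analyticAt 0)

theorem pull_ofDual (L : E →L[ℂ] E') (ℓ : E' →L[ℂ] ℂ) : pull L (ofDual ℓ) = ofDual (ℓ.comp L) := rfl

theorem value_ofDual (ℓ : E →L[ℂ] ℂ) : value (ofDual ℓ) = 0 := by simp [ofDual]

/-- Constant germs. -/
noncomputable def const : ℂ →+* AnalyticGerm E where
  toFun c := mk (fun _ => c) analyticAt_const
  map_one' := rfl
  map_mul' _ _ := rfl
  map_zero' := rfl
  map_add' _ _ := rfl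

/-- A nonzero germ has finite order along some line through `0`. -/
theorem exists_line {φ : AnalyticGerm E} (h : φ ≠ 0) [Nontrivial E] :
    ∃ e : E, e ≠ 0 ∧ ∃ k : ℕ, analyticOrderAt (fun t : ℂ => φ.rep (t • e)) 0 = k := by
  have han : ∀ e : E, AnalyticAt ℂ (fun t : ℂ => φ.rep (t • e)) 0 := fun e =>
    AnalyticAt.comp (g := φ.rep) (f := fun t : ℂ => t • e) (by simpa using φ.analyticAt_rep)
      (by fun_prop)
  suffices ∃ e : E, e ≠ 0 ∧ ¬ ∀ᶠ t in 𝓝 (0 : ℂ), φ.rep (t • e) = 0 by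
    obtain ⟨e, he, h1⟩ := this
    refine ⟨e, he, ?_⟩
    rw [← analyticOrderAt_eq_top] at h1
    exact ⟨_, (ENat.natCast_toNat h1).symm⟩
  by_cases h0 : φ.rep 0 = 0
  · obtain ⟨R, hR, hb⟩ := φ.exists_ball
    obtain ⟨y, hy, hyR⟩ := ((eventually_frequently_ne_zero h).self_of_nhds.and_eventually
      (Metric.ball_mem_nhds 0 hR)).exists
    refine ⟨y, by rintro rfl; exact hy h0, fun hn => hy ?_⟩
    let s : Set ℂ := (fun t : ℂ => t • y) ⁻¹' Metric.ball 0 R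
    have hs : Convex ℝ s :=
      (convex_ball (0 : E) R).is_linear_preimage
        (f := fun t : ℂ => t • y) ⟨fun a b => add_smul a b y, fun c a => smul_assoc c a y⟩
    have h1 : AnalyticOnNhd ℂ (fun t : ℂ => φ.rep (t • y)) s := fun t ht =>
      AnalyticAt.comp (g := φ.rep) (f := fun t : ℂ => t • y) (hb _ ht) (by fun_prop)
    have h2 := h1.eqOn_zero_of_preconnected_of_eventuallyEq_zero hs.isPreconnected
      (z₀ := 0) (by simp [s, hR]) hn (x := 1) (by simpa [s] using hyR)
    simpa using h2
  · obtain ⟨e, he⟩ := exists_ne (0 : E)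
    refine ⟨e, he, fun hn => h0 ?_⟩
    simpa using hn.self_of_nhds

end AnalyticGerm

end AnalyticGerm

/-! ### Estimates for roots of polynomials -/

section PolynomialEstimates

open Filter Polynomial

/-- The roots of a monic polynomial with small lower coefficients are small. -/
theorem eventually_norm_lt_of_pow_eq_sum {α : Type*} {l : Filter α} {k : ℕ} {c : ℕ → α → ℂ}
    (hc : ∀ i < k, Tendsto (c i) l (𝓝 0)) {ε : ℝ} (hε : 0 < ε) :
    ∀ᶠ a in l, ∀ τ : ℂ, τ ^ k = ∑ i ∈ Finset.range k, c i a * τ ^ i → ‖τ‖ < ε := by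
  have h1 : Tendsto (fun a => ∑ i ∈ Finset.range k, ‖c i a‖ * ε ^ i) l (𝓝 0) := by
    have : (0 : ℝ) = ∑ i ∈ Finset.range k, 0 * ε ^ i := by simp
    rw [this]
    exact tendsto_finsetSum _ fun i hi =>
      (tendsto_zero_iff_norm_tendsto_zero.1 (hc i (Finset.mem_range.1 hi))).mul_const _
  filter_upwards [h1.eventually_lt_const (pow_pos hε k)] with a hlt τ ha
  by_contra! hge
  have h2 : 1 ≤ ‖τ‖ / ε := (one_le_div hε).2 hge
  have h3 : ‖τ‖ ^ k ≤ (‖τ‖ / ε) ^ k * ∑ i ∈ Finset.range k, ‖c i a‖ * ε ^ i := by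
    rw [← norm_pow, ha, Finset.mul_sum]
    refine (norm_sum_le _ _).trans (Finset.sum_le_sum fun i hi => ?_)
    rw [norm_mul, norm_pow]
    have h4 : ‖τ‖ ^ i = (‖τ‖ / ε) ^ i * ε ^ i := by
      rw [← mul_pow, div_mul_cancel₀ _ hε.ne']
    rw [h4]
    have h5 : (‖τ‖ / ε) ^ i ≤ (‖τ‖ / ε) ^ k :=
      pow_le_pow_right₀ h2 (Finset.mem_range.1 hi).le
    calc ‖c i a‖ * ((‖τ‖ / ε) ^ i * ε ^ i) = (‖τ‖ / ε) ^ i * (‖c i a‖ * ε ^ i) := by ring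
      _ ≤ _ := by gcongr
  have h6 : (‖τ‖ / ε) ^ k * ∑ i ∈ Finset.range k, ‖c i a‖ * ε ^ i <
      (‖τ‖ / ε) ^ k * ε ^ k := by
    have : 0 < (‖τ‖ / ε) ^ k := by positivity
    gcongr
  rw [← mul_pow, div_mul_cancel₀ _ hε.ne'] at h6
  linarith

theorem tendsto_zero_of_pow_eq_sum {α : Type*} {l : Filter α} {k : ℕ} {c : ℕ → α → ℂ}
    (hc : ∀ i < k, Tendsto (c i) l (𝓝 0)) {τ : α → ℂ}
    (hτ : ∀ᶠ a in l, τ a ^ k = ∑ i ∈ Finset.range k, c i a * τ a ^ i) : Tendsto τ l (𝓝 0) := by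
  rw [Metric.tendsto_nhds]
  intro ε hε
  filter_upwards [hτ, eventually_norm_lt_of_pow_eq_sum hc hε] with a ha h
  rw [dist_zero_right]
  exact h _ ha

/-- A monic polynomial that bounds another polynomial near its own roots divides it. -/
theorem Polynomial.dvd_of_norm_eval_le {U : Set ℂ} (hU : IsOpen U) {C : ℝ} (n : ℕ) :
    ∀ {p r : ℂ[X]}, p.Monic → p.natDegree = n → (∀ t, p.eval t = 0 → t ∈ U) →
      (∀ t ∈ U, ‖r.eval t‖ ≤ C * ‖p.eval t‖) → p ∣ r := by
  induction n with
  | zero =>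
    intro p r hp hn _ _
    rw [hp.natDegree_eq_zero.1 hn]
    exact one_dvd r
  | succ n ih =>
    intro p r hp hn hU' hb
    obtain ⟨α, hα⟩ := IsAlgClosed.exists_root p (by
      rw [degree_eq_natDegree hp.ne_zero, hn]; exact_mod_cast n.succ_ne_zero)
    have hαU := hU' α hα
    obtain ⟨p₁, rfl⟩ := dvd_iff_isRoot.2 hα
    have hrα : r.eval α = 0 := by
      have := hb α hαU
      rw [show eval α ((X - Polynomial.C α) * p₁) = 0 from hα, norm_zero, mul_zero] at this
      exact norm_le_zero_iff.1 this
    obtain ⟨r₁, rfl⟩ := dvd_iff_isRoot.2 (show IsRoot r α from hrα)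
    have hp₁ : p₁.Monic := (monic_X_sub_C α).of_mul_monic_left hp
    refine mul_dvd_mul_left _ (ih hp₁ ?_ (fun t ht => hU' t (by simp [ht])) ?_)
    · rw [(monic_X_sub_C α).natDegree_mul hp₁, natDegree_X_sub_C] at hn
      omega
    · have h1 : ∀ t ∈ U \ {α}, ‖r₁.eval t‖ ≤ C * ‖p₁.eval t‖ := by
        rintro t ⟨ht, hne⟩
        have h2 := hb t ht
        simp only [eval_mul, eval_sub, eval_X, eval_C, norm_mul] at h2
        have h3 : 0 < ‖t - α‖ := norm_pos_iff.2 (sub_ne_zero.2 hne)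
        refine le_of_mul_le_mul_left ?_ h3
        linarith
      intro t ht
      by_cases h : t = α
      · subst h
        have h2 : ∀ᶠ s in 𝓝[≠] t, ‖r₁.eval s‖ ≤ C * ‖p₁.eval s‖ := by
          filter_upwards [self_mem_nhdsWithin, nhdsWithin_le_nhds (hU.mem_nhds ht)] with s hs hs'
          exact h1 s ⟨hs', hs⟩
        exact le_of_tendsto_of_tendsto
          ((r₁.continuous.norm.tendsto t).mono_left nhdsWithin_le_nhds)
          (((continuous_const.mul p₁.continuous.norm).tendsto t).mono_left nhdsWithin_le_nhds) h2
      · exact h1 t ⟨ht, h⟩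

/-- An element that is integral of degree `N` over the multiples of `b` is bounded by a multiple
of `b`. -/
theorem norm_le_of_sum_eq_zero {N : ℕ} {a b : ℂ} {c : ℕ → ℂ} (hN : c N = 1)
    (h : ∑ i ∈ Finset.range (N + 1), c i * b ^ (N - i) * a ^ i = 0) :
    ‖a‖ ≤ (1 + ∑ i ∈ Finset.range N, ‖c i‖) * ‖b‖ := by
  rw [Finset.sum_range_succ, hN, Nat.sub_self, pow_zero, one_mul, one_mul] at h
  have h1 : ‖a‖ ^ N ≤ ∑ i ∈ Finset.range N, ‖c i‖ * ‖b‖ ^ (N - i) * ‖a‖ ^ i := by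
    rw [← norm_pow, eq_neg_of_add_eq_zero_right h, norm_neg]
    refine (norm_sum_le _ _).trans (le_of_eq ?_)
    simp [norm_pow]
  set S := ∑ i ∈ Finset.range N, ‖c i‖ with hS
  have hS0 : 0 ≤ S := Finset.sum_nonneg fun _ _ => norm_nonneg _
  by_contra! hlt
  have hba : ‖b‖ ≤ ‖a‖ := by nlinarith [norm_nonneg b]
  have ha : 0 < ‖a‖ := lt_of_le_of_lt (by positivity) hlt
  rcases Nat.eq_zero_or_pos N with rfl | hN0
  · simp at h1
    linarith
  have h2 : ‖a‖ ^ N ≤ S * ‖b‖ * ‖a‖ ^ (N - 1) := by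
    refine h1.trans ?_
    rw [hS, Finset.sum_mul, Finset.sum_mul]
    refine Finset.sum_le_sum fun i hi => ?_
    have hi' := Finset.mem_range.1 hi
    have e1 : N - i = (N - i - 1) + 1 := by omega
    have e2 : N - 1 = (N - i - 1) + i := by omega
    rw [e1, pow_succ, e2, pow_add]
    calc ‖c i‖ * (‖b‖ ^ (N - i - 1) * ‖b‖) * ‖a‖ ^ i
        = ‖c i‖ * ‖b‖ * (‖b‖ ^ (N - i - 1) * ‖a‖ ^ i) := by ring
      _ ≤ _ := by gcongr
  have h3 : ‖a‖ ^ N = ‖a‖ * ‖a‖ ^ (N - 1) := by rw [← pow_succ']; congr 1; omega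
  rw [h3] at h2
  have h4 := le_of_mul_le_mul_right h2 (pow_pos ha _)
  nlinarith [norm_nonneg b]

end PolynomialEstimates

/-! ### Weierstrass division of germs -/

namespace AnalyticGerm

open Filter

variable {E : Type*} [NormedAddCommGroup E] [NormedSpace ℂ E]
  {E' : Type*} [NormedAddCommGroup E'] [NormedSpace ℂ E']

theorem eventually_rep_mul (φ γ : AnalyticGerm E) :
    (φ * γ).rep =ᶠ[𝓝 0] fun x => φ.rep x * γ.rep x := by
  have h1 : φ * γ = mk (fun x => φ.rep x * γ.rep x) (φ.analyticAt_rep.mul γ.analyticAt_rep) := by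
    conv_lhs => rw [← φ.mk_rep, ← γ.mk_rep]
    rfl
  rw [h1]
  exact rep_mk _ _

theorem eventually_rep_add (φ γ : AnalyticGerm E) :
    (φ + γ).rep =ᶠ[𝓝 0] fun x => φ.rep x + γ.rep x := by
  have h1 : φ + γ = mk (fun x => φ.rep x + γ.rep x) (φ.analyticAt_rep.add γ.analyticAt_rep) := by
    conv_lhs => rw [← φ.mk_rep, ← γ.mk_rep]
    rfl
  rw [h1]
  exact rep_mk _ _

theorem eventually_rep_sum {ι : Type*} (s : Finset ι) (φ : ι → AnalyticGerm E) :
    (∑ i ∈ s, φ i).rep =ᶠ[𝓝 0] fun x => ∑ i ∈ s, (φ i).rep x := by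
  classical
  induction s using Finset.induction_on with
  | empty =>
    simp only [Finset.sum_empty]
    exact eq_zero_iff.1 rfl
  | insert a s ha ih =>
    rw [Finset.sum_insert ha]
    filter_upwards [eventually_rep_add (φ a) (∑ i ∈ s, φ i), ih] with x h1 h2
    rw [h1, h2, Finset.sum_insert ha]

theorem eventually_rep_pow (φ : AnalyticGerm E) (n : ℕ) :
    (φ ^ n).rep =ᶠ[𝓝 0] fun x => φ.rep x ^ n := by
  have h1 : φ ^ n = mk (fun x => φ.rep x ^ n) (φ.analyticAt_rep.pow n) := by
    conv_lhs => rw [← φ.mk_rep]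
    rfl
  rw [h1]
  exact rep_mk _ _

theorem rep_ofDual (ℓ : E →L[ℂ] ℂ) : (ofDual ℓ).rep =ᶠ[𝓝 0] ℓ := rep_mk _ _

/-- The Weierstrass division theorem for germs, in coordinates `E ≃ E' × ℂ`. -/
theorem exists_division [FiniteDimensional ℂ E'] (Ψ : E ≃L[ℂ] E' × ℂ) {φ : AnalyticGerm E} {k : ℕ}
    (hk : analyticOrderAt (fun t : ℂ => φ.rep (Ψ.symm (0, t))) 0 = k) (γ : AnalyticGerm E) :
    ∃ (q : AnalyticGerm E) (r : ℕ → AnalyticGerm E'), γ = q * φ + ∑ i ∈ Finset.range k,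
      pull ((ContinuousLinearMap.fst ℂ E' ℂ).comp (Ψ : E →L[ℂ] E' × ℂ)) (r i) *
        ofDual ((ContinuousLinearMap.snd ℂ E' ℂ).comp (Ψ : E →L[ℂ] E' × ℂ)) ^ i := by
  obtain ⟨q, r, hq, hr, h⟩ := weierstrass_division
    (analyticAt_comp_clm φ.analyticAt_rep (Ψ.symm : E' × ℂ →L[ℂ] E))
    (analyticAt_comp_clm γ.analyticAt_rep (Ψ.symm : E' × ℂ →L[ℂ] E)) hk
  have hq' := analyticAt_comp_clm hq (Ψ : E →L[ℂ] E' × ℂ)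
  refine ⟨mk _ hq', fun i => mk (r i) (hr i), ?_⟩
  rw [← γ.mk_rep]
  have h1 : Tendsto Ψ (𝓝 0) (𝓝 0) := by simpa using Ψ.continuous.tendsto 0
  have h2 := h1.eventually h
  apply toGerm_injective
  rw [← coe_rep, ← coe_rep, Germ.coe_eq]
  refine (rep_mk _ _).trans ?_
  refine EventuallyEq.trans ?_ (eventually_rep_add _ _).symm
  refine EventuallyEq.trans ?_
    ((eventually_rep_mul _ _).symm.add (eventually_rep_sum _ _).symm)
  have h3 : ∀ᶠ x in 𝓝 (0 : E), ∀ i ∈ Finset.range k,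
      (pull ((ContinuousLinearMap.fst ℂ E' ℂ).comp (Ψ : E →L[ℂ] E' × ℂ)) (mk (r i) (hr i)) *
        ofDual ((ContinuousLinearMap.snd ℂ E' ℂ).comp (Ψ : E →L[ℂ] E' × ℂ)) ^ i).rep x =
      r i (Ψ x).1 * (Ψ x).2 ^ i := by
    rw [Filter.eventually_all_finset]
    intro i _
    filter_upwards [eventually_rep_mul (pull ((ContinuousLinearMap.fst ℂ E' ℂ).comp
      (Ψ : E →L[ℂ] E' × ℂ)) (mk (r i) (hr i)))
      (ofDual ((ContinuousLinearMap.snd ℂ E' ℂ).comp (Ψ : E →L[ℂ] E' × ℂ)) ^ i),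
      eventually_rep_pow (ofDual ((ContinuousLinearMap.snd ℂ E' ℂ).comp
        (Ψ : E →L[ℂ] E' × ℂ))) i, rep_ofDual ((ContinuousLinearMap.snd ℂ E' ℂ).comp
        (Ψ : E →L[ℂ] E' × ℂ)), rep_mk _ (analyticAt_comp_clm (hr i) ((ContinuousLinearMap.fst ℂ
        E' ℂ).comp (Ψ : E →L[ℂ] E' × ℂ)))] with x h1 h2 h3 h4
    rw [h1, h2, h3, pull_mk, h4]
    rfl
  filter_upwards [h2, h3, rep_mk _ hq'] with x hx hx3 hx4
  rw [Pi.add_apply, Finset.sum_congr rfl hx3, hx4]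
  simpa using hx

end AnalyticGerm

/-! ### The ring of germs is noetherian -/

namespace AnalyticGerm

open Filter

variable {E : Type*} [NormedAddCommGroup E] [NormedSpace ℂ E]
  {E' : Type*} [NormedAddCommGroup E'] [NormedSpace ℂ E']

/-- Coordinates in which a given non-zero vector is the last basis vector. -/
theorem exists_split [FiniteDimensional ℂ E] {n : ℕ} (hn : Module.finrank ℂ E = n + 1) {e : E}
    (he : e ≠ 0) : ∃ Ψ : E ≃L[ℂ] (Fin n → ℂ) × ℂ, Ψ e = (0, 1) := by
  obtain ⟨ℓ, hℓ⟩ := SeparatingDual.exists_eq_one (R := ℂ) he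
  have hr : Function.RightInverse (ContinuousLinearMap.toSpanSingleton ℂ e) ℓ := fun c => by
    simp [hℓ]
  let Ψ₁ := ContinuousLinearEquiv.equivOfRightInverse ℓ _ hr
  have h1 : Module.finrank ℂ ℓ.ker = n := by
    have h2 := Ψ₁.toLinearEquiv.finrank_eq
    rw [Module.finrank_prod, Module.finrank_self, hn] at h2
    omega
  let Ψ₂ : ℓ.ker ≃L[ℂ] (Fin n → ℂ) := ContinuousLinearEquiv.ofFinrankEq (by simp [h1])
  refine ⟨Ψ₁.trans ((ContinuousLinearEquiv.prodComm ℂ ℂ ℓ.ker).trans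
    (Ψ₂.prodCongr (ContinuousLinearEquiv.refl ℂ ℂ))), ?_⟩
  have h3 : Ψ₁ e = (1, 0) := by
    refine Prod.ext ?_ ?_
    · simp [Ψ₁, hℓ]
    · apply Subtype.ext
      simp [Ψ₁, hℓ]
  simp [h3]

theorem exists_split_of_ne_zero [FiniteDimensional ℂ E] {n : ℕ} (hn : Module.finrank ℂ E = n + 1)
    {φ : AnalyticGerm E} (hφ : φ ≠ 0) : ∃ (Ψ : E ≃L[ℂ] (Fin n → ℂ) × ℂ) (k : ℕ),
      analyticOrderAt (fun t : ℂ => φ.rep (Ψ.symm (0, t))) 0 = k := by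
  have : Nontrivial E := Module.nontrivial_of_finrank_pos (R := ℂ) (by omega)
  obtain ⟨e, he, k, hk⟩ := exists_line hφ
  obtain ⟨Ψ, hΨ⟩ := exists_split hn he
  refine ⟨Ψ, k, ?_⟩
  rw [← hk]
  congr 1
  ext t
  congr 1
  rw [ContinuousLinearEquiv.symm_apply_eq, map_smul, hΨ]
  simp

theorem eq_const_of_finrank_eq_zero [FiniteDimensional ℂ E] (h : Module.finrank ℂ E = 0)
    (φ : AnalyticGerm E) : φ = const (value φ) := by
  have : Subsingleton E := Module.finrank_zero_iff.1 h
  conv_lhs => rw [← φ.mk_rep]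
  refine (mk_eq_mk_iff (hG := analyticAt_const)).2 (Eventually.of_forall fun x => ?_)
  rw [value_eq, Subsingleton.elim x 0]

/-- The projection to the first factor in given coordinates. -/
noncomputable abbrev prFst (Ψ : E ≃L[ℂ] E' × ℂ) : E →L[ℂ] E' :=
  (ContinuousLinearMap.fst ℂ E' ℂ).comp (Ψ : E →L[ℂ] E' × ℂ)

/-- The last coordinate. -/
noncomputable abbrev prSnd (Ψ : E ≃L[ℂ] E' × ℂ) : E →L[ℂ] ℂ :=
  (ContinuousLinearMap.snd ℂ E' ℂ).comp (Ψ : E →L[ℂ] E' × ℂ)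

/-- A ring is finite over `A` if all its elements are polynomials over `A` of degree less than `k`
in a fixed element. -/
theorem _root_.RingHom.finite_of_sum_pow {A B : Type*} [CommRing A] [CommRing B] (f : A →+* B)
    (t : B) (k : ℕ) (h : ∀ b, ∃ r : ℕ → A, b = ∑ i ∈ Finset.range k, f (r i) * t ^ i) :
    f.Finite := by
  classical
  let _ := f.toAlgebra
  change Module.Finite A B
  refine ⟨⟨(Finset.range k).image (fun i => t ^ i), ?_⟩⟩
  rw [eq_top_iff]
  intro b _
  obtain ⟨r, rfl⟩ := h b
  refine Submodule.sum_mem _ fun i hi => ?_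
  have : f (r i) * t ^ i = r i • t ^ i := rfl
  rw [this]
  exact Submodule.smul_mem _ _ (Submodule.subset_span (by
    simp only [Finset.coe_image, Set.mem_image]
    exact ⟨i, hi, rfl⟩))

/-- By Weierstrass division, a quotient by an ideal that contains a germ of finite order in the
last coordinate is finite over the germs in the other coordinates. -/
theorem finite_quotient [FiniteDimensional ℂ E'] (Ψ : E ≃L[ℂ] E' × ℂ) {φ : AnalyticGerm E} {k : ℕ}
    (hk : analyticOrderAt (fun t : ℂ => φ.rep (Ψ.symm (0, t))) 0 = k) {I : Ideal (AnalyticGerm E)}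
    (hI : φ ∈ I) : ((Ideal.Quotient.mk I).comp (pull (prFst Ψ))).Finite := by
  refine RingHom.finite_of_sum_pow _ (Ideal.Quotient.mk I (ofDual (prSnd Ψ))) k fun b => ?_
  obtain ⟨γ, rfl⟩ := Ideal.Quotient.mk_surjective b
  obtain ⟨q, r, h⟩ := exists_division Ψ hk γ
  refine ⟨r, ?_⟩
  conv_lhs => rw [h]
  rw [map_add, map_mul, Ideal.Quotient.eq_zero_iff_mem.2 hI, mul_zero, zero_add, map_sum]
  simp [map_mul, map_pow]

/-- The induction for Rückert's basis theorem: modulo a nonzero germ the ring is finite over the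
germs in one variable less. -/
theorem isNoetherianRing_of_finrank (n : ℕ) : ∀ (E : Type) [NormedAddCommGroup E]
    [NormedSpace ℂ E] [FiniteDimensional ℂ E], Module.finrank ℂ E = n →
    IsNoetherianRing (AnalyticGerm E) := by
  induction n with
  | zero =>
    intro E _ _ _ hE
    exact isNoetherianRing_of_surjective ℂ _ const fun φ =>
      ⟨value φ, (eq_const_of_finrank_eq_zero hE φ).symm⟩
  | succ n ih =>
    intro E _ _ _ hE
    have hN : IsNoetherianRing (AnalyticGerm (Fin n → ℂ)) := ih _ (by simp)
    refine ⟨fun I => ?_⟩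
    by_cases hI : I = ⊥
    · rw [hI]; exact Submodule.fg_bot
    obtain ⟨φ, hφI, hφ⟩ := Submodule.exists_mem_ne_zero_of_ne_bot hI
    obtain ⟨Ψ, k, hk⟩ := exists_split_of_ne_zero hE hφ
    have hfin := finite_quotient Ψ hk (Ideal.mem_span_singleton_self φ)
    have hNq : IsNoetherianRing (AnalyticGerm E ⧸ Ideal.span {φ}) := by
      let _ := ((Ideal.Quotient.mk (Ideal.span {φ})).comp (pull (prFst Ψ))).toAlgebra
      have : Module.Finite (AnalyticGerm (Fin n → ℂ)) (AnalyticGerm E ⧸ Ideal.span {φ}) := hfin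
      exact IsNoetherianRing.of_finite (AnalyticGerm (Fin n → ℂ)) _
    have hle : Ideal.span {φ} ≤ I := (Ideal.span_singleton_le_iff_mem I).2 hφI
    have h1 : (Ideal.map (Ideal.Quotient.mk (Ideal.span {φ})) I).FG :=
      (isNoetherianRing_iff_ideal_fg _).1 hNq _
    obtain ⟨s, hs⟩ := h1
    have hsurj := Ideal.Quotient.mk_surjective (I := Ideal.span {φ})
    choose g hg using hsurj
    classical
    refine ⟨insert φ (s.image g), le_antisymm ?_ ?_⟩
    · rw [Submodule.span_le]
      intro x hx
      simp only [Finset.coe_insert, Finset.coe_image, Set.mem_insert_iff, Set.mem_image] at hx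
      rcases hx with rfl | ⟨y, hy, rfl⟩
      · exact hφI
      · have h2 : y ∈ Ideal.map (Ideal.Quotient.mk (Ideal.span {φ})) I := by
          rw [← hs]; exact Submodule.subset_span hy
        obtain ⟨z, hz, hzy⟩ := (Ideal.mem_map_iff_of_surjective _
          Ideal.Quotient.mk_surjective).1 h2
        have h3 : g y - z ∈ Ideal.span {φ} := by
          rw [← Ideal.Quotient.eq, hg, hzy]
        have := I.add_mem (hle h3) hz
        simpa using this
    · intro x hx
      have h2 : Ideal.Quotient.mk (Ideal.span {φ}) x ∈
          (Ideal.span ((s.image g : Finset _) : Set (AnalyticGerm E))).map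
            (Ideal.Quotient.mk (Ideal.span {φ})) := by
        rw [Ideal.map_span, Finset.coe_image, ← Set.image_comp]
        have : (Ideal.Quotient.mk (Ideal.span {φ})) ∘ g = id := by ext y; simp [hg]
        rw [this, Set.image_id]
        change _ ∈ Ideal.span _
        rw [hs]
        exact Ideal.mem_map_of_mem _ hx
      obtain ⟨z, hz, hzy⟩ := (Ideal.mem_map_iff_of_surjective _
          Ideal.Quotient.mk_surjective).1 h2
      have h3 : x - z ∈ Ideal.span {φ} := by rw [← Ideal.Quotient.eq, hzy]
      change x ∈ Ideal.span _
      rw [Finset.coe_insert, Ideal.span_insert]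
      have := Submodule.add_mem_sup h3 hz
      simpa using this

/-- **Rückert's basis theorem**: the ring of germs of analytic functions is noetherian. -/
instance isNoetherianRing [FiniteDimensional ℂ E] : IsNoetherianRing (AnalyticGerm E) := by
  have e : E ≃L[ℂ] (Fin (Module.finrank ℂ E) → ℂ) := ContinuousLinearEquiv.ofFinrankEq (by simp)
  have := isNoetherianRing_of_finrank _ (Fin (Module.finrank ℂ E) → ℂ) rfl
  exact isNoetherianRing_of_ringEquiv _ (pullEquiv e)

end AnalyticGerm

/-! ### The ring of germs is integrally closed -/

namespace AnalyticGerm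

open Filter Polynomial

variable {E : Type*} [NormedAddCommGroup E] [NormedSpace ℂ E]
  {E' : Type*} [NormedAddCommGroup E'] [NormedSpace ℂ E']

theorem tendsto_rep (φ : AnalyticGerm E) : Tendsto φ.rep (𝓝 0) (𝓝 (value φ)) := by
  rw [value_eq]; exact φ.analyticAt_rep.continuousAt

theorem eventually_norm_rep_le (φ : AnalyticGerm E) :
    ∀ᶠ x in 𝓝 (0 : E), ‖φ.rep x‖ ≤ ‖value φ‖ + 1 :=
  (φ.tendsto_rep.norm.eventually_lt_const (lt_add_one _)).mono fun _ h => h.le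

/-- A germ of finite order `k` in the last coordinate divides a Weierstrass polynomial of
degree `k`, with invertible cofactor. -/
theorem exists_weierstrass_polynomial [FiniteDimensional ℂ E'] (Ψ : E ≃L[ℂ] E' × ℂ)
    {φ : AnalyticGerm E} {k : ℕ}
    (hk : analyticOrderAt (fun t : ℂ => φ.rep (Ψ.symm (0, t))) 0 = k) :
    ∃ (q : AnalyticGerm E) (r : ℕ → AnalyticGerm E'), IsUnit q ∧ (∀ i < k, value (r i) = 0) ∧
      ofDual (prSnd Ψ) ^ k = q * φ + ∑ i ∈ Finset.range k,
        pull (prFst Ψ) (r i) * ofDual (prSnd Ψ) ^ i := by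
  obtain ⟨q, r, h⟩ := exists_division Ψ hk (ofDual (prSnd Ψ) ^ k)
  -- restrict the identity to the last coordinate axis
  have hz : Ψ.symm ((0 : E'), (0 : ℂ)) = 0 := by rw [Prod.mk_zero_zero, map_zero]
  have hlim : Tendsto (fun t : ℂ => Ψ.symm (0, t)) (𝓝 0) (𝓝 0) := by
    have : Continuous fun t : ℂ => Ψ.symm (0, t) := by fun_prop
    simpa only [hz] using this.tendsto 0
  have hlin : AnalyticAt ℂ (fun t : ℂ => Ψ.symm (0, t)) 0 :=
    (Ψ.symm.analyticAt _).fun_comp (f := fun t : ℂ => ((0 : E'), t))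
      (analyticAt_const.prod analyticAt_id)
  have hφ : AnalyticAt ℂ (fun t : ℂ => φ.rep (Ψ.symm (0, t))) 0 :=
    AnalyticAt.comp (g := φ.rep) (f := fun t : ℂ => Ψ.symm (0, t))
      (by simpa only [hz] using φ.analyticAt_rep) hlin
  have hq : AnalyticAt ℂ (fun t : ℂ => q.rep (Ψ.symm (0, t))) 0 :=
    AnalyticAt.comp (g := q.rep) (f := fun t : ℂ => Ψ.symm (0, t))
      (by simpa only [hz] using q.analyticAt_rep) hlin
  obtain ⟨u, hu, hu0, hφu⟩ := (hφ.analyticOrderAt_eq_natCast).1 hk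
  have h1 := congrArg (evalAlong _ hlim) h
  rw [map_add, map_mul, map_sum, map_pow] at h1
  have hX : evalAlong (fun t : ℂ => Ψ.symm (0, t)) hlim (ofDual (prSnd Ψ)) =
      ((fun t : ℂ => t : ℂ → ℂ) : Germ (𝓝 (0 : ℂ)) ℂ) := by
    rw [ofDual, evalAlong_mk]
    congr 1
    ext t
    simp
  have hr : ∀ i, evalAlong (fun t : ℂ => Ψ.symm (0, t)) hlim (pull (prFst Ψ) (r i)) =
      ((fun _ : ℂ => value (r i) : ℂ → ℂ) : Germ (𝓝 (0 : ℂ)) ℂ) := by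
    intro i
    rw [← (r i).mk_rep, pull_mk, evalAlong_mk]
    congr 1
    ext t
    simp [value_eq]
  let p : ℂ[X] := ∑ i ∈ Finset.range k, C (value (r i)) * X ^ i
  have h2 : ∀ᶠ t in 𝓝 (0 : ℂ),
      t ^ k = q.rep (Ψ.symm (0, t)) * φ.rep (Ψ.symm (0, t)) + p.eval t := by
    have h3 : evalAlong _ hlim q * evalAlong _ hlim φ + ∑ i ∈ Finset.range k,
        evalAlong (fun t : ℂ => Ψ.symm (0, t)) hlim (pull (prFst Ψ) (r i) * ofDual (prSnd Ψ) ^ i) =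
        ((fun t => q.rep (Ψ.symm (0, t)) * φ.rep (Ψ.symm (0, t)) + p.eval t : ℂ → ℂ) :
          Germ (𝓝 (0 : ℂ)) ℂ) := by
      have h4 : ∑ i ∈ Finset.range k,
          evalAlong (fun t : ℂ => Ψ.symm (0, t)) hlim (pull (prFst Ψ) (r i) * ofDual (prSnd Ψ) ^ i)
          = ((fun t => p.eval t : ℂ → ℂ) : Germ (𝓝 (0 : ℂ)) ℂ) := by
        simp_rw [map_mul, map_pow, hX, hr]
        have h5 : (fun t => p.eval t) = ∑ i ∈ Finset.range k, fun t : ℂ => value (r i) * t ^ i := by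
          ext t
          simp [p, eval_finsetSum]
        rw [h5]
        exact (map_sum (Germ.coeRingHom (𝓝 (0 : ℂ)))
          (fun i => (fun t : ℂ => value (r i) * t ^ i)) (Finset.range k)).symm
      rw [h4, evalAlong_eq, evalAlong_eq]
      rfl
    rw [h3, hX] at h1
    exact Germ.coe_eq.1 h1
  have h3 : ∀ᶠ t in 𝓝 (0 : ℂ), t ^ k * (1 - q.rep (Ψ.symm (0, t)) * u t) = p.eval t := by
    filter_upwards [h2, hφu] with t h4 h5
    rw [sub_zero, smul_eq_mul] at h5
    rw [h5] at h4
    linear_combination h4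
  have hw : AnalyticAt ℂ (fun t : ℂ => 1 - q.rep (Ψ.symm (0, t)) * u t) 0 :=
    analyticAt_const.sub (hq.mul hu)
  -- a polynomial of degree `< k` of order at least `k` vanishes
  have hp : p = 0 := by
    have hdeg : p.degree < k := by
      refine mem_degreeLT.1 (Submodule.sum_mem _ fun i hi => mem_degreeLT.2 ?_)
      exact (degree_C_mul_X_pow_le i _).trans_lt (by exact_mod_cast Finset.mem_range.1 hi)
    obtain ⟨δ, hδ, hb⟩ := Metric.eventually_nhds_iff_ball.1
      (h3.and (hw.continuousAt.norm.eventually_lt_const (lt_add_one _)))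
    have h6 : (X ^ k : ℂ[X]) ∣ p := by
      refine Polynomial.dvd_of_norm_eval_le Metric.isOpen_ball _ (monic_X_pow k) rfl ?_
        (fun t ht => ?_) (U := Metric.ball 0 δ)
        (C := ‖1 - q.rep (Ψ.symm (0, 0)) * u 0‖ + 1)
      · intro t ht
        rw [eval_pow, eval_X] at ht
        rw [eq_zero_of_pow_eq_zero ht]
        exact Metric.mem_ball_self hδ
      · obtain ⟨h7, h8⟩ := hb t ht
        rw [← h7, eval_pow, eval_X, norm_mul, mul_comm]
        gcongr
    by_contra h0
    have := degree_le_of_dvd h6 h0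
    rw [degree_X_pow] at this
    exact absurd hdeg (not_lt.2 this)
  refine ⟨q, r, ?_, ?_, h⟩
  · rw [isUnit_iff, value_eq]
    have h9 : ∀ᶠ t in 𝓝[≠] (0 : ℂ), 1 - q.rep (Ψ.symm (0, t)) * u t = 0 := by
      filter_upwards [nhdsWithin_le_nhds h3, self_mem_nhdsWithin] with t h4 h5
      rw [hp, eval_zero] at h4
      exact (mul_eq_zero.1 h4).resolve_left (pow_ne_zero _ h5)
    have h10 := tendsto_nhds_unique_of_eventuallyEq
      (hw.continuousAt.tendsto.mono_left nhdsWithin_le_nhds) tendsto_const_nhds h9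
    intro h0
    rw [hz, h0] at h10
    simp at h10
  · intro i hi
    have := congrArg (fun p => coeff p i) hp
    simpa [p, coeff_C_mul, coeff_X_pow, hi] using this

theorem eventually_rep_sum_pull (Ψ : E ≃L[ℂ] E' × ℂ) (r : ℕ → AnalyticGerm E') (k : ℕ) :
    (∑ i ∈ Finset.range k, pull (prFst Ψ) (r i) * ofDual (prSnd Ψ) ^ i).rep =ᶠ[𝓝 0]
      fun x => ∑ i ∈ Finset.range k, (r i).rep (Ψ x).1 * (Ψ x).2 ^ i := by
  refine (eventually_rep_sum _ _).trans ?_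
  have h : ∀ᶠ x in 𝓝 (0 : E), ∀ i ∈ Finset.range k,
      (pull (prFst Ψ) (r i) * ofDual (prSnd Ψ) ^ i).rep x = (r i).rep (Ψ x).1 * (Ψ x).2 ^ i := by
    rw [Filter.eventually_all_finset]
    intro i _
    filter_upwards [eventually_rep_mul (pull (prFst Ψ) (r i)) (ofDual (prSnd Ψ) ^ i),
      eventually_rep_pow (ofDual (prSnd Ψ)) i, rep_ofDual (prSnd Ψ), rep_pull (prFst Ψ) (r i)]
      with x h1 h2 h3 h4
    rw [h1, h2, h3, h4]
    rfl
  filter_upwards [h] with x hx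
  exact Finset.sum_congr rfl hx

/-- A quotient of germs that is bounded is a germ. -/
theorem dvd_of_norm_rep_le [FiniteDimensional ℂ E] {a b : AnalyticGerm E} (hb : b ≠ 0) {C : ℝ}
    (h : ∀ᶠ x in 𝓝 (0 : E), ‖a.rep x‖ ≤ C * ‖b.rep x‖) : b ∣ a := by
  rcases hn : Module.finrank ℂ E with _ | n
  · refine IsUnit.dvd (isUnit_iff.2 fun h0 => hb ?_)
    rw [eq_const_of_finrank_eq_zero hn b, h0, map_zero]
  obtain ⟨Ψ, k, hk⟩ := exists_split_of_ne_zero hn hb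
  obtain ⟨q, r, hq, hr, hP⟩ := exists_weierstrass_polynomial Ψ hk
  obtain ⟨q₂, ρ, hR⟩ := exists_division Ψ hk a
  obtain ⟨q', hq'⟩ := hq.exists_left_inv
  set R := ∑ i ∈ Finset.range k, pull (prFst Ψ) (ρ i) * ofDual (prSnd Ψ) ^ i with hRdef
  set S := ∑ i ∈ Finset.range k, pull (prFst Ψ) (r i) * ofDual (prSnd Ψ) ^ i with hSdef
  have hbP : b = q' * (ofDual (prSnd Ψ) ^ k + (-1) * S) := by
    rw [hP]
    linear_combination (-b) * hq'
  have hRa : R = a + (-1) * (q₂ * b) := by rw [hR]; ring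
  set P := ofDual (prSnd Ψ) ^ k + (-1) * S with hPdef
  have hRa : a = R + q₂ * b := by rw [hR]; ring
  -- the remainder is bounded by the Weierstrass polynomial
  have hbound : ∀ᶠ x in 𝓝 (0 : E), ‖R.rep x‖ ≤ ((|C| + (‖value q₂‖ + 1)) * (‖value q'‖ + 1)) *
      ‖P.rep x‖ := by
    have e1 : ∀ᶠ x in 𝓝 0, a.rep x = R.rep x + q₂.rep x * b.rep x := by
      filter_upwards [eventually_rep_add R (q₂ * b), eventually_rep_mul q₂ b] with x h1 h2
      rw [← h2, ← h1, ← hRa]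
    have e2 : b.rep =ᶠ[𝓝 0] fun x => q'.rep x * P.rep x := by
      conv_lhs => rw [hbP]
      exact eventually_rep_mul _ _
    filter_upwards [e1, e2, h, q₂.eventually_norm_rep_le, q'.eventually_norm_rep_le]
      with x h1 h2 h3 h4 h5
    calc ‖R.rep x‖ = ‖a.rep x - q₂.rep x * b.rep x‖ := by rw [h1, add_sub_cancel_right]
      _ ≤ ‖a.rep x‖ + ‖q₂.rep x * b.rep x‖ := norm_sub_le _ _
      _ ≤ |C| * ‖b.rep x‖ + (‖value q₂‖ + 1) * ‖b.rep x‖ := by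
        rw [norm_mul]
        gcongr
        exact h3.trans (by gcongr; exact le_abs_self C)
      _ = (|C| + (‖value q₂‖ + 1)) * ‖b.rep x‖ := by ring
      _ ≤ (|C| + (‖value q₂‖ + 1)) * ((‖value q'‖ + 1) * ‖P.rep x‖) := by
        rw [h2, norm_mul]
        gcongr
      _ = _ := by ring
  have hP' : ∀ᶠ x in 𝓝 (0 : E), P.rep x =
      (Ψ x).2 ^ k - ∑ i ∈ Finset.range k, (r i).rep (Ψ x).1 * (Ψ x).2 ^ i := by
    have hPS : ofDual (prSnd Ψ) ^ k = P + S := by rw [hPdef]; ring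
    filter_upwards [eventually_rep_sum_pull Ψ r k, eventually_rep_add P S,
      eventually_rep_pow (ofDual (prSnd Ψ)) k, rep_ofDual (prSnd Ψ)] with x h1 h2 h3 h4
    rw [← h1, eq_sub_iff_add_eq, ← hSdef, ← h2, ← hPS, h3, h4]
    rfl
  -- the same bound in the coordinates `(z, t)`
  obtain ⟨D, hD⟩ : ∃ D : ℝ, ∀ᶠ y in 𝓝 (0 : (Fin n → ℂ) × ℂ),
      ‖∑ i ∈ Finset.range k, (ρ i).rep y.1 * y.2 ^ i‖ ≤
        D * ‖y.2 ^ k - ∑ i ∈ Finset.range k, (r i).rep y.1 * y.2 ^ i‖ := by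
    refine ⟨(|C| + (‖value q₂‖ + 1)) * (‖value q'‖ + 1), ?_⟩
    have h1 : Tendsto Ψ.symm (𝓝 0) (𝓝 0) := by simpa using Ψ.symm.continuous.tendsto 0
    filter_upwards [h1.eventually hbound, h1.eventually hP',
      h1.eventually (eventually_rep_sum_pull Ψ ρ k)] with y h2 h3 h4
    rw [← hRdef] at h4
    rw [h4, h3] at h2
    simpa only [ContinuousLinearEquiv.apply_symm_apply] using h2
  obtain ⟨δ, hδ, hball⟩ := Metric.eventually_nhds_iff_ball.1 hD
  have hroots := eventually_norm_lt_of_pow_eq_sum (l := 𝓝 (0 : (Fin n → ℂ))) (k := k)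
    (c := fun i => (r i).rep) (fun i hi => by simpa only [hr i hi] using (r i).tendsto_rep) hδ
  have hzero : ∀ᶠ z in 𝓝 (0 : (Fin n → ℂ)), ∀ i < k, (ρ i).rep z = 0 := by
    filter_upwards [hroots, Metric.ball_mem_nhds 0 hδ] with z h1 h2
    have hev : ∀ (c : ℕ → AnalyticGerm ((Fin n → ℂ))) (t : ℂ),
        (∑ i ∈ Finset.range k, Polynomial.C ((c i).rep z) * X ^ i).eval t =
          ∑ i ∈ Finset.range k, (c i).rep z * t ^ i := by
      intro c t
      simp [eval_finsetSum]
    have hdeg : ∀ c : ℕ → AnalyticGerm ((Fin n → ℂ)),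
        (∑ i ∈ Finset.range k, Polynomial.C ((c i).rep z) * X ^ i).degree < (k : WithBot ℕ) := by
      intro c
      refine mem_degreeLT.1 (Submodule.sum_mem _ fun i hi => mem_degreeLT.2 ?_)
      exact (degree_C_mul_X_pow_le i _).trans_lt (by exact_mod_cast Finset.mem_range.1 hi)
    have hmonic := monic_X_pow_sub (hdeg r)
    have hnat : (X ^ k - ∑ i ∈ Finset.range k, Polynomial.C ((r i).rep z) * X ^ i).degree =
        (k : WithBot ℕ) := by
      rw [degree_sub_eq_left_of_degree_lt] <;> rw [degree_X_pow]
      exact hdeg r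
    have hdvd := Polynomial.dvd_of_norm_eval_le (U := Metric.ball (0 : ℂ) δ) Metric.isOpen_ball
      (C := D) k
      hmonic (natDegree_eq_of_degree_eq_some hnat) (r := ∑ i ∈ Finset.range k,
        Polynomial.C ((ρ i).rep z) * X ^ i)
      (fun t ht => by
        rw [eval_sub, eval_pow, eval_X, hev, sub_eq_zero] at ht
        simpa using h1 t ht)
      (fun t ht => by
        rw [eval_sub, eval_pow, eval_X, hev, hev]
        refine hball (z, t) ?_
        rw [← ball_prod_same]
        exact ⟨h2, ht⟩)
    have h0 : ∑ i ∈ Finset.range k, Polynomial.C ((ρ i).rep z) * X ^ i = 0 := by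
      by_contra h0
      have := degree_le_of_dvd hdvd h0
      rw [hnat] at this
      exact absurd (hdeg ρ) (not_lt.2 this)
    intro i hi
    have := congrArg (fun p => coeff p i) h0
    simpa [coeff_C_mul, coeff_X_pow, hi] using this
  have hR0 : R = 0 := by
    refine Finset.sum_eq_zero fun i hi => ?_
    have : ρ i = 0 := eq_zero_iff.2 (hzero.mono fun z hz => hz i (Finset.mem_range.1 hi))
    rw [this, map_zero, zero_mul]
  rw [hRa, hR0, zero_add]
  exact dvd_mul_left _ _

/-- The ring of germs is integrally closed: an integral quotient of germs is bounded. -/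
instance isIntegrallyClosed [FiniteDimensional ℂ E] : IsIntegrallyClosed (AnalyticGerm E) := by
  refine (isIntegrallyClosed_iff (FractionRing (AnalyticGerm E))).2 fun {x} hx => ?_
  obtain ⟨p, hp, hpx⟩ := hx
  obtain ⟨a, b, hb, rfl⟩ := IsFractionRing.div_surjective (A := AnalyticGerm E) x
  have hb0 : b ≠ 0 := nonZeroDivisors.ne_zero hb
  have hb1 : algebraMap (AnalyticGerm E) (FractionRing (AnalyticGerm E)) b ≠ 0 := by
    simpa using hb0
  set N := p.natDegree with hN
  have h1 : ∑ i ∈ Finset.range (N + 1), p.coeff i * b ^ (N - i) * a ^ i = 0 := by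
    apply IsFractionRing.injective (AnalyticGerm E) (FractionRing (AnalyticGerm E))
    rw [eval₂_eq_sum_range] at hpx
    rw [map_zero, ← mul_zero (algebraMap _ (FractionRing (AnalyticGerm E)) b ^ N), ← hpx, map_sum,
      Finset.mul_sum]
    refine Finset.sum_congr rfl fun i hi => ?_
    have hi' : i ≤ N := Nat.lt_succ_iff.1 (Finset.mem_range.1 hi)
    rw [map_mul, map_mul, map_pow, map_pow, div_pow]
    field_simp
    conv_rhs => rw [← Nat.sub_add_cancel hi', pow_add]
    ring
  have h2 : ∀ᶠ x in 𝓝 (0 : E), ∑ i ∈ Finset.range (N + 1),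
      (p.coeff i).rep x * b.rep x ^ (N - i) * a.rep x ^ i = 0 := by
    have h3 : ∀ᶠ x in 𝓝 (0 : E), ∀ i ∈ Finset.range (N + 1),
        (p.coeff i * b ^ (N - i) * a ^ i).rep x =
          (p.coeff i).rep x * b.rep x ^ (N - i) * a.rep x ^ i := by
      rw [Filter.eventually_all_finset]
      intro i _
      filter_upwards [eventually_rep_mul (p.coeff i * b ^ (N - i)) (a ^ i),
        eventually_rep_mul (p.coeff i) (b ^ (N - i)), eventually_rep_pow a i,
        eventually_rep_pow b (N - i)] with x h4 h5 h6 h7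
      rw [h4, h5, h6, h7]
    filter_upwards [h3, eventually_rep_sum (Finset.range (N + 1))
      fun i => p.coeff i * b ^ (N - i) * a ^ i, eq_zero_iff.1 h1] with x h4 h5 h6
    rw [← Finset.sum_congr rfl h4, ← h5, h6]
  have h3 : ∀ᶠ x in 𝓝 (0 : E), ∀ i ∈ Finset.range N,
      ‖(p.coeff i).rep x‖ ≤ ‖value (p.coeff i)‖ + 1 := by
    rw [Filter.eventually_all_finset]
    exact fun i _ => (p.coeff i).eventually_norm_rep_le
  have h4 : ∀ᶠ x in 𝓝 (0 : E), (p.coeff N).rep x = 1 := by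
    rw [hN, hp.coeff_natDegree]
    exact rep_mk (fun _ => 1) analyticAt_const
  obtain ⟨c, rfl⟩ : b ∣ a := by
    refine dvd_of_norm_rep_le (C := 1 + ∑ i ∈ Finset.range N, (‖value (p.coeff i)‖ + 1)) hb0 ?_
    filter_upwards [h2, h3, h4] with x h5 h6 h7
    refine (norm_le_of_sum_eq_zero (c := fun i => (p.coeff i).rep x) h7 h5).trans ?_
    gcongr with i hi
    exact h6 i hi
  exact ⟨c, by rw [map_mul]; field_simp⟩

end AnalyticGerm

/-! ### Noether normalization -/

namespace AnalyticGerm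

open Filter

variable {E : Type*} [NormedAddCommGroup E] [NormedSpace ℂ E]
  {E' : Type*} [NormedAddCommGroup E'] [NormedSpace ℂ E'] {ι : Type*}

/-- The projection to the base, in coordinates `E ≃ E' × (ι → ℂ)`. -/
noncomputable abbrev prBase (Φ : E ≃L[ℂ] E' × (ι → ℂ)) : E →L[ℂ] E' :=
  (ContinuousLinearMap.fst ℂ E' (ι → ℂ)).comp (Φ : E →L[ℂ] E' × (ι → ℂ))

/-- The coordinates of the fibre, in coordinates `E ≃ E' × (ι → ℂ)`. -/
noncomputable abbrev prCoord (Φ : E ≃L[ℂ] E' × (ι → ℂ)) (j : ι) : E →L[ℂ] ℂ :=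
  ((ContinuousLinearMap.proj j : (ι → ℂ) →L[ℂ] ℂ).comp
    (ContinuousLinearMap.snd ℂ E' (ι → ℂ))).comp (Φ : E →L[ℂ] E' × (ι → ℂ))

/-- The germs that are polynomials in the fibre coordinates with coefficients from the base. -/
noncomputable def fibrePolynomials (Φ : E ≃L[ℂ] E' × (ι → ℂ)) : Subring (AnalyticGerm E) :=
  Subring.closure (Set.range (pull (prBase Φ)) ∪ Set.range fun j => ofDual (prCoord Φ j))

theorem pull_mem_fibrePolynomials (Φ : E ≃L[ℂ] E' × (ι → ℂ)) (φ : AnalyticGerm E') :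
    pull (prBase Φ) φ ∈ fibrePolynomials Φ :=
  Subring.subset_closure (Or.inl ⟨φ, rfl⟩)

theorem ofDual_mem_fibrePolynomials (Φ : E ≃L[ℂ] E' × (ι → ℂ)) (j : ι) :
    ofDual (prCoord Φ j) ∈ fibrePolynomials Φ :=
  Subring.subset_closure (Or.inr ⟨j, rfl⟩)

/-- The ideal generated by those elements of `I` that are polynomials in the fibre coordinates. -/
noncomputable def polynomialPart (Φ : E ≃L[ℂ] E' × (ι → ℂ)) (I : Ideal (AnalyticGerm E)) :
    Ideal (AnalyticGerm E) :=
  Ideal.span ((fibrePolynomials Φ : Set (AnalyticGerm E)) ∩ I)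

theorem polynomialPart_le (Φ : E ≃L[ℂ] E' × (ι → ℂ)) (I : Ideal (AnalyticGerm E)) :
    polynomialPart Φ I ≤ I :=
  Ideal.span_le.2 Set.inter_subset_right

/-- Coordinates in which the germs modulo `I` are a finite extension of the germs on the base,
such that moreover every germ is modulo `I` a polynomial in the fibre coordinates, by virtue of
polynomial relations alone. -/
structure IsNormalization (Φ : E ≃L[ℂ] E' × (ι → ℂ)) (I : Ideal (AnalyticGerm E)) : Prop where
  eq_zero_of_pull_mem : ∀ φ, pull (prBase Φ) φ ∈ I → φ = 0
  finite : ((Ideal.Quotient.mk I).comp (pull (prBase Φ))).Finite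
  exists_sub_mem : ∀ G, ∃ P ∈ fibrePolynomials Φ, G - P ∈ polynomialPart Φ I

/-- A normalized ideal is generated by its elements that are polynomials in the fibre coordinates.
-/
theorem IsNormalization.polynomialPart_eq {Φ : E ≃L[ℂ] E' × (ι → ℂ)} {I : Ideal (AnalyticGerm E)}
    (h : IsNormalization Φ I) : polynomialPart Φ I = I := by
  refine le_antisymm (polynomialPart_le Φ I) fun G hG => ?_
  obtain ⟨P, hP, hGP⟩ := h.exists_sub_mem G
  have hPI : P ∈ I := by
    have := I.sub_mem hG (polynomialPart_le Φ I hGP)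
    simpa using this
  have := add_mem hGP (Ideal.subset_span ⟨hP, hPI⟩ : P ∈ polynomialPart Φ I)
  simpa using this

/-- Moves the last coordinate to the fibre. -/
def optionFibre (E' : Type*) [NormedAddCommGroup E'] [NormedSpace ℂ E'] (ι : Type*) :
    ((E' × (ι → ℂ)) × ℂ) ≃ₗ[ℂ] E' × (Option ι → ℂ) where
  toFun p := (p.1.1, fun o => o.elim p.2 p.1.2)
  invFun p := ((p.1, fun j => p.2 (some j)), p.2 none)
  map_add' p q := by
    refine Prod.ext rfl ?_
    ext (_ | j) <;> rfl
  map_smul' c p := by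
    refine Prod.ext rfl ?_
    ext (_ | j) <;> rfl
  left_inv p := rfl
  right_inv p := by
    refine Prod.ext rfl ?_
    ext (_ | j) <;> rfl

/-- Coordinates of a hyperplane extend to coordinates of the space. -/
noncomputable def extendFibre [FiniteDimensional ℂ E'] [Fintype ι] {F : Type*}
    [NormedAddCommGroup F] [NormedSpace ℂ F] (Ψ : E ≃L[ℂ] F × ℂ) (Φ : F ≃L[ℂ] E' × (ι → ℂ)) :
    E ≃L[ℂ] E' × (Option ι → ℂ) :=
  Ψ.trans ((Φ.prodCongr (ContinuousLinearEquiv.refl ℂ ℂ)).trans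
    (optionFibre E' ι).toContinuousLinearEquiv)

section

variable [FiniteDimensional ℂ E'] [Fintype ι] {F : Type*} [NormedAddCommGroup F] [NormedSpace ℂ F]
  (Ψ : E ≃L[ℂ] F × ℂ) (Φ : F ≃L[ℂ] E' × (ι → ℂ))

theorem prBase_extendFibre : prBase (extendFibre Ψ Φ) = (prBase Φ).comp (prFst Ψ) := rfl

theorem pull_mem_fibrePolynomials_extendFibre {P : AnalyticGerm F} (hP : P ∈ fibrePolynomials Φ) :
    pull (prFst Ψ) P ∈ fibrePolynomials (extendFibre Ψ Φ) := by
  suffices fibrePolynomials Φ ≤ (fibrePolynomials (extendFibre Ψ Φ)).comap (pull (prFst Ψ)) from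
    this hP
  refine Subring.closure_le.2 ?_
  rintro _ (⟨φ, rfl⟩ | ⟨j, rfl⟩)
  · rw [SetLike.mem_coe, Subring.mem_comap, pull_pull]
    exact pull_mem_fibrePolynomials (extendFibre Ψ Φ) φ
  · rw [SetLike.mem_coe, Subring.mem_comap, pull_ofDual]
    exact ofDual_mem_fibrePolynomials (extendFibre Ψ Φ) (some j)

theorem pull_mem_polynomialPart_extendFibre (I : Ideal (AnalyticGerm E)) {P : AnalyticGerm F}
    (hP : P ∈ polynomialPart Φ (I.comap (pull (prFst Ψ)))) :
    pull (prFst Ψ) P ∈ polynomialPart (extendFibre Ψ Φ) I := by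
  suffices polynomialPart Φ (I.comap (pull (prFst Ψ))) ≤
    (polynomialPart (extendFibre Ψ Φ) I).comap (pull (prFst Ψ)) from this hP
  refine Ideal.span_le.2 fun Q hQ => Ideal.subset_span ⟨?_, hQ.2⟩
  exact pull_mem_fibrePolynomials_extendFibre Ψ Φ hQ.1

variable {Ψ Φ}

/-- The induction step of Noether normalization. -/
theorem IsNormalization.extendFibre [FiniteDimensional ℂ F] {I : Ideal (AnalyticGerm E)}
    (h : IsNormalization Φ (I.comap (pull (prFst Ψ)))) {φ : AnalyticGerm E} (hφ : φ ∈ I) {k : ℕ}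
    (hk : analyticOrderAt (fun t : ℂ => φ.rep (Ψ.symm (0, t))) 0 = k) :
    IsNormalization (extendFibre Ψ Φ) I := by
  refine ⟨fun γ hγ => ?_, ?_, ?_⟩
  · rw [prBase_extendFibre, ← pull_pull] at hγ
    exact h.eq_zero_of_pull_mem γ hγ
  · let I' := I.comap (pull (prFst Ψ))
    let f : (AnalyticGerm F ⧸ I') →+* (AnalyticGerm E ⧸ I) :=
      Ideal.quotientMap I (pull (prFst Ψ)) le_rfl
    have hf : f.Finite := RingHom.Finite.of_comp_finite (f := Ideal.Quotient.mk I')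
      (finite_quotient Ψ hk hφ)
    have := hf.comp h.finite
    convert this using 1
    ext1 γ
    simp [f, prBase_extendFibre, ← pull_pull, I']
  · set Φ' := AnalyticGerm.extendFibre Ψ Φ with hΦ'
    have key : ∀ r : ℕ → AnalyticGerm F, ∃ P ∈ fibrePolynomials Φ',
        ∑ i ∈ Finset.range k, pull (prFst Ψ) (r i) * ofDual (prSnd Ψ) ^ i - P ∈
          polynomialPart Φ' I := by
      intro r
      choose p hp hrp using fun i => h.exists_sub_mem (r i)
      refine ⟨∑ i ∈ Finset.range k, pull (prFst Ψ) (p i) * ofDual (prSnd Ψ) ^ i, ?_, ?_⟩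
      · exact sum_mem fun i _ => mul_mem (pull_mem_fibrePolynomials_extendFibre Ψ Φ (hp i))
          (pow_mem (ofDual_mem_fibrePolynomials Φ' none) i)
      · rw [← Finset.sum_sub_distrib]
        refine sum_mem fun i _ => ?_
        rw [← sub_mul, ← map_sub]
        exact Ideal.mul_mem_right _ _ (pull_mem_polynomialPart_extendFibre Ψ Φ I (hrp i))
    obtain ⟨q, r, hq, -, hqr⟩ := exists_weierstrass_polynomial Ψ hk
    -- the Weierstrass polynomial is congruent to a polynomial in all the fibre coordinates
    have hφJ : φ ∈ polynomialPart Φ' I := by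
      obtain ⟨P, hP, hPr⟩ := key r
      have h1 : ofDual (prSnd Ψ) ^ k - P ∈ polynomialPart Φ' I := by
        refine Ideal.subset_span ⟨sub_mem (pow_mem (ofDual_mem_fibrePolynomials Φ' none) k) hP, ?_⟩
        have h2 : ofDual (prSnd Ψ) ^ k - P = q * φ + (∑ i ∈ Finset.range k,
            pull (prFst Ψ) (r i) * ofDual (prSnd Ψ) ^ i - P) := by rw [hqr]; ring
        rw [h2]
        exact add_mem (I.mul_mem_left _ hφ) (polynomialPart_le _ _ hPr)
      have h3 : q * φ ∈ polynomialPart Φ' I := by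
        have h2 : q * φ = (ofDual (prSnd Ψ) ^ k - P) - (∑ i ∈ Finset.range k,
            pull (prFst Ψ) (r i) * ofDual (prSnd Ψ) ^ i - P) := by rw [hqr]; ring
        rw [h2]
        exact sub_mem h1 hPr
      obtain ⟨q', hq'⟩ := hq.exists_left_inv
      have := Ideal.mul_mem_left _ q' h3
      rwa [← mul_assoc, hq', one_mul] at this
    intro G
    obtain ⟨q₂, ρ, hG⟩ := exists_division Ψ hk G
    obtain ⟨P, hP, hρP⟩ := key ρ
    refine ⟨P, hP, ?_⟩
    rw [hG, add_sub_assoc]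
    exact add_mem (Ideal.mul_mem_left _ _ hφJ) hρP

end

/-- The existence of a normalization, for all prime ideals. -/
def HasNormalizations (E : Type*) [NormedAddCommGroup E] [NormedSpace ℂ E] : Prop :=
  ∀ I : Ideal (AnalyticGerm E), I.IsPrime → ∃ (d : ℕ) (ι : Type) (_ : Fintype ι)
    (Φ : E ≃L[ℂ] (Fin d → ℂ) × (ι → ℂ)), IsNormalization Φ I

/-- The zero ideal is normalized by coordinates without a fibre. -/
theorem isNormalization_bot [FiniteDimensional ℂ E] [IsEmpty ι] [FiniteDimensional ℂ E']
    (e : E ≃L[ℂ] E') : ∃ Φ : E ≃L[ℂ] E' × (ι → ℂ), IsNormalization Φ ⊥ := by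
  let l : E' ≃ₗ[ℂ] E' × (ι → ℂ) :=
    { toFun x := (x, 0), invFun p := p.1, map_add' _ _ := by simp, map_smul' _ _ := by simp
      left_inv _ := rfl, right_inv p := Prod.ext rfl (Subsingleton.elim _ _) }
  let Φ := e.trans (l.toContinuousLinearEquiv)
  have hΦ : prBase Φ = (e : E →L[ℂ] E') := rfl
  have hsurj : Function.Surjective (pull (prBase Φ)) := fun G =>
    ⟨(pullEquiv e).symm G, (pullEquiv e).apply_symm_apply G⟩
  refine ⟨Φ, fun φ h => ?_, ?_, fun G => ?_⟩
  · exact (pullEquiv e).map_eq_zero_iff.1 ((Submodule.mem_bot _).1 h)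
  · exact RingHom.Finite.of_surjective _ (Ideal.Quotient.mk_surjective.comp hsurj)
  · obtain ⟨g, rfl⟩ := hsurj G
    exact ⟨_, pull_mem_fibrePolynomials Φ g, by simp⟩

/-- The inductive step of Noether normalization: a nonzero prime ideal `I` contains a germ of finite
order in a suitable last coordinate, modulo which that coordinate is integral; the
remaining coordinates come from the contraction of `I` to one variable less. -/
theorem hasNormalizations_of_finrank [FiniteDimensional ℂ E]
    (ih : ∀ m, m + 1 = Module.finrank ℂ E → HasNormalizations (Fin m → ℂ)) :
    HasNormalizations E := by
  intro I hI
  by_cases h0 : I = ⊥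
  · obtain ⟨Φ, hΦ⟩ := isNormalization_bot (ι := Empty)
      (ContinuousLinearEquiv.ofFinrankEq (by simp) : E ≃L[ℂ] (Fin (Module.finrank ℂ E) → ℂ))
    exact ⟨_, Empty, inferInstance, Φ, h0 ▸ hΦ⟩
  obtain ⟨φ, hφI, hφ⟩ := Submodule.exists_mem_ne_zero_of_ne_bot h0
  rcases hn : Module.finrank ℂ E with _ | m
  · exact absurd (Ideal.eq_top_of_isUnit_mem I hφI (isUnit_iff.2 fun h => hφ (by
      rw [eq_const_of_finrank_eq_zero hn φ, h, map_zero]))) hI.ne_top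
  obtain ⟨Ψ, k, hk⟩ := exists_split_of_ne_zero hn hφ
  obtain ⟨d, ι, _, Φ, hΦ⟩ := ih m hn.symm (I.comap (pull (prFst Ψ))) inferInstance
  exact ⟨d, Option ι, inferInstance, _, hΦ.extendFibre hφI hk⟩

/-- **Noether normalization** for prime ideals of germs. -/
theorem hasNormalizations [FiniteDimensional ℂ E] : HasNormalizations E := by
  refine hasNormalizations_of_finrank fun m hm => ?_
  clear hm
  induction m with
  | zero => exact hasNormalizations_of_finrank fun m hm => by simp at hm
  | succ m ih =>
    refine hasNormalizations_of_finrank fun m' hm => ?_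
    rw [Module.finrank_fin_fun] at hm
    obtain rfl : m' = m := by omega
    exact ih

end AnalyticGerm

/-! ### Extending homomorphisms into algebraically closed fields -/

section Algebra

open Polynomial Filter

theorem isTorsionFree_of_algebraMap_injective {A B : Type*} [CommRing A] [CommRing B] [IsDomain B]
    [Algebra A B] (h : Function.Injective (algebraMap A B)) : Module.IsTorsionFree A B := by
  have : FaithfulSMul A B := (faithfulSMul_iff_algebraMap_injective A B).2 h
  have : IsDomain A := h.isDomain _
  infer_instance

/-- A homomorphism to an algebraically closed field extends to integral extensions. -/
theorem RingHom.IsIntegral.exists_comp_eq {A B K : Type*} [CommRing A] [CommRing B] [Field K]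
    [IsAlgClosed K] {i : A →+* B} (hinj : Function.Injective i) (hi : i.IsIntegral)
    (f : A →+* K) : ∃ g : B →+* K, g.comp i = f := by
  let _ := i.toAlgebra
  have hint : Algebra.IsIntegral A B := ⟨hi⟩
  have := RingHom.ker_isPrime f
  obtain ⟨Q, -, hQ, hQP⟩ := Ideal.exists_ideal_over_prime_of_isIntegral (S := B)
    (RingHom.ker f) ⊥ (by
      have : RingHom.ker (algebraMap A B) = ⊥ := (RingHom.injective_iff_ker_eq_bot _).1 hinj
      exact this.le.trans bot_le)
  let j : (A ⧸ RingHom.ker f) →+* B ⧸ Q := Ideal.quotientMap Q i hQP.ge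
  let _ := j.toAlgebra
  let _ := (RingHom.kerLift f).toAlgebra
  have hj : Function.Injective j := Ideal.quotientMap_injective' hQP.le
  have h1 : Module.IsTorsionFree (A ⧸ RingHom.ker f) (B ⧸ Q) :=
    isTorsionFree_of_algebraMap_injective hj
  have h2 : Module.IsTorsionFree (A ⧸ RingHom.ker f) K :=
    isTorsionFree_of_algebraMap_injective (RingHom.kerLift_injective f)
  have h3 : Algebra.IsIntegral (A ⧸ RingHom.ker f) (B ⧸ Q) := by
    refine ⟨fun b => ?_⟩
    obtain ⟨b, rfl⟩ := Ideal.Quotient.mk_surjective b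
    obtain ⟨p, hp, hpb⟩ := hi b
    refine ⟨p.map (Ideal.Quotient.mk (RingHom.ker f)), hp.map _, ?_⟩
    rw [eval₂_map]
    have : (algebraMap (A ⧸ RingHom.ker f) (B ⧸ Q)).comp (Ideal.Quotient.mk (RingHom.ker f)) =
        (Ideal.Quotient.mk Q).comp i := by
      ext1 a
      rfl
    rw [this, ← hom_eval₂, hpb, map_zero]
  have : FaithfulSMul (A ⧸ RingHom.ker f) (B ⧸ Q) :=
    (faithfulSMul_iff_algebraMap_injective _ _).2 hj
  let g : (B ⧸ Q) →ₐ[A ⧸ RingHom.ker f] K := IsAlgClosed.lift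
  refine ⟨g.toRingHom.comp (Ideal.Quotient.mk Q), ?_⟩
  ext1 a
  exact (g.commutes (Ideal.Quotient.mk (RingHom.ker f) a)).trans (RingHom.kerLift_mk f a)

/-- A homomorphism to an algebraically closed field extends to integral extensions of integrally
closed domains, with a prescribed conjugate as the value at one element. -/
theorem exists_ringHom_apply_eq {A B K : Type*} [CommRing A] [IsIntegrallyClosed A]
    [CommRing B] [IsDomain B] [Field K] [IsAlgClosed K] [Algebra A B] [Algebra.IsIntegral A B]
    (hinj : Function.Injective (algebraMap A B)) (f : A →+* K) (θ : B) (τ : K)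
    (hτ : (minpoly A θ).eval₂ f τ = 0) :
    ∃ g : B →+* K, g.comp (algebraMap A B) = f ∧ g θ = τ := by
  have : IsDomain A := hinj.isDomain _
  have : Module.IsTorsionFree A B := isTorsionFree_of_algebraMap_injective hinj
  have hθ : IsIntegral A θ := Algebra.IsIntegral.isIntegral θ
  let e := minpoly.equivAdjoin hθ
  let f' : Algebra.adjoin A {θ} →+* K := (AdjoinRoot.lift f τ hτ).comp e.symm.toRingEquiv.toRingHom
  have hint : (algebraMap (Algebra.adjoin A {θ}) B).IsIntegral := fun b =>
    (Algebra.IsIntegral.isIntegral (R := A) b).tower_top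
  obtain ⟨g, hg⟩ := RingHom.IsIntegral.exists_comp_eq (i := algebraMap (Algebra.adjoin A {θ}) B)
    Subtype.val_injective hint f'
  refine ⟨g, ?_, ?_⟩
  · ext1 a
    have h1 := RingHom.congr_fun hg (algebraMap A _ a)
    rw [RingHom.comp_apply, ← IsScalarTower.algebraMap_apply] at h1
    rw [RingHom.comp_apply, h1]
    change AdjoinRoot.lift f τ hτ (e.symm (algebraMap A _ a)) = f a
    rw [e.symm.commutes, AdjoinRoot.algebraMap_eq, AdjoinRoot.lift_of]
  · have h1 := RingHom.congr_fun hg ⟨θ, Algebra.subset_adjoin rfl⟩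
    refine h1.trans ?_
    change AdjoinRoot.lift f τ hτ (e.symm ⟨θ, Algebra.subset_adjoin rfl⟩) = τ
    have h2 : e.symm ⟨θ, Algebra.subset_adjoin rfl⟩ = AdjoinRoot.root (minpoly A θ) := by
      rw [AlgEquiv.symm_apply_eq]
      apply Subtype.ext
      simp [e]
    rw [h2, AdjoinRoot.lift_root]

/-- A non-unit of a local domain that is finite over an integrally closed local ring has a minimal
polynomial with non-invertible lower coefficients. -/
theorem coeff_minpoly_mem_maximalIdeal {A B : Type*} [CommRing A] [IsLocalRing A]
    [IsIntegrallyClosed A] [CommRing B] [IsDomain B] [IsLocalRing B] [Algebra A B]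
    [Module.Finite A B] (hinj : Function.Injective (algebraMap A B)) {θ : B}
    (hθ : θ ∈ IsLocalRing.maximalIdeal B) {i : ℕ} (hi : i < (minpoly A θ).natDegree) :
    (minpoly A θ).coeff i ∈ IsLocalRing.maximalIdeal A := by
  have : IsDomain A := hinj.isDomain _
  have : Module.IsTorsionFree A B := isTorsionFree_of_algebraMap_injective hinj
  set m := IsLocalRing.maximalIdeal A
  -- `θ` is nilpotent modulo the maximal ideal of `A`
  obtain ⟨N, hN⟩ : ∃ N : ℕ, θ ^ N ∈ m.map (algebraMap A B) := by
    have h1 : θ ∈ (m.map (algebraMap A B)).radical := by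
      rw [Ideal.radical_eq_sInf, Ideal.mem_sInf]
      rintro P ⟨hmP, hP⟩
      have hle : m ≤ P.comap (algebraMap A B) := Ideal.map_le_iff_le_comap.1 hmP
      have hmax : (P.comap (algebraMap A B)).IsMaximal := by
        have h2 := (IsLocalRing.maximalIdeal.isMaximal A).eq_of_le
          (Ideal.comap_ne_top (algebraMap A B) hP.ne_top) hle
        exact h2 ▸ IsLocalRing.maximalIdeal.isMaximal A
      have := Ideal.isMaximal_of_isIntegral_of_isMaximal_comap P hmax
      rwa [IsLocalRing.eq_maximalIdeal this]
    exact h1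
  obtain ⟨p, hp, -, hpm, hpθ⟩ :=
    LinearMap.exists_monic_and_natDegree_eq_and_coeff_mem_pow_and_aeval_eq_zero A
    (Algebra.lmul A B (θ ^ N)) m (by
      rintro _ ⟨b, rfl⟩
      rw [Ideal.smul_top_eq_map]
      exact Ideal.mul_mem_right _ _ hN)
  have h1 : aeval θ (expand A N p) = 0 := by
    rw [expand_aeval]
    rw [aeval_algHom_apply] at hpθ
    have := LinearMap.congr_fun hpθ 1
    simpa using this
  have h2 := minpoly.isIntegrallyClosed_dvd (Algebra.IsIntegral.isIntegral θ) h1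
  have h3 := Polynomial.map_dvd (IsLocalRing.residue A) h2
  have h4 : p.map (IsLocalRing.residue A) = X ^ p.natDegree := by
    ext j
    rw [coeff_map, coeff_X_pow]
    split_ifs with hj
    · rw [hj, hp.coeff_natDegree, map_one]
    · rcases lt_or_gt_of_ne hj with hj | hj
      · exact Ideal.Quotient.eq_zero_iff_mem.2 (Ideal.pow_le_self (by omega) (hpm j))
      · rw [coeff_eq_zero_of_natDegree_lt hj, map_zero]
  rw [map_expand, h4, map_pow, expand_X, ← pow_mul] at h3
  obtain ⟨s, -, hs⟩ := (dvd_prime_pow prime_X _).1 h3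
  have hmon := minpoly.monic (Algebra.IsIntegral.isIntegral (R := A) θ)
  have h5 := eq_of_monic_of_associated (hmon.map (IsLocalRing.residue A)) (monic_X_pow s) hs
  have h6 : (minpoly A θ).natDegree = s := by
    rw [← hmon.natDegree_map (IsLocalRing.residue A), h5, natDegree_X_pow]
  have h7 := congrArg (fun p => coeff p i) h5
  simp only [coeff_map, coeff_X_pow] at h7
  rw [if_neg (by omega)] at h7
  exact Ideal.Quotient.eq_zero_iff_mem.1 h7

/-- Ultraproducts of `ℂ` are algebraically closed. -/
instance Filter.Germ.isAlgClosed {α : Type*} (l : Ultrafilter α) :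
    IsAlgClosed (Germ (l : Filter α) ℂ) := by
  refine IsAlgClosed.of_exists_root _ fun p hp hirr => ?_
  choose c hc using fun i => Quotient.exists_rep (p.coeff i)
  set n := p.natDegree with hn
  have hn0 : n ≠ 0 := hirr.natDegree_pos.ne'
  have hex : ∀ a : α, ∃ t : ℂ, t ^ n + ∑ i ∈ Finset.range n, c i a * t ^ i = 0 := by
    intro a
    have hdeg : (∑ i ∈ Finset.range n, C (c i a) * X ^ i).degree < (n : WithBot ℕ) := by
      refine mem_degreeLT.1 (Submodule.sum_mem _ fun i hi => mem_degreeLT.2 ?_)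
      exact (degree_C_mul_X_pow_le i _).trans_lt (by exact_mod_cast Finset.mem_range.1 hi)
    obtain ⟨t, ht⟩ := IsAlgClosed.exists_root (X ^ n + ∑ i ∈ Finset.range n, C (c i a) * X ^ i) (by
      rw [degree_add_eq_left_of_degree_lt (by rwa [degree_X_pow]), degree_X_pow]
      exact_mod_cast hn0)
    refine ⟨t, ?_⟩
    simpa [IsRoot, eval_finsetSum] using ht
  choose t ht using hex
  refine ⟨(t : Germ (l : Filter α) ℂ), ?_⟩
  rw [eval_eq_sum_range, Finset.sum_range_succ, ← hn, hn, hp.coeff_natDegree, ← hn, one_mul,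
    add_comm]
  have h1 : ∑ i ∈ Finset.range n, p.coeff i * (t : Germ (l : Filter α) ℂ) ^ i =
      ((∑ i ∈ Finset.range n, fun a => c i a * t a ^ i : α → ℂ) : Germ (l : Filter α) ℂ) := by
    refine Eq.trans ?_ (map_sum (Germ.coeRingHom (l : Filter α)) _ _).symm
    refine Finset.sum_congr rfl fun i _ => ?_
    rw [← hc i]
    rfl
  rw [h1]
  refine Germ.coe_eq.2 (Eventually.of_forall fun a => ?_)
  simpa using ht a

end Algebra

/-! ### Lifting points from the base -/

namespace AnalyticGerm

open Filter Polynomial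

variable {E : Type*} [NormedAddCommGroup E] [NormedSpace ℂ E]
  {E' : Type*} [NormedAddCommGroup E'] [NormedSpace ℂ E'] {ι : Type*}

/-- The monic polynomial obtained from a monic polynomial with coefficients in the ring of germs
by evaluating the coefficients at `z`. -/
noncomputable def polyAt (p : (AnalyticGerm E')[X]) (z : E') : ℂ[X] :=
  X ^ p.natDegree + ∑ i ∈ Finset.range p.natDegree, C ((p.coeff i).rep z) * X ^ i

theorem eval_polyAt (p : (AnalyticGerm E')[X]) (z : E') (t : ℂ) : (polyAt p z).eval t =
    t ^ p.natDegree + ∑ i ∈ Finset.range p.natDegree, (p.coeff i).rep z * t ^ i := by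
  simp [polyAt, eval_finsetSum]

theorem degree_polyAt_aux (p : (AnalyticGerm E')[X]) (z : E') :
    (∑ i ∈ Finset.range p.natDegree, C ((p.coeff i).rep z) * X ^ i).degree <
      (p.natDegree : WithBot ℕ) := by
  refine mem_degreeLT.1 (Submodule.sum_mem _ fun i hi => mem_degreeLT.2 ?_)
  exact (degree_C_mul_X_pow_le i _).trans_lt (by exact_mod_cast Finset.mem_range.1 hi)

theorem monic_polyAt (p : (AnalyticGerm E')[X]) (z : E') : (polyAt p z).Monic :=
  monic_X_pow_add (degree_polyAt_aux p z)

theorem natDegree_polyAt (p : (AnalyticGerm E')[X]) (z : E') :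
    (polyAt p z).natDegree = p.natDegree := by
  refine natDegree_eq_of_degree_eq_some ?_
  rw [polyAt, degree_add_eq_left_of_degree_lt (by rw [degree_X_pow]; exact degree_polyAt_aux p z),
    degree_X_pow]

theorem eval₂_evalAlong {p : (AnalyticGerm E')[X]} (hp : p.Monic) {α : Type*} {l : Filter α}
    {z : α → E'} (hz : Tendsto z l (𝓝 0)) (t : α → ℂ) :
    p.eval₂ (evalAlong z hz) (t : Germ l ℂ) =
      ((fun a => (polyAt p (z a)).eval (t a) : α → ℂ) : Germ l ℂ) := by
  rw [eval₂_eq_sum_range, Finset.sum_range_succ, hp.coeff_natDegree, map_one, one_mul, add_comm]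
  have h1 : ∑ i ∈ Finset.range p.natDegree, evalAlong z hz (p.coeff i) * (t : Germ l ℂ) ^ i =
      ((∑ i ∈ Finset.range p.natDegree, fun a => (p.coeff i).rep (z a) * t a ^ i : α → ℂ) :
        Germ l ℂ) := by
    refine Eq.trans ?_ (map_sum (Germ.coeRingHom l) _ _).symm
    refine Finset.sum_congr rfl fun i _ => ?_
    rw [evalAlong_eq]
    rfl
  rw [h1]
  refine Germ.coe_eq.2 (Eventually.of_forall fun a => ?_)
  simp [eval_polyAt]

/-- The values of a polynomial expression with coefficients from the base. -/
theorem rep_eval₂_pull (L : E →L[ℂ] E') {p : (AnalyticGerm E')[X]} (hp : p.Monic)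
    (θ : AnalyticGerm E) :
    (p.eval₂ (pull L) θ).rep =ᶠ[𝓝 0] fun u => (polyAt p (L u)).eval (θ.rep u) := by
  have hL : Tendsto L (𝓝 0) (𝓝 0) := by simpa using L.continuous.tendsto 0
  rw [← Germ.coe_eq, coe_rep, hom_eval₂, ← coe_rep, ← eval₂_evalAlong hp hL]
  rfl

/-- The minimal polynomial of a germ modulo `I` over the germs on the base. -/
noncomputable def relPoly (Φ : E ≃L[ℂ] E' × (ι → ℂ)) (I : Ideal (AnalyticGerm E))
    (θ : AnalyticGerm E) : (AnalyticGerm E')[X] :=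
  let _ := ((Ideal.Quotient.mk I).comp (pull (prBase Φ))).toAlgebra
  minpoly (AnalyticGerm E') (Ideal.Quotient.mk I θ)

variable {Φ : E ≃L[ℂ] E' × (ι → ℂ)} {I : Ideal (AnalyticGerm E)}

theorem IsNormalization.injective (h : IsNormalization Φ I) :
    Function.Injective ((Ideal.Quotient.mk I).comp (pull (prBase Φ))) := by
  rw [injective_iff_map_eq_zero]
  intro φ hφ
  exact h.eq_zero_of_pull_mem φ (Ideal.Quotient.eq_zero_iff_mem.1 hφ)

theorem IsNormalization.monic_relPoly (h : IsNormalization Φ I) (θ : AnalyticGerm E) :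
    (relPoly Φ I θ).Monic := by
  let _ := ((Ideal.Quotient.mk I).comp (pull (prBase Φ))).toAlgebra
  have : Module.Finite (AnalyticGerm E') (AnalyticGerm E ⧸ I) := h.finite
  exact minpoly.monic (Algebra.IsIntegral.isIntegral _)

theorem eval₂_relPoly_mem (θ : AnalyticGerm E) :
    (relPoly Φ I θ).eval₂ (pull (prBase Φ)) θ ∈ I := by
  let _ := ((Ideal.Quotient.mk I).comp (pull (prBase Φ))).toAlgebra
  rw [← Ideal.Quotient.eq_zero_iff_mem, hom_eval₂]
  exact minpoly.aeval (AnalyticGerm E') (Ideal.Quotient.mk I θ)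

/-- The minimal polynomial of `θ` has the smallest degree among all nonzero polynomials that
annihilate `θ` modulo `I`, monic or not, because the ring of germs on the base is integrally closed.
-/
theorem IsNormalization.natDegree_relPoly_le (h : IsNormalization Φ I) (θ : AnalyticGerm E)
    {p : (AnalyticGerm E')[X]} (hp : p ≠ 0) [FiniteDimensional ℂ E'] [I.IsPrime]
    (hpI : p.eval₂ (pull (prBase Φ)) θ ∈ I) :
    (relPoly Φ I θ).natDegree ≤ p.natDegree := by
  let _ := ((Ideal.Quotient.mk I).comp (pull (prBase Φ))).toAlgebra
  have : Module.Finite (AnalyticGerm E') (AnalyticGerm E ⧸ I) := h.finite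
  have : Module.IsTorsionFree (AnalyticGerm E') (AnalyticGerm E ⧸ I) :=
    isTorsionFree_of_algebraMap_injective h.injective
  refine natDegree_le_of_dvd (minpoly.isIntegrallyClosed_dvd
    (Algebra.IsIntegral.isIntegral (Ideal.Quotient.mk I θ)) ?_) hp
  rw [← Ideal.Quotient.eq_zero_iff_mem, hom_eval₂] at hpI
  exact hpI

/-- The minimal polynomial of a germ that vanishes at `0` is a Weierstrass polynomial, because the
ring of germs modulo `I` is local. -/
theorem IsNormalization.value_coeff_relPoly (h : IsNormalization Φ I)
    [FiniteDimensional ℂ E'] [I.IsPrime] {θ : AnalyticGerm E}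
    (hθ : value θ = 0) {i : ℕ} (hi : i < (relPoly Φ I θ).natDegree) :
    value ((relPoly Φ I θ).coeff i) = 0 := by
  let _ := ((Ideal.Quotient.mk I).comp (pull (prBase Φ))).toAlgebra
  have : Module.Finite (AnalyticGerm E') (AnalyticGerm E ⧸ I) := h.finite
  have : IsLocalRing (AnalyticGerm E ⧸ I) :=
    IsLocalRing.of_surjective' (Ideal.Quotient.mk I) Ideal.Quotient.mk_surjective
  rw [← mem_maximalIdeal_iff]
  refine coeff_minpoly_mem_maximalIdeal h.injective ?_ hi
  rw [IsLocalRing.mem_maximalIdeal, mem_nonunits_iff]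
  intro hu
  obtain ⟨b, hb⟩ := hu.exists_right_inv
  obtain ⟨γ, rfl⟩ := Ideal.Quotient.mk_surjective b
  rw [← map_mul, ← map_one (Ideal.Quotient.mk I), Ideal.Quotient.eq] at hb
  refine (Ideal.ne_top_iff_one I).1 (Ideal.IsPrime.ne_top ‹_›) ?_
  have hv : IsUnit (θ * γ - 1) := isUnit_iff.2 (by rw [map_sub, map_mul, hθ, map_one]; simp)
  rw [Ideal.eq_top_of_isUnit_mem I hb hv]
  trivial

/-- Points of the base that tend to `0`, with a root of the minimal polynomial of `θ` over each of
them, lift along an ultrafilter to zeros of `I` at which `θ` takes the value of the root: a root is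
a homomorphism from a subring of the germs modulo `I` to the ultraproduct of copies of `ℂ`, which
is algebraically closed, and the homomorphism extends. -/
theorem IsNormalization.exists_lift_ultrafilter (h : IsNormalization Φ I)
    [FiniteDimensional ℂ E'] [I.IsPrime] [Finite ι] {α : Type*} (l : Ultrafilter α)
    {z : α → E'} (hz : Tendsto z l (𝓝 0)) (θ : AnalyticGerm E) {τ : α → ℂ}
    (hτ : ∀ᶠ a in (l : Filter α), (polyAt (relPoly Φ I θ) (z a)).eval (τ a) = 0) :
    ∃ u : α → E, Tendsto u l (𝓝 0) ∧ (∀ a, prBase Φ (u a) = z a) ∧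
      (∀ F ∈ I, ∀ᶠ a in (l : Filter α), F.rep (u a) = 0) ∧
      ∀ᶠ a in (l : Filter α), θ.rep (u a) = τ a := by
  have := Fintype.ofFinite ι
  obtain ⟨χ, hχ, hχθ⟩ : ∃ χ : AnalyticGerm E ⧸ I →+* Germ (l : Filter α) ℂ,
      χ.comp ((Ideal.Quotient.mk I).comp (pull (prBase Φ))) = evalAlong z hz ∧
        χ (Ideal.Quotient.mk I θ) = (τ : Germ (l : Filter α) ℂ) := by
    let _ := ((Ideal.Quotient.mk I).comp (pull (prBase Φ))).toAlgebra
    have : Module.Finite (AnalyticGerm E') (AnalyticGerm E ⧸ I) := h.finite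
    refine exists_ringHom_apply_eq h.injective (evalAlong z hz) _ _ ?_
    change (relPoly Φ I θ).eval₂ (evalAlong z hz) (τ : Germ (l : Filter α) ℂ) = 0
    rw [eval₂_evalAlong (h.monic_relPoly θ) hz]
    exact Germ.coe_eq.2 hτ
  choose σ hσ using fun j => Quotient.exists_rep (χ (Ideal.Quotient.mk I (ofDual (prCoord Φ j))))
  have hσ0 : ∀ j, Tendsto (σ j) l (𝓝 0) := by
    intro j
    set p := relPoly Φ I (ofDual (prCoord Φ j)) with hp
    have h1 : p.eval₂ (evalAlong z hz) (σ j : Germ (l : Filter α) ℂ) = 0 := by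
      have : (σ j : Germ (l : Filter α) ℂ) = χ (Ideal.Quotient.mk I (ofDual (prCoord Φ j))) := hσ j
      rw [this, ← hχ, ← RingHom.comp_assoc]
      have h2 := congrArg χ (Ideal.Quotient.eq_zero_iff_mem.2
        (eval₂_relPoly_mem (Φ := Φ) (I := I) (ofDual (prCoord Φ j))))
      rwa [map_zero, hom_eval₂, hom_eval₂, ← RingHom.comp_assoc] at h2
    rw [eval₂_evalAlong (h.monic_relPoly _) hz] at h1
    refine tendsto_zero_of_pow_eq_sum (k := p.natDegree)
      (c := fun i a => -(p.coeff i).rep (z a)) (fun i hi => ?_) ?_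
    · have := ((p.coeff i).tendsto_rep.comp hz).neg
      rwa [h.value_coeff_relPoly (value_ofDual _) hi, neg_zero] at this
    · filter_upwards [Germ.coe_eq.1 h1] with a ha
      rw [eval_polyAt] at ha
      rw [eq_neg_of_add_eq_zero_left ha, ← Finset.sum_neg_distrib]
      exact Finset.sum_congr rfl fun i _ => by ring
  let u : α → E := fun a => Φ.symm (z a, fun j => σ j a)
  have hu : Tendsto u l (𝓝 0) := by
    have h1 : Tendsto (fun a => (z a, fun j => σ j a)) l (𝓝 ((0 : E'), (0 : ι → ℂ))) :=
      hz.prodMk_nhds (tendsto_pi_nhds.2 hσ0)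
    have h2 := (Φ.symm.continuous.tendsto ((0 : E'), (0 : ι → ℂ))).comp h1
    rwa [Prod.mk_zero_zero, map_zero] at h2
  have hbase : ∀ a, prBase Φ (u a) = z a := fun a => by simp [u]
  -- substitution of the lifted points agrees with `χ` on polynomials in the fibre coordinates
  have hagree : ∀ P ∈ fibrePolynomials Φ, evalAlong u hu P = χ (Ideal.Quotient.mk I P) := by
    intro P hP
    refine RingHom.eqOn_set_closure (f := evalAlong u hu) (g := χ.comp (Ideal.Quotient.mk I)) ?_ hP
    rintro _ (⟨φ, rfl⟩ | ⟨j, rfl⟩)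
    · rw [evalAlong_pull u hu (prBase Φ) (hz.congr fun a => (hbase a).symm)]
      have := RingHom.congr_fun hχ φ
      rw [RingHom.comp_apply, RingHom.comp_apply] at this
      rw [RingHom.comp_apply, this]
      rw [evalAlong_eq, evalAlong_eq]
      exact congrArg _ (funext fun a => congrArg φ.rep (hbase a))
    · change evalAlong u hu (ofDual (prCoord Φ j)) = χ (Ideal.Quotient.mk I (ofDual (prCoord Φ j)))
      refine Eq.trans ?_ (hσ j)
      rw [ofDual, evalAlong_mk]
      refine congrArg _ (funext fun a => ?_)
      simp [u]
  have hI : ∀ F ∈ I, evalAlong u hu F = 0 := by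
    intro F hF
    rw [← h.polynomialPart_eq] at hF
    suffices polynomialPart Φ I ≤ RingHom.ker (evalAlong u hu) from this hF
    refine Ideal.span_le.2 fun P hP => ?_
    rw [SetLike.mem_coe, RingHom.mem_ker, hagree P hP.1, Ideal.Quotient.eq_zero_iff_mem.2 hP.2,
      map_zero]
  refine ⟨u, hu, hbase, fun F hF => ?_, ?_⟩
  · have := hI F hF
    rw [evalAlong_eq] at this
    exact Germ.coe_eq.1 this
  · obtain ⟨P, hP, hPθ⟩ := h.exists_sub_mem θ
    have h1 : evalAlong u hu θ = (τ : Germ (l : Filter α) ℂ) := by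
      have h2 := hI _ (polynomialPart_le Φ I hPθ)
      rw [map_sub, sub_eq_zero] at h2
      rw [h2, hagree P hP, ← hχθ]
      exact congrArg χ (Ideal.Quotient.eq.2 (polynomialPart_le Φ I hPθ)).symm
    rw [evalAlong_eq] at h1
    exact Germ.coe_eq.1 h1

/-- `Z` is near `0` the zero set of finitely many germs, and `I` is the ideal of the germs that
vanish on `Z`. -/
structure IsZeroLocus (Z : Set E) (I : Ideal (AnalyticGerm E)) : Prop where
  mem_iff : ∀ F, F ∈ I ↔ ∀ᶠ u in 𝓝[Z] 0, F.rep u = 0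
  exists_eq : ∃ (m : ℕ) (F : Fin m → AnalyticGerm E), ∀ᶠ u in 𝓝 0, u ∈ Z ↔ ∀ i, (F i).rep u = 0

/-- Points that tend to `0` and at which every germ of `I` eventually vanishes eventually lie on
`Z`. -/
theorem IsZeroLocus.eventually_mem {Z : Set E} {I : Ideal (AnalyticGerm E)} (hZ : IsZeroLocus Z I)
    {α : Type*} {l : Filter α} {u : α → E} (hu : Tendsto u l (𝓝 0))
    (hI : ∀ F ∈ I, ∀ᶠ a in l, F.rep (u a) = 0) : ∀ᶠ a in l, u a ∈ Z := by
  obtain ⟨m, F, hF⟩ := hZ.exists_eq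
  have h1 : ∀ i, F i ∈ I := fun i => (hZ.mem_iff _).2 <| by
    filter_upwards [nhdsWithin_le_nhds hF, self_mem_nhdsWithin] with v hv hvZ
    exact hv.1 hvZ i
  filter_upwards [hu.eventually hF, eventually_all.2 fun i => hI _ (h1 i)] with a h2 h3
  exact h2.2 h3

/-- Every root of the minimal polynomial of `θ` over a point near `0` of the base is the value
of `θ` at a point of `Z`. -/
theorem IsNormalization.eventually_exists_mem [FiniteDimensional ℂ E'] [Finite ι]
    {Φ : E ≃L[ℂ] E' × (ι → ℂ)} {I : Ideal (AnalyticGerm E)} [I.IsPrime] (h : IsNormalization Φ I)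
    {Z : Set E} (hZ : IsZeroLocus Z I) (θ : AnalyticGerm E) {N : Set E} (hN : N ∈ 𝓝 0) :
    ∀ᶠ z in 𝓝 (0 : E'), ∀ τ : ℂ, (polyAt (relPoly Φ I θ) z).eval τ = 0 →
      ∃ u ∈ N, u ∈ Z ∧ prBase Φ u = z ∧ θ.rep u = τ := by
  by_contra hcon
  rw [not_eventually] at hcon
  let B : Set E' := {z | ¬ ∀ τ : ℂ, (polyAt (relPoly Φ I θ) z).eval τ = 0 →
      ∃ u ∈ N, u ∈ Z ∧ prBase Φ u = z ∧ θ.rep u = τ}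
  have hB : (𝓝 (0 : E') ⊓ 𝓟 B).NeBot := frequently_mem_iff_neBot.1 hcon
  let l := Ultrafilter.of (𝓝 (0 : E') ⊓ 𝓟 B)
  have hl : (l : Filter E') ≤ 𝓝 0 ⊓ 𝓟 B := Ultrafilter.of_le _
  have hlB : ∀ᶠ z in (l : Filter E'), z ∈ B := (hl.trans inf_le_right) (mem_principal_self B)
  have hex : ∀ z, ∃ τ : ℂ, z ∈ B → (polyAt (relPoly Φ I θ) z).eval τ = 0 ∧
      ¬ ∃ u ∈ N, u ∈ Z ∧ prBase Φ u = z ∧ θ.rep u = τ := by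
    intro z
    by_cases hz : z ∈ B
    · have hz' : ¬ ∀ τ : ℂ, (polyAt (relPoly Φ I θ) z).eval τ = 0 →
        ∃ u ∈ N, u ∈ Z ∧ prBase Φ u = z ∧ θ.rep u = τ := hz
      push Not at hz'
      obtain ⟨τ, h1, h2⟩ := hz'
      exact ⟨τ, fun _ => ⟨h1, by push Not; exact h2⟩⟩
    · exact ⟨0, fun h => absurd h hz⟩
  choose τ hτ using hex
  obtain ⟨u, hu, hu1, hu2, hu3⟩ := h.exists_lift_ultrafilter l (z := id)
    (hl.trans inf_le_left) θ (τ := τ) (hlB.mono fun z hz => (hτ z hz).1)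
  obtain ⟨z, h1, h2, h3, h4⟩ :=
    (((hu.eventually hN).and (hZ.eventually_mem hu hu2)).and (hu3.and hlB)).exists.imp
      fun z h => And.intro h.1.1 (And.intro h.1.2 (And.intro h.2.1 h.2.2))
  exact (hτ z h4).2 ⟨u z, h1, h2, hu1 z, h3⟩

end AnalyticGerm

/-! ### Openness of the projection to the base -/

open Filter Polynomial

/-- At a point where a monic polynomial is small, one of its roots is near. -/
theorem Polynomial.exists_root_norm_sub_pow_le {p : ℂ[X]} (hp : p.Monic) (hn : p.natDegree ≠ 0)
    (t : ℂ) : ∃ ρ, p.eval ρ = 0 ∧ ‖t - ρ‖ ^ p.natDegree ≤ ‖p.eval t‖ := by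
  have hs : p.Splits := IsAlgClosed.splits p
  have hcard : p.roots.card = p.natDegree := hs.natDegree_eq_card_roots.symm
  have hne : p.roots.toFinset.Nonempty := by
    rw [Finset.nonempty_iff_ne_empty, Ne, Multiset.toFinset_eq_empty, ← Multiset.card_eq_zero,
      hcard]
    exact hn
  obtain ⟨ρ, hρ, hmin⟩ := p.roots.toFinset.exists_min_image (fun ρ => ‖t - ρ‖) hne
  refine ⟨ρ, (mem_roots'.1 (Multiset.mem_toFinset.1 hρ)).2, ?_⟩
  have key : ∀ m : Multiset ℂ, (∀ x ∈ m, ‖t - ρ‖ ≤ ‖t - x‖) →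
      ‖t - ρ‖ ^ m.card ≤ ‖(m.map fun x => t - x).prod‖ := by
    intro m
    induction m using Multiset.induction_on with
    | empty => simp
    | cons a m ih =>
      intro h
      rw [Multiset.card_cons, Multiset.map_cons, Multiset.prod_cons, norm_mul, pow_succ']
      exact mul_le_mul (h a (Multiset.mem_cons_self a m))
        (ih fun x hx => h x (Multiset.mem_cons_of_mem hx)) (by positivity) (by positivity)
  have h1 := key p.roots fun x hx => hmin x (Multiset.mem_toFinset.2 hx)
  rw [hcard] at h1
  convert h1 using 2
  conv_lhs => rw [hs.eq_prod_roots_of_monic hp]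
  rw [eval_multiset_prod, Multiset.map_map]
  simp

/-- Finitely many linear forms suffice to separate `0` from all sets of at most `D` other
vectors. -/
theorem exists_finset_separating (ι : Type*) [Fintype ι] (D : ℕ) :
    ∃ Λ : Finset (ι → ℂ), ∀ T : Finset (ι → ℂ), T.card ≤ D → 0 ∉ T →
      ∃ a ∈ Λ, ∀ c ∈ T, ∑ j, a j * c j ≠ 0 := by
  classical
  set m := Fintype.card ι
  let e := Fintype.equivFin ι
  -- points on the moment curve
  refine ⟨(Finset.range (D * m + 1)).image fun (s : ℕ) (j : ι) => (s : ℂ) ^ (e j : ℕ),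
    fun T hT h0 => ?_⟩
  let P : (ι → ℂ) → ℂ[X] := fun c => ∑ j, C (c j) * X ^ (e j : ℕ)
  have hP : ∀ c j, (P c).coeff (e j) = c j := by
    intro c j
    simp only [P, finsetSum_coeff, coeff_C_mul, coeff_X_pow]
    rw [Finset.sum_eq_single j]
    · simp
    · intro k _ hk
      rw [if_neg, mul_zero]
      intro h
      exact hk (e.injective (Fin.ext h)).symm
    · simp
  have hdeg : ∀ c, (P c).natDegree ≤ m := fun c =>
    natDegree_sum_le_of_forall_le _ _ fun j _ =>
      (natDegree_C_mul_X_pow_le _ _).trans (e j).2.le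
  have heval : ∀ c (s : ℂ), (P c).eval s = ∑ j, s ^ (e j : ℕ) * c j := by
    intro c s
    simp only [P, eval_finsetSum, eval_mul, eval_C, eval_pow, eval_X]
    exact Finset.sum_congr rfl fun j _ => mul_comm _ _
  by_contra! hcon
  have h1 : Finset.range (D * m + 1) ⊆ T.biUnion fun c =>
      (Finset.range (D * m + 1)).filter fun s => (P c).eval (s : ℂ) = 0 := by
    intro s hs
    obtain ⟨c, hc, hsc⟩ := hcon _ (Finset.mem_image_of_mem _ hs)
    refine Finset.mem_biUnion.2 ⟨c, hc, Finset.mem_filter.2 ⟨hs, ?_⟩⟩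
    rw [heval]
    exact hsc
  have h2 : ∀ c ∈ T, ((Finset.range (D * m + 1)).filter fun s : ℕ =>
      (P c).eval (s : ℂ) = 0).card ≤ m := by
    intro c hc
    have hc0 : P c ≠ 0 := by
      rintro h
      refine h0 ?_
      convert hc
      ext j
      rw [← hP c j, h]
      simp
    calc _ ≤ (P c).roots.toFinset.card := by
          refine Finset.card_le_card_of_injOn (fun s : ℕ => (s : ℂ)) ?_
            (Nat.cast_injective.injOn)
          intro s hs
          have := (Finset.mem_filter.1 hs).2
          simpa [hc0] using this
      _ ≤ (P c).roots.card := Multiset.toFinset_card_le _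
      _ ≤ (P c).natDegree := card_roots' _
      _ ≤ m := hdeg c
  have h3 := (Finset.card_le_card h1).trans (Finset.card_biUnion_le_card_mul _ _ m h2)
  rw [Finset.card_range] at h3
  have := Nat.mul_le_mul_right m hT
  omega

namespace AnalyticGerm

variable {E : Type*} [NormedAddCommGroup E] [NormedSpace ℂ E]
  {E' : Type*} [NormedAddCommGroup E'] [NormedSpace ℂ E'] {ι : Type*}

theorem eventually_continuousAt_polyAt (p : (AnalyticGerm E')[X]) :
    ∀ᶠ z in 𝓝 (0 : E'), ∀ t : ℂ,
      ContinuousAt (fun y : E' × ℂ => (polyAt p y.1).eval y.2) (z, t) := by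
  have h : ∀ᶠ z in 𝓝 (0 : E'), ∀ i ∈ Finset.range p.natDegree,
      AnalyticAt ℂ (p.coeff i).rep z := by
    rw [Filter.eventually_all_finset]
    exact fun i _ => (p.coeff i).analyticAt_rep.eventually_analyticAt
  filter_upwards [h] with z hz t
  simp only [eval_polyAt]
  refine (continuousAt_snd.pow _).add (tendsto_finsetSum _ fun i hi => ?_)
  exact (ContinuousAt.comp (f := Prod.fst) (g := (p.coeff i).rep) (hz i hi).continuousAt
    continuousAt_fst).mul (continuousAt_snd.pow _)

theorem IsZeroLocus.eventually_eval_relPoly {Φ : E ≃L[ℂ] E' × (ι → ℂ)}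
    {I : Ideal (AnalyticGerm E)} (h : IsNormalization Φ I) {Z : Set E} (hZ : IsZeroLocus Z I)
    (ℓ : E →L[ℂ] ℂ) :
    ∀ᶠ u in 𝓝[Z] 0, (polyAt (relPoly Φ I (ofDual ℓ)) (prBase Φ u)).eval (ℓ u) = 0 := by
  filter_upwards [(hZ.mem_iff _).1 (eval₂_relPoly_mem (Φ := Φ) (I := I) (ofDual ℓ)),
    nhdsWithin_le_nhds (rep_eval₂_pull (prBase Φ) (h.monic_relPoly (ofDual ℓ)) (ofDual ℓ)),
    nhdsWithin_le_nhds (rep_ofDual ℓ)] with u h1 h2 h3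
  rw [← h3, ← h2, h1]

/-- The projection of a zero locus to the base is open at all points near `0`. -/
theorem IsNormalization.eventually_nhds_le_map [FiniteDimensional ℂ E] [FiniteDimensional ℂ E']
    [Fintype ι] {Φ : E ≃L[ℂ] E' × (ι → ℂ)} {I : Ideal (AnalyticGerm E)} [I.IsPrime]
    (h : IsNormalization Φ I) {Z : Set E} (hZ : IsZeroLocus Z I) :
    ∀ᶠ b in 𝓝[Z] 0, 𝓝 (prBase Φ b) ≤ map (prBase Φ) (𝓝[Z] b) := by
  classical
  let Q : ι → (AnalyticGerm E')[X] := fun j => relPoly Φ I (ofDual (prCoord Φ j))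
  obtain ⟨Λ, hΛ⟩ := exists_finset_separating ι (∏ j, (Q j).natDegree)
  let ℓ : (ι → ℂ) → (E →L[ℂ] ℂ) := fun a => ∑ j, a j • prCoord Φ j
  have hℓ : ∀ a u, ℓ a u = ∑ j, a j * prCoord Φ j u := by
    intro a u
    simp [ℓ]
  let L : (ι → ℂ) → (AnalyticGerm E')[X] := fun a => relPoly Φ I (ofDual (ℓ a))
  have hπ : Tendsto (prBase Φ) (𝓝 0) (𝓝 0) := by simpa using (prBase Φ).continuous.tendsto 0
  -- a ball in which everything holds
  have hQZ : ∀ᶠ u in 𝓝 (0 : E), u ∈ Z →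
      ∀ j, (polyAt (Q j) (prBase Φ u)).eval (prCoord Φ j u) = 0 := by
    rw [← eventually_nhdsWithin_iff, eventually_all]
    exact fun j => hZ.eventually_eval_relPoly h _
  have hℓrep : ∀ᶠ u in 𝓝 (0 : E), ∀ a ∈ Λ, (ofDual (ℓ a)).rep u = ℓ a u := by
    rw [Filter.eventually_all_finset]
    exact fun a _ => rep_ofDual (ℓ a)
  obtain ⟨r, hr, hball⟩ := Metric.eventually_nhds_iff_ball.1 (hQZ.and hℓrep)
  have hclaim : ∀ᶠ z in 𝓝 (0 : E'), ∀ a ∈ Λ, ∀ τ : ℂ, (polyAt (L a) z).eval τ = 0 →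
      ∃ u ∈ Metric.ball (0 : E) r, u ∈ Z ∧ prBase Φ u = z ∧ (ofDual (ℓ a)).rep u = τ := by
    rw [Filter.eventually_all_finset]
    exact fun a _ => h.eventually_exists_mem hZ (ofDual (ℓ a)) (Metric.ball_mem_nhds 0 hr)
  have hcont : ∀ᶠ z in 𝓝 (0 : E'), ∀ j, ∀ t : ℂ,
      ContinuousAt (fun y : E' × ℂ => (polyAt (Q j) y.1).eval y.2) (z, t) :=
    eventually_all.2 fun j => eventually_continuousAt_polyAt _
  have hcont' : ∀ᶠ z in 𝓝 (0 : E'), ∀ a ∈ Λ, ∀ t : ℂ,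
      ContinuousAt (fun y : E' × ℂ => (polyAt (L a) y.1).eval y.2) (z, t) := by
    rw [Filter.eventually_all_finset]
    exact fun a _ => eventually_continuousAt_polyAt _
  have hLZ : ∀ᶠ u in 𝓝[Z] (0 : E), ∀ a ∈ Λ, (polyAt (L a) (prBase Φ u)).eval (ℓ a u) = 0 := by
    rw [Filter.eventually_all_finset]
    exact fun a _ => hZ.eventually_eval_relPoly h _
  filter_upwards [hLZ, nhdsWithin_le_nhds (hπ.eventually hclaim.eventually_nhds),
    nhdsWithin_le_nhds (hπ.eventually (hcont.and hcont')), self_mem_nhdsWithin,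
    nhdsWithin_le_nhds (Metric.ball_mem_nhds 0 hr)] with b hb1 hb2 hb3 hbZ hbr
  obtain ⟨hb3, hb4⟩ := hb3
  -- a linear form that separates `b` from the other points of the fibre
  obtain ⟨a, ha, hsep⟩ : ∃ a ∈ Λ, ∀ u, prBase Φ u = prBase Φ b →
      (∀ j, (polyAt (Q j) (prBase Φ b)).eval (prCoord Φ j u) = 0) → ℓ a u = ℓ a b → u = b := by
    let R : Finset (ι → ℂ) := Fintype.piFinset fun j => (polyAt (Q j) (prBase Φ b)).roots.toFinset
    have hR : R.card ≤ ∏ j, (Q j).natDegree := by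
      rw [Fintype.card_piFinset]
      refine Finset.prod_le_prod' fun j _ => ?_
      exact (Multiset.toFinset_card_le _).trans ((card_roots' _).trans (natDegree_polyAt _ _).le)
    obtain ⟨a, ha, h1⟩ := hΛ ((R.image fun c j => c j - prCoord Φ j b).erase 0)
      ((Finset.card_erase_le.trans Finset.card_image_le).trans hR) (Finset.notMem_erase _ _)
    refine ⟨a, ha, fun u hu1 hu2 hu3 => ?_⟩
    by_contra hne
    refine h1 (fun j => prCoord Φ j u - prCoord Φ j b)
      (Finset.mem_erase.2 ⟨fun h0 => hne ?_, ?_⟩) ?_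
    · refine Φ.injective (Prod.ext hu1 (funext fun j => ?_))
      exact sub_eq_zero.1 (congrFun h0 j)
    · refine Finset.mem_image.2 ⟨fun j => prCoord Φ j u, Fintype.mem_piFinset.2 fun j => ?_, rfl⟩
      rw [Multiset.mem_toFinset, mem_roots (monic_polyAt _ _).ne_zero]
      exact hu2 j
    · simp only [mul_sub, Finset.sum_sub_distrib]
      rw [← hℓ, ← hℓ, hu3, sub_self]
  have hn : (L a).natDegree ≠ 0 := by
    intro h0
    have h1 := hb1 a ha
    rw [eval_polyAt, h0] at h1
    simp at h1
  intro s hs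
  rw [mem_map] at hs
  obtain ⟨N, hN, hNs⟩ := mem_nhdsWithin_iff_exists_mem_nhds_inter.1 hs
  rw [mem_iff_ultrafilter]
  intro l hl
  -- the root over `z` that is nearest to the value at `b`
  have hroot : ∀ z, ∃ ρ, (polyAt (L a) z).eval ρ = 0 ∧
      ‖ℓ a b - ρ‖ ^ (L a).natDegree ≤ ‖(polyAt (L a) z).eval (ℓ a b)‖ := by
    intro z
    have := exists_root_norm_sub_pow_le (monic_polyAt (L a) z) (by rwa [natDegree_polyAt]) (ℓ a b)
    rwa [natDegree_polyAt] at this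
  choose τ hτ1 hτ2 using hroot
  have hτ : Tendsto τ l (𝓝 (ℓ a b)) := by
    have h1 : Tendsto (fun z => (polyAt (L a) z).eval (ℓ a b)) l (𝓝 0) := by
      have h2 := (hb4 a ha (ℓ a b)).tendsto.comp
        (Tendsto.prodMk_nhds (hl : Tendsto id (l : Filter E') (𝓝 (prBase Φ b)))
          (tendsto_const_nhds (x := ℓ a b)))
      rw [hb1 a ha] at h2
      exact h2
    have h3 : Tendsto (fun z => ‖ℓ a b - τ z‖ ^ (L a).natDegree) l (𝓝 0) :=
      squeeze_zero (fun z => by positivity) hτ2 (by simpa using h1.norm)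
    have h4 : Tendsto (fun z => ‖ℓ a b - τ z‖) l (𝓝 0) := by
      rw [Metric.tendsto_nhds] at h3 ⊢
      intro ε hε
      filter_upwards [h3 (ε ^ (L a).natDegree) (by positivity)] with z hz
      rw [dist_zero_right, norm_norm]
      rw [dist_zero_right, norm_pow, norm_norm] at hz
      exact lt_of_pow_lt_pow_left₀ _ hε.le hz
    have h5 := tendsto_zero_iff_norm_tendsto_zero.2 h4
    have h6 := h5.const_sub (ℓ a b)
    simpa using h6
  have hex : ∀ z, ∃ u : E, (∀ a ∈ Λ, ∀ τ : ℂ, (polyAt (L a) z).eval τ = 0 →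
      ∃ u ∈ Metric.ball (0 : E) r, u ∈ Z ∧ prBase Φ u = z ∧ (ofDual (ℓ a)).rep u = τ) →
      u ∈ Metric.ball (0 : E) r ∧ u ∈ Z ∧ prBase Φ u = z ∧ ℓ a u = τ z := by
    intro z
    by_cases hz : ∀ a ∈ Λ, ∀ τ : ℂ, (polyAt (L a) z).eval τ = 0 →
      ∃ u ∈ Metric.ball (0 : E) r, u ∈ Z ∧ prBase Φ u = z ∧ (ofDual (ℓ a)).rep u = τ
    · obtain ⟨u, h1, h2, h3, h4⟩ := hz a ha (τ z) (hτ1 z)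
      exact ⟨u, fun _ => ⟨h1, h2, h3, by rw [← h4, (hball u h1).2 a ha]⟩⟩
    · exact ⟨0, fun h => absurd h hz⟩
  choose u hu using hex
  have hu' : ∀ᶠ z in (l : Filter E'), u z ∈ Metric.ball (0 : E) r ∧ u z ∈ Z ∧
      prBase Φ (u z) = z ∧ ℓ a (u z) = τ z := (hb2.filter_mono hl).mono fun z hz => hu z hz
  -- the lifted points converge, and the limit is `b`
  have : ProperSpace E := FiniteDimensional.proper ℂ E
  obtain ⟨v, -, hv⟩ := (isCompact_closedBall (0 : E) r).ultrafilter_le_nhds (l.map u) (by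
    rw [le_principal_iff]
    exact hu'.mono fun z hz => Metric.ball_subset_closedBall hz.1)
  have hv : Tendsto u l (𝓝 v) := hv
  have hv1 : prBase Φ v = prBase Φ b :=
    tendsto_nhds_unique_of_eventuallyEq (((prBase Φ).continuous.tendsto v).comp hv) hl
      (hu'.mono fun z hz => hz.2.2.1)
  have hv2 : ℓ a v = ℓ a b :=
    tendsto_nhds_unique_of_eventuallyEq (((ℓ a).continuous.tendsto v).comp hv) hτ
      (hu'.mono fun z hz => hz.2.2.2)
  have hv3 : ∀ j, (polyAt (Q j) (prBase Φ b)).eval (prCoord Φ j v) = 0 := by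
    intro j
    refine tendsto_nhds_unique_of_eventuallyEq ((hb3 j (prCoord Φ j v)).tendsto.comp
      (Tendsto.prodMk_nhds (hl : Tendsto id (l : Filter E') (𝓝 (prBase Φ b)))
        (((prCoord Φ j).continuous.tendsto v).comp hv))) tendsto_const_nhds ?_
    filter_upwards [hu'] with z hz
    have := (hball (u z) hz.1).1 hz.2.1 j
    rw [hz.2.2.1] at this
    exact this
  obtain rfl := hsep v hv1 hv3 hv2
  filter_upwards [hu', hv hN] with z hz hzN
  have := hNs ⟨hzN, hz.2.1⟩
  rwa [Set.mem_preimage, hz.2.2.1] at this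

/-- A germ that does not vanish on `Z` near `0` does not vanish on `Z` near any point close
to `0`. -/
theorem IsNormalization.eventually_frequently_ne_zero [FiniteDimensional ℂ E]
    [FiniteDimensional ℂ E'] [Fintype ι] {Φ : E ≃L[ℂ] E' × (ι → ℂ)} {I : Ideal (AnalyticGerm E)}
    [I.IsPrime] (h : IsNormalization Φ I) {Z : Set E} (hZ : IsZeroLocus Z I) {γ : AnalyticGerm E}
    (hγ : γ ∉ I) : ∀ᶠ b in 𝓝[Z] 0, ∃ᶠ u in 𝓝[Z] b, γ.rep u ≠ 0 := by
  -- some multiple of `γ` comes from the base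
  obtain ⟨c, q, hc, hcq⟩ : ∃ (c : AnalyticGerm E') (q : AnalyticGerm E), c ≠ 0 ∧
      pull (prBase Φ) c - γ * q ∈ I := by
    let _ := ((Ideal.Quotient.mk I).comp (pull (prBase Φ))).toAlgebra
    have : Module.Finite (AnalyticGerm E') (AnalyticGerm E ⧸ I) := h.finite
    have hγ' : Ideal.Quotient.mk I γ ≠ 0 := by rwa [Ne, Ideal.Quotient.eq_zero_iff_mem]
    have h1 := Ideal.comap_ne_bot_of_integral_mem (R := AnalyticGerm E') hγ'
      (Ideal.mem_span_singleton_self _) (Algebra.IsIntegral.isIntegral _)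
    obtain ⟨c, hc, hc0⟩ := Submodule.exists_mem_ne_zero_of_ne_bot h1
    obtain ⟨q, hq⟩ := Ideal.mem_span_singleton.1 hc
    obtain ⟨q, rfl⟩ := Ideal.Quotient.mk_surjective q
    refine ⟨c, q, hc0, ?_⟩
    rw [← Ideal.Quotient.eq, map_mul, ← hq]
    rfl
  have hπ : Tendsto (prBase Φ) (𝓝 0) (𝓝 0) := by simpa using (prBase Φ).continuous.tendsto 0
  have h1 : ∀ᶠ u in 𝓝[Z] 0, c.rep (prBase Φ u) = γ.rep u * q.rep u := by
    have h2 : pull (prBase Φ) c = (pull (prBase Φ) c - γ * q) + γ * q := by ring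
    filter_upwards [(hZ.mem_iff _).1 hcq, nhdsWithin_le_nhds (eventually_rep_mul γ q),
      nhdsWithin_le_nhds (rep_pull (prBase Φ) c),
      nhdsWithin_le_nhds (eventually_rep_add (pull (prBase Φ) c - γ * q) (γ * q))]
      with u h3 h4 h5 h6
    rw [← h2, h3, zero_add, h4, h5] at h6
    exact h6
  filter_upwards [h.eventually_nhds_le_map hZ, eventually_eventually_nhdsWithin.2 h1,
    nhdsWithin_le_nhds (hπ.eventually (AnalyticGerm.eventually_frequently_ne_zero hc))]
    with b h2 h3 h4 h5
  refine h4 (h2 ?_)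
  simp only [not_not] at h5 ⊢
  change ∀ᶠ u in 𝓝[Z] b, c.rep (prBase Φ u) = 0
  filter_upwards [h3, h5] with u h6 h7
  rw [h6, h7, zero_mul]

end AnalyticGerm

/-! ### Local parametrizations of a zero locus -/

open Filter Polynomial

/-- A set `Z` on which `G` vanishes is a graph over the base near `y` if `(π, G)` is a local
isomorphism at `y` and the projection of `Z` to the base is open at `y`: the parametrization is the
local inverse of `(π, G)` restricted to `G = 0`, and openness shows that all its values lie on `Z`.
-/
theorem exists_parametrization_of_nhds_le_map {E E' W : Type*} [NormedAddCommGroup E]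
    [NormedSpace ℂ E] [FiniteDimensional ℂ E] [NormedAddCommGroup E'] [NormedSpace ℂ E']
    [FiniteDimensional ℂ E'] [NormedAddCommGroup W] [NormedSpace ℂ W] [FiniteDimensional ℂ W]
    (Φ : E ≃L[ℂ] E' × W) (π : E →L[ℂ] E') {G : E → W} {y : E} (hG : AnalyticAt ℂ G y)
    (hinj : ∀ u, π u = 0 → fderiv ℂ G y u = 0 → u = 0) {Z : Set E} (hy : y ∈ Z)
    (hZG : ∀ᶠ u in 𝓝[Z] y, G u = 0) (hopen : 𝓝 (π y) ≤ map π (𝓝[Z] y)) :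
    ∃ ψ : E' → E, AnalyticAt ℂ ψ 0 ∧ ψ 0 = y ∧ (∀ᶠ v in 𝓝 0, π (ψ v) = π y + v) ∧
      map ψ (𝓝 0) = 𝓝[Z] y ∧ ∀ᶠ v in 𝓝 0, G (ψ v) = 0 := by
  have hcE : CompleteSpace E := FiniteDimensional.complete ℂ E
  have hcE' : CompleteSpace E' := FiniteDimensional.complete ℂ E'
  have hcW : CompleteSpace W := FiniteDimensional.complete ℂ W
  let H : E → E' × W := fun u => (π u, G u)
  have hH : AnalyticAt ℂ H y := (π.analyticAt y).prod hG
  let H'₀ : E →L[ℂ] E' × W := π.prod (fderiv ℂ G y)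
  have hH'₀ : HasFDerivAt H H'₀ y := (π.hasFDerivAt).prodMk hG.differentiableAt.hasFDerivAt
  have hker : Function.Injective H'₀.toLinearMap := by
    refine (injective_iff_map_eq_zero _).2 fun u hu => ?_
    exact hinj u (congrArg Prod.fst hu) (congrArg Prod.snd hu)
  let H' : E ≃L[ℂ] E' × W := (LinearMap.linearEquivOfInjective H'₀.toLinearMap hker
    Φ.toLinearEquiv.finrank_eq).toContinuousLinearEquiv
  have hH' : HasFDerivAt H (H' : E →L[ℂ] E' × W) y := by
    convert hH'₀
    ext u <;> rfl
  have hHc : ContDiffAt ℂ ω H y := hH.contDiffAt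
  have hst := hHc.hasStrictFDerivAt' hH' (by simp)
  let inv : E' × W → E := hHc.localInverse hH' (by simp)
  have hinv : AnalyticAt ℂ inv (H y) := (hHc.to_localInverse hH' (by simp)).analyticAt
  have hleft : ∀ᶠ u in 𝓝 y, inv (H u) = u := hst.eventually_left_inverse
  have hright : ∀ᶠ p in 𝓝 (H y), H (inv p) = p := hst.eventually_right_inverse
  have hGy : G y = 0 := hZG.self_of_nhdsWithin hy
  have hHy : H y = (π y + 0, 0) := by simp [H, hGy]
  let σ : E' → E' × W := fun v => (π y + v, 0)
  have hσ : AnalyticAt ℂ σ 0 := (analyticAt_const.add analyticAt_id).prod analyticAt_const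
  have hσ0 : Tendsto σ (𝓝 0) (𝓝 (H y)) := by
    rw [hHy]; exact hσ.continuousAt
  refine ⟨fun v => inv (σ v), ?_, ?_, ?_, ?_, ?_⟩
  · exact AnalyticAt.comp (g := inv) (f := σ) (by
      change AnalyticAt ℂ inv (π y + 0, 0)
      rw [← hHy]
      exact hinv) hσ
  · change inv (π y + 0, 0) = y
    rw [← hHy]
    exact hleft.self_of_nhds
  · filter_upwards [hσ0.eventually hright] with v hv
    exact congrArg Prod.fst hv
  · have hfix : ∀ᶠ u in 𝓝[Z] y, inv (σ (π u - π y)) = u := by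
      filter_upwards [nhdsWithin_le_nhds hleft, hZG] with u hu hu'
      conv_rhs => rw [← hu]
      simp [σ, H, hu']
    refine le_antisymm ?_ ?_
    · refine tendsto_nhdsWithin_iff.2 ⟨?_, ?_⟩
      · have h1 : Tendsto inv (𝓝 (H y)) (𝓝 y) := by
          have := hinv.continuousAt.tendsto
          rwa [hleft.self_of_nhds] at this
        exact h1.comp hσ0
      · have h1 : ∀ᶠ z in 𝓝 (π y), inv (σ (z - π y)) ∈ Z := by
          refine hopen ?_
          rw [mem_map]
          filter_upwards [hfix, self_mem_nhdsWithin] with u hu hu'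
          change inv (σ (π u - π y)) ∈ Z
          rwa [hu]
        have h2 : Tendsto (fun v => π y + v) (𝓝 0) (𝓝 (π y)) := by
          have : Continuous fun v => π y + v := by fun_prop
          simpa using this.tendsto 0
        filter_upwards [h2.eventually h1] with v hv
        rwa [add_sub_cancel_left] at hv
    · intro s hs
      have h2 : Tendsto (fun u => π u - π y) (𝓝[Z] y) (𝓝 0) := by
        have : Continuous fun u => π u - π y := by fun_prop
        simpa using (this.tendsto y).mono_left nhdsWithin_le_nhds
      filter_upwards [h2.eventually hs, hfix] with u hu hu'
      rwa [hu'] at hu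
  · filter_upwards [hσ0.eventually hright] with v hv
    exact congrArg Prod.snd hv

namespace AnalyticGerm

variable {E : Type*} [NormedAddCommGroup E] [NormedSpace ℂ E]
  {E' : Type*} [NormedAddCommGroup E'] [NormedSpace ℂ E'] {ι : Type*}

/-- A monic polynomial with coefficients in the ring of germs, as a function of two variables. -/
noncomputable def polyFun (p : (AnalyticGerm E')[X]) (y : E' × ℂ) : ℂ := (polyAt p y.1).eval y.2

theorem analyticAt_polyFun (p : (AnalyticGerm E')[X]) : AnalyticAt ℂ (polyFun p) 0 := by
  have h : polyFun p = fun y : E' × ℂ => y.2 ^ p.natDegree +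
      ∑ i ∈ Finset.range p.natDegree, (p.coeff i).rep y.1 * y.2 ^ i := by
    ext y
    exact eval_polyAt p y.1 y.2
  rw [h]
  refine (analyticAt_snd.pow _).add (Finset.analyticAt_fun_sum _ fun i _ => ?_)
  exact (AnalyticAt.comp (g := (p.coeff i).rep) (f := Prod.fst) (p.coeff i).analyticAt_rep
    analyticAt_fst).mul (analyticAt_snd.pow _)

theorem fderiv_polyFun_zero_one {p : (AnalyticGerm E')[X]} {y : E' × ℂ}
    (h : DifferentiableAt ℂ (polyFun p) y) :
    fderiv ℂ (polyFun p) y (0, 1) = (polyAt p y.1).derivative.eval y.2 := by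
  have h1 : HasDerivAt (fun t : ℂ => polyFun p (y.1, t)) (fderiv ℂ (polyFun p) y (0, 1)) y.2 := by
    have h2 : HasDerivAt (fun t : ℂ => (y.1, t)) ((0 : E'), (1 : ℂ)) y.2 :=
      (hasDerivAt_const _ _).prodMk (hasDerivAt_id _)
    exact HasFDerivAt.comp_hasDerivAt y.2 (f := fun t : ℂ => (y.1, t)) h.hasFDerivAt h2
  exact h1.unique ((polyAt p y.1).hasDerivAt y.2)

/-- The values of the derivative of a polynomial with coefficients from the base. -/
theorem rep_eval₂_derivative (L : E →L[ℂ] E') {p : (AnalyticGerm E')[X]} (hp : p.Monic)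
    (θ : AnalyticGerm E) : (p.derivative.eval₂ (pull L) θ).rep =ᶠ[𝓝 0]
      fun u => (polyAt p (L u)).derivative.eval (θ.rep u) := by
  have hL : Tendsto L (𝓝 0) (𝓝 0) := by simpa using L.continuous.tendsto 0
  rw [← Germ.coe_eq, coe_rep]
  have h1 : p.derivative.eval₂ (pull L) θ = p.natDegree * θ ^ (p.natDegree - 1) +
      ∑ i ∈ Finset.range p.natDegree, pull L (p.coeff i) * (i * θ ^ (i - 1)) := by
    conv_lhs => rw [hp.as_sum]
    simp [eval₂_finsetSum, derivative_X_pow]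
  rw [h1, map_add, map_sum]
  simp only [map_mul, map_natCast, map_pow, ← coe_rep θ]
  have h2 : (fun u => (polyAt p (L u)).derivative.eval (θ.rep u)) =
      (fun u => (p.natDegree : ℂ) * θ.rep u ^ (p.natDegree - 1)) +
        ∑ i ∈ Finset.range p.natDegree, fun u =>
          (p.coeff i).rep (L u) * ((i : ℂ) * θ.rep u ^ (i - 1)) := by
    ext u
    simp [polyAt, eval_finsetSum, derivative_X_pow]
  rw [h2]
  refine Eq.trans ?_ (map_add (Germ.coeRingHom (𝓝 (0 : E))) _ _).symm
  rw [map_sum]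
  congr 1
  refine Finset.sum_congr rfl fun i _ => ?_
  have h3 : toGerm (pull L (p.coeff i)) =
      (((p.coeff i).rep ∘ L : E → ℂ) : Germ (𝓝 (0 : E)) ℂ) :=
    evalAlong_eq L hL (p.coeff i)
  rw [h3]
  rfl

/-- The derivative of the minimal polynomial of `θ` does not annihilate `θ` modulo `I`, since its
degree is smaller and the characteristic is zero. -/
theorem IsNormalization.eval₂_derivative_notMem [FiniteDimensional ℂ E']
    {Φ : E ≃L[ℂ] E' × (ι → ℂ)} {I : Ideal (AnalyticGerm E)} [I.IsPrime] (h : IsNormalization Φ I)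
    (θ : AnalyticGerm E) : (relPoly Φ I θ).derivative.eval₂ (pull (prBase Φ)) θ ∉ I := by
  intro hI
  have hn : (relPoly Φ I θ).natDegree ≠ 0 := by
    intro h0
    have h1 := eval₂_relPoly_mem (Φ := Φ) (I := I) θ
    rw [(h.monic_relPoly θ).natDegree_eq_zero.1 h0, eval₂_one] at h1
    exact Ideal.IsPrime.ne_top ‹_› ((Ideal.eq_top_iff_one I).2 h1)
  have hlt := natDegree_derivative_lt hn
  refine absurd (h.natDegree_relPoly_le θ (fun h0 => hn ?_) hI) (not_le.2 hlt)
  have hchar : CharZero (AnalyticGerm E') :=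
    charZero_of_injective_ringHom (f := (const : ℂ →+* AnalyticGerm E')) const.injective
  exact derivative_eq_zero.1 h0

/-- **Local structure of a zero locus.** Outside the zero set of `Δ` the zero locus is a manifold.
It is parametrized by the base, and the derivatives of the parametrizations, multiplied by `Δ`,
are vector fields `X v` that extend analytically. -/
theorem IsNormalization.exists_parametrizations [FiniteDimensional ℂ E] [FiniteDimensional ℂ E']
    [Fintype ι] {Φ : E ≃L[ℂ] E' × (ι → ℂ)} {I : Ideal (AnalyticGerm E)} [I.IsPrime]
    (h : IsNormalization Φ I) {Z : Set E} (hZ : IsZeroLocus Z I) :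
    ∃ (Δ : AnalyticGerm E) (X : E' → E → E), Δ ∉ I ∧ (∀ v, AnalyticAt ℂ (X v) 0) ∧
      ∀ᶠ y in 𝓝[Z] 0, Δ.rep y ≠ 0 → ∃ ψ : E' → E, AnalyticAt ℂ ψ 0 ∧ ψ 0 = y ∧
        (∀ᶠ v in 𝓝 0, prBase Φ (ψ v) = prBase Φ y + v) ∧ map ψ (𝓝 0) = 𝓝[Z] y ∧
        ∀ v, Δ.rep y • fderiv ℂ ψ 0 v = X v y := by
  classical
  have hcE : CompleteSpace E := FiniteDimensional.complete ℂ E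
  have hcE' : CompleteSpace E' := FiniteDimensional.complete ℂ E'
  let Q : ι → (AnalyticGerm E')[X] := fun j => relPoly Φ I (ofDual (prCoord Φ j))
  let κ : ι → (E →L[ℂ] E' × ℂ) := fun j => (prBase Φ).prod (prCoord Φ j)
  have hκ0 : ∀ j, κ j 0 = 0 := fun j => map_zero _
  have hκ : ∀ j, Tendsto (κ j) (𝓝 0) (𝓝 0) := fun j => by
    simpa only [hκ0] using (κ j).continuous.tendsto 0
  -- the derivatives of the minimal polynomials of the fibre coordinates, in the fibre direction and
  -- in the direction of the base
  let q : ι → E → ℂ := fun j y => fderiv ℂ (polyFun (Q j)) (κ j y) (0, 1)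
  let D : ι → E' → E → ℂ := fun j v y => fderiv ℂ (polyFun (Q j)) (κ j y) (v, 0)
  have hfd : ∀ j (v : E' × ℂ), AnalyticAt ℂ (fun y => fderiv ℂ (polyFun (Q j)) (κ j y) v) 0 := by
    intro j v
    have h1 : AnalyticAt ℂ (fun y => fderiv ℂ (polyFun (Q j)) (κ j y)) 0 :=
      AnalyticAt.comp (g := fderiv ℂ (polyFun (Q j))) (f := κ j)
        (by rw [hκ0]; exact (analyticAt_polyFun _).fderiv) ((κ j).analyticAt 0)
    exact (ContinuousLinearMap.apply ℂ ℂ v).analyticAt _ |>.comp h1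
  have hq : ∀ j, AnalyticAt ℂ (q j) 0 := fun j => hfd j _
  let Δ : AnalyticGerm E := ∏ j, AnalyticGerm.mk (q j) (hq j)
  -- implicit differentiation of `Q j = 0` gives the fibre component `-D j v / q j`, and `Δ` clears
  -- the denominators
  let X : E' → E → E := fun v y => Φ.symm ((∏ j, q j y) • v, fun j =>
    -((∏ l ∈ Finset.univ.erase j, q l y) * D j v y))
  have hana : ∀ j, ∀ᶠ y in 𝓝 (0 : E), AnalyticAt ℂ (polyFun (Q j)) (κ j y) := fun j =>
    (hκ j).eventually (analyticAt_polyFun _).eventually_analyticAt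
  refine ⟨Δ, X, ?_, ?_, ?_⟩
  · intro hΔ
    obtain ⟨j, -, hj⟩ := (Ideal.IsPrime.prod_mem_iff (hp := ‹I.IsPrime›)).1 hΔ
    refine h.eval₂_derivative_notMem (ofDual (prCoord Φ j)) ?_
    convert hj
    rw [← mk_rep (eval₂ _ _ _)]
    refine mk_eq_mk_iff.2 ?_
    filter_upwards [rep_eval₂_derivative (prBase Φ) (h.monic_relPoly (ofDual (prCoord Φ j)))
      (ofDual (prCoord Φ j)), rep_ofDual (prCoord Φ j), hana j] with u h1 h2 h3
    rw [h1, h2]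
    exact (fderiv_polyFun_zero_one h3.differentiableAt).symm
  · intro v
    refine (Φ.symm.analyticAt _).comp (AnalyticAt.prod ?_ (AnalyticAt.pi fun j => ?_))
    · exact (Finset.analyticAt_fun_prod _ fun j _ => hq j).smul analyticAt_const
    · exact ((Finset.analyticAt_fun_prod _ fun l _ => hq l).mul (hfd j _)).neg
  have hΔrep : ∀ᶠ y in 𝓝 (0 : E), Δ.rep y = ∏ j, q j y := by
    have h1 : Δ = AnalyticGerm.mk (fun y => ∏ j, q j y)
        (Finset.analyticAt_fun_prod _ fun j _ => hq j) := by
      apply toGerm_injective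
      rw [map_prod]
      refine Eq.trans ?_ (congrArg (fun F : E → ℂ => (F : Germ (𝓝 (0 : E)) ℂ))
        (Finset.prod_fn Finset.univ q))
      exact (map_prod (Germ.coeRingHom (𝓝 (0 : E))) q Finset.univ).symm
    rw [h1]
    exact rep_mk _ _
  have hvan : ∀ᶠ u in 𝓝[Z] (0 : E), ∀ j, polyFun (Q j) (κ j u) = 0 :=
    eventually_all.2 fun j => hZ.eventually_eval_relPoly h _
  filter_upwards [nhdsWithin_le_nhds hΔrep, nhdsWithin_le_nhds (eventually_all.2 hana),
    eventually_eventually_nhdsWithin.2 hvan, h.eventually_nhds_le_map hZ, self_mem_nhdsWithin]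
    with y hy1 hy2 hy3 hy4 hyZ hΔy
  rw [hy1] at hΔy
  have hqy : ∀ j, q j y ≠ 0 := fun j => Finset.prod_ne_zero_iff.1 hΔy j (Finset.mem_univ j)
  have hsplit : ∀ j (u : E), fderiv ℂ (polyFun (Q j)) (κ j y) (κ j u) =
      D j (prBase Φ u) y + prCoord Φ j u * q j y := by
    intro j u
    have h1 : κ j u = (prBase Φ u, 0) + prCoord Φ j u • ((0 : E'), (1 : ℂ)) := by
      ext <;> simp [κ]
    rw [h1, map_add, map_smul, smul_eq_mul]
  let G : E → ι → ℂ := fun u j => polyFun (Q j) (κ j u)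
  have hG' : ∀ j, HasFDerivAt (fun u => polyFun (Q j) (κ j u))
      ((fderiv ℂ (polyFun (Q j)) (κ j y)).comp (κ j)) y := fun j =>
    HasFDerivAt.comp y (hy2 j).differentiableAt.hasFDerivAt (κ j).hasFDerivAt
  have hG : AnalyticAt ℂ G y := AnalyticAt.pi fun j =>
    AnalyticAt.comp (g := polyFun (Q j)) (hy2 j) ((κ j).analyticAt y)
  have hGfd : ∀ u j, fderiv ℂ G y u j = D j (prBase Φ u) y + prCoord Φ j u * q j y := by
    intro u j
    rw [(hasFDerivAt_pi.2 hG').fderiv, ← hsplit]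
    rfl
  obtain ⟨ψ, hψ1, hψ2, hψ3, hψ4, hψ5⟩ := exists_parametrization_of_nhds_le_map Φ (prBase Φ) hG
    (fun u hu1 hu2 => by
      have h2 : ∀ j, prCoord Φ j u = 0 := by
        intro j
        have h1 := hGfd u j
        rw [hu2, hu1] at h1
        have h3 : D j 0 y = 0 := by
          change fderiv ℂ (polyFun (Q j)) (κ j y) (0, 0) = 0
          rw [Prod.mk_zero_zero, map_zero]
        rw [h3, zero_add] at h1
        exact (mul_eq_zero.1 h1.symm).resolve_right (hqy j)
      refine Φ.map_eq_zero_iff.1 (Prod.ext hu1 (funext h2))) hyZ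
    (hy3.mono fun u hu => funext hu) hy4
  refine ⟨ψ, hψ1, hψ2, hψ3, hψ4, fun v => ?_⟩
  set u := fderiv ℂ ψ 0 v with hu
  have hu1 : prBase Φ u = v := by
    have h1 : HasFDerivAt (fun v => prBase Φ (ψ v)) ((prBase Φ).comp (fderiv ℂ ψ 0)) 0 :=
      (prBase Φ).hasFDerivAt.comp 0 hψ1.differentiableAt.hasFDerivAt
    have h2 : HasFDerivAt (fun v => prBase Φ (ψ v)) (ContinuousLinearMap.id ℂ E') 0 :=
      ((hasFDerivAt_id (0 : E')).const_add (prBase Φ y)).congr_of_eventuallyEq hψ3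
    exact congrArg (fun L : E' →L[ℂ] E' => L v) (h1.unique h2)
  have hu2 : fderiv ℂ G y u = 0 := by
    have h1 : HasFDerivAt (fun v => G (ψ v)) ((fderiv ℂ G y).comp (fderiv ℂ ψ 0)) 0 :=
      HasFDerivAt.comp (g := G) 0 (by rw [hψ2]; exact hG.differentiableAt.hasFDerivAt)
        hψ1.differentiableAt.hasFDerivAt
    have h2 : HasFDerivAt (fun v => G (ψ v)) (0 : E' →L[ℂ] (ι → ℂ)) 0 :=
      (hasFDerivAt_const (0 : ι → ℂ) (0 : E')).congr_of_eventuallyEq hψ5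
    exact congrArg (fun L : E' →L[ℂ] (ι → ℂ) => L v) (h1.unique h2)
  apply Φ.injective
  rw [Φ.apply_symm_apply, map_smul, hy1]
  refine Prod.ext ?_ (funext fun j => ?_)
  · change (∏ j, q j y) • prBase Φ u = _
    rw [hu1]
  · change (∏ j, q j y) * prCoord Φ j u = _
    have h1 := hGfd u j
    rw [hu2, hu1] at h1
    rw [← Finset.mul_prod_erase _ _ (Finset.mem_univ j)]
    have h2 : (0 : ι → ℂ) j = 0 := rfl
    rw [h2] at h1
    linear_combination (-(∏ l ∈ Finset.univ.erase j, q l y)) * h1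

end AnalyticGerm

/-! ### Functions that are non-constant along a discrete valuation -/

section Valuation

/-- If the residue field of the restriction of the valuation to `K` consists of constants, a
derivation that kills an element of smallest positive valuation kills `K`: the elements of `K` are
power series in it. -/
theorem Derivation.eq_zero_of_forall_eq_add_mul {k A L : Type*} [Field k] [CommRing A] [IsDomain A]
    [IsNoetherianRing A] [ValuationRing A] [Field L] [Algebra A L] [IsFractionRing A L]
    [Algebra k A] [Algebra k L] [IsScalarTower k A L] (K : Subfield L) (D : Derivation k L L)
    (hD : ∀ a : A, ∃ b : A, D (algebraMap A L a) = algebraMap A L b) {τ : A} (hτ : ¬ IsUnit τ)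
    (hDτ : D (algebraMap A L τ) = 0)
    (hK : ∀ a : A, algebraMap A L a ∈ K → ∃ (c : k) (b : A), algebraMap A L b ∈ K ∧
      a = algebraMap k A c + τ * b) : ∀ x ∈ K, D x = 0 := by
  have hA : ∀ a : A, algebraMap A L a ∈ K → D (algebraMap A L a) = 0 := by
    intro a ha
    have h1 : ∀ n : ℕ, ∀ a : A, algebraMap A L a ∈ K →
        ∃ b : A, D (algebraMap A L a) = algebraMap A L (τ ^ n * b) := by
      intro n
      induction n with
      | zero =>
        intro a _
        simpa using hD a
      | succ n ih =>
        intro a ha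
        obtain ⟨c, b, hb, rfl⟩ := hK a ha
        obtain ⟨b', hb'⟩ := ih b hb
        refine ⟨b', ?_⟩
        rw [map_add, ← IsScalarTower.algebraMap_apply, map_add, Derivation.map_algebraMap, zero_add,
          map_mul, Derivation.leibniz, hDτ, smul_zero, add_zero, hb', smul_eq_mul, ← map_mul]
        ring_nf
    obtain ⟨b, hb⟩ := hD a
    rw [hb]
    suffices b = 0 by rw [this, map_zero]
    by_contra hb0
    refine FiniteMultiplicity.not_iff_forall.2 (fun n => ?_)
      (FiniteMultiplicity.of_not_isUnit hτ hb0)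
    obtain ⟨b', hb'⟩ := h1 n a ha
    rw [hb] at hb'
    exact ⟨b', IsFractionRing.injective A L hb'⟩
  intro x hx
  rcases ValuationRing.isInteger_or_isInteger A x with ⟨a, ha⟩ | ⟨a, ha⟩
  · rw [← ha]
    exact hA a (ha ▸ hx)
  · have h2 := hA a (ha ▸ K.inv_mem hx)
    rw [ha] at h2
    rw [← inv_inv x, Derivation.leibniz_inv, h2, smul_zero]

/-- If two elements of a field `K` of functions are independent with respect to two derivations
that preserve a discrete valuation ring, then not all functions of `K` without poles have constant
residue. -/
theorem exists_forall_isUnit_sub {k A L : Type*} [Field k] [CommRing A] [IsDomain A]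
    [IsDiscreteValuationRing A] [Field L] [Algebra A L] [IsFractionRing A L] [Algebra k A]
    [Algebra k L] [IsScalarTower k A L] (K : Subfield L) (hK : ∀ c : k, algebraMap k L c ∈ K)
    (D₁ D₂ : Derivation k L L)
    (hD₁ : ∀ a : A, ∃ b : A, D₁ (algebraMap A L a) = algebraMap A L b)
    (hD₂ : ∀ a : A, ∃ b : A, D₂ (algebraMap A L a) = algebraMap A L b) {f g : L} (hf : f ∈ K)
    (hg : g ∈ K) (hfg : D₁ f * D₂ g - D₂ f * D₁ g ≠ 0) :
    ∃ a : A, algebraMap A L a ∈ K ∧ ∀ c : k, IsUnit (a - algebraMap k A c) := by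
  by_contra! hcon
  let s : Set A := {a | algebraMap A L a ∈ K ∧ a ≠ 0 ∧ ¬ IsUnit a}
  by_cases hs : s.Nonempty
  · -- an element of smallest positive valuation
    obtain ⟨_, ⟨τ, ⟨hτK, hτ0, hτu⟩, rfl⟩, hmin⟩ := wellFounded_lt.has_min
      ((IsDiscreteValuationRing.addVal A) '' s) (hs.image _)
    have hexp : ∀ a : A, algebraMap A L a ∈ K → ∃ (c : k) (b : A), algebraMap A L b ∈ K ∧
        a = algebraMap k A c + τ * b := by
      intro a ha
      obtain ⟨c, hc⟩ := hcon a ha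
      have hcK : algebraMap A L (a - algebraMap k A c) ∈ K := by
        rw [map_sub, ← IsScalarTower.algebraMap_apply]
        exact K.sub_mem ha (hK c)
      by_cases h0 : a - algebraMap k A c = 0
      · exact ⟨c, 0, by rw [map_zero]; exact K.zero_mem, by rw [sub_eq_zero.1 h0]; ring⟩
      · obtain ⟨b, hb⟩ := IsDiscreteValuationRing.addVal_le_iff_dvd.1
          (not_lt.1 (hmin _ ⟨_, ⟨hcK, h0, hc⟩, rfl⟩))
        refine ⟨c, b, ?_, by rw [← hb]; ring⟩
        have hτL : algebraMap A L τ ≠ 0 := by simpa using hτ0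
        have : algebraMap A L b = algebraMap A L (a - algebraMap k A c) * (algebraMap A L τ)⁻¹ := by
          rw [hb, map_mul]
          field_simp
        rw [this]
        exact K.mul_mem hcK (K.inv_mem hτK)
    by_cases h1 : D₁ (algebraMap A L τ) = 0
    · have h2 := D₁.eq_zero_of_forall_eq_add_mul K hD₁ hτu h1 hexp
      rw [h2 f hf, h2 g hg] at hfg
      simp at hfg
    · let D : Derivation k L L :=
        D₁ (algebraMap A L τ) • D₂ - D₂ (algebraMap A L τ) • D₁
      have hDapp : ∀ x, D x = D₁ (algebraMap A L τ) * D₂ x - D₂ (algebraMap A L τ) * D₁ x :=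
        fun x => rfl
      have h2 := D.eq_zero_of_forall_eq_add_mul K (fun a => by
        obtain ⟨b₁, hb₁⟩ := hD₁ a
        obtain ⟨b₂, hb₂⟩ := hD₂ a
        obtain ⟨t₁, ht₁⟩ := hD₁ τ
        obtain ⟨t₂, ht₂⟩ := hD₂ τ
        exact ⟨t₁ * b₂ - t₂ * b₁, by rw [hDapp, hb₁, hb₂, ht₁, ht₂]; simp⟩) hτu
        (by rw [hDapp]; ring) hexp
      have h3 := h2 f hf
      have h4 := h2 g hg
      rw [hDapp] at h3 h4
      refine hfg ((mul_eq_zero.1 (?_ : D₁ (algebraMap A L τ) * _ = 0)).resolve_left h1)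
      linear_combination D₁ f * h4 - D₁ g * h3
  · -- a trivial valuation: all elements are constants
    have h1 : ∀ a : A, algebraMap A L a ∈ K → ∃ c : k, algebraMap A L a = algebraMap k L c := by
      intro a ha
      obtain ⟨c, hc⟩ := hcon a ha
      refine ⟨c, ?_⟩
      by_contra hne
      refine hs ⟨a - algebraMap k A c, ?_, fun h0 => hne ?_, hc⟩
      · rw [map_sub, ← IsScalarTower.algebraMap_apply]
        exact K.sub_mem ha (hK c)
      · rw [sub_eq_zero.1 h0, ← IsScalarTower.algebraMap_apply]
    have h2 : ∀ D : Derivation k L L, D f = 0 := by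
      intro D
      rcases ValuationRing.isInteger_or_isInteger A f with ⟨a, ha⟩ | ⟨a, ha⟩
      · obtain ⟨c, hc⟩ := h1 a (ha ▸ hf)
        rw [← ha, hc, D.map_algebraMap]
      · obtain ⟨c, hc⟩ := h1 a (ha ▸ K.inv_mem hf)
        rw [← inv_inv f, Derivation.leibniz_inv, ← ha, hc, D.map_algebraMap, smul_zero]
    rw [h2, h2] at hfg
    simp at hfg

end Valuation

/-! ### Prime ideals of height one -/

section Height

open IsLocalRing

/-- An ideal with a quotient of dimension one less is contained in a prime ideal of height one. -/
theorem exists_isPrime_of_ringKrullDim_eq {R : Type*} [CommRing R] [IsDomain R] [IsNoetherianRing R]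
    [IsLocalRing R] {J : Ideal R} (h : ringKrullDim R = ringKrullDim (R ⧸ J) + 1) :
    ∃ P : Ideal R, P.IsPrime ∧ J ≤ P ∧ P ≠ ⊥ ∧
      ∀ Q : Ideal R, Q.IsPrime → Q ≤ P → Q ≠ ⊥ → Q = P := by
  have htop := ringKrullDim_ne_top (R := R)
  have hbot := ringKrullDim_ne_bot (R := R)
  obtain ⟨n, hn⟩ : ∃ n : ℕ, ringKrullDim (R ⧸ J) = n := by
    rcases hd : ringKrullDim (R ⧸ J) with _ | (_ | n)
    · rw [hd] at h
      exact absurd h hbot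
    · rw [hd] at h
      exact absurd h htop
    · exact ⟨n, rfl⟩
  rw [hn] at h
  rw [ringKrullDim_quotient] at hn
  obtain ⟨l, hl⟩ := Order.le_krullDim_iff.1 hn.ge
  refine ⟨l.head.1.asIdeal, l.head.1.2, l.head.2, fun h0 => ?_, fun Q hQ hQP hQ0 => ?_⟩
  · have hJ : J = ⊥ := le_bot_iff.1 (h0 ▸ l.head.2)
    have h1 : ringKrullDim (R ⧸ J) = ringKrullDim R := by
      rw [hJ]
      exact ringKrullDim_eq_of_ringEquiv (RingEquiv.quotientBot R)
    rw [ringKrullDim_quotient, hn, h] at h1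
    have h2 : n = n + 1 := by exact_mod_cast h1
    omega
  · by_contra hne
    let l' : LTSeries (PrimeSpectrum R) := l.map Subtype.val (fun _ _ h => h)
    let q : PrimeSpectrum R := ⟨Q, hQ⟩
    have hq : q < l'.head := lt_of_le_of_ne hQP fun h => hne (congrArg PrimeSpectrum.asIdeal h)
    have hb : (⟨⊥, Ideal.isPrime_bot⟩ : PrimeSpectrum R) < (l'.cons q hq).head := by
      rw [RelSeries.head_cons]
      exact lt_of_le_of_ne (bot_le : (⊥ : Ideal R) ≤ Q) fun h =>
        hQ0 (congrArg PrimeSpectrum.asIdeal h).symm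
    have h1 := Order.LTSeries.length_le_krullDim ((l'.cons q hq).cons _ hb)
    have h2 : ((l'.cons q hq).cons _ hb).length = n + 2 := by
      rw [RelSeries.cons_length, RelSeries.cons_length]
      exact congrArg (· + 2) hl
    rw [h2] at h1
    change _ ≤ ringKrullDim R at h1
    rw [h] at h1
    have h3 : n + 2 ≤ n + 1 := by exact_mod_cast h1
    omega

/-- The localization of an integrally closed noetherian domain at a prime of height one is a
discrete valuation ring. -/
theorem isDiscreteValuationRing_of_height_one {R : Type*} [CommRing R] [IsDomain R]
    [IsNoetherianRing R] [IsIntegrallyClosed R] (P : Ideal R) [P.IsPrime] (hP : P ≠ ⊥)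
    (hmin : ∀ Q : Ideal R, Q.IsPrime → Q ≤ P → Q ≠ ⊥ → Q = P) :
    IsDiscreteValuationRing (Localization.AtPrime P) := by
  have hN : IsNoetherianRing (Localization.AtPrime P) :=
    IsLocalization.isNoetherianRing P.primeCompl _ ‹_›
  have hI : IsIntegrallyClosed (Localization.AtPrime P) :=
    isIntegrallyClosed_of_isLocalization _ P.primeCompl P.primeCompl_le_nonZeroDivisors
  have hinj : Function.Injective (algebraMap R (Localization.AtPrime P)) :=
    IsLocalization.injective _ P.primeCompl_le_nonZeroDivisors
  have hmax : maximalIdeal (Localization.AtPrime P) ≠ ⊥ := by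
    intro h
    refine hP ?_
    rw [← Localization.AtPrime.under_maximalIdeal (I := P), h]
    exact (RingHom.injective_iff_ker_eq_bot _).1 hinj
  have hfield : ¬ IsField (Localization.AtPrime P) := by
    rw [IsLocalRing.isField_iff_maximalIdeal_eq]
    exact hmax
  have key : IsDiscreteValuationRing (Localization.AtPrime P) ↔
      IsIntegrallyClosed (Localization.AtPrime P) ∧
        ∃! Q : Ideal (Localization.AtPrime P), Q ≠ ⊥ ∧ Q.IsPrime :=
    (IsDiscreteValuationRing.TFAE _ hfield).out 0 3
  refine key.2 ⟨hI, maximalIdeal _,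
    ⟨hmax, inferInstance⟩, fun Q hQ => ?_⟩
  have hQP := hQ.2
  have h1 : Q.under R ≤ P := by
    have := Ideal.comap_mono (f := algebraMap R (Localization.AtPrime P))
      (le_maximalIdeal hQP.ne_top)
    exact this.trans Localization.AtPrime.under_maximalIdeal.le
  refine Localization.AtPrime.eq_maximalIdeal_iff_under_eq.1 (hmin _ inferInstance h1 fun h0 => ?_)
  refine hQ.1 ?_
  rw [← IsLocalization.map_under P.primeCompl (Localization.AtPrime P) Q, h0, Ideal.map_bot]

end Height

/-! ### Quotients that are non-constant along an ideal of codimension one -/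

section Derivation

/-- A derivation of a domain extends to the field of fractions. -/
theorem Derivation.exists_extend {k R : Type*} (L : Type*) [Field k] [CommRing R] [IsDomain R]
    [Field L] [Algebra k R] [Algebra R L] [IsFractionRing R L] [Algebra k L] [IsScalarTower k R L]
    (D : Derivation k R R) :
    ∃ D' : Derivation k L L, ∀ r, D' (algebraMap R L r) = algebraMap R L (D r) := by
  -- derivations are sections of the dual numbers
  let φ : R →+* TrivSqZeroExt L L :=
    { toFun r := TrivSqZeroExt.inl (algebraMap R L r) + TrivSqZeroExt.inr (algebraMap R L (D r))
      map_one' := by ext <;> simp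
      map_mul' r s := by
        ext
        · simp
        · simp
          simp only [Algebra.smul_def]
          ring
      map_zero' := by ext <;> simp
      map_add' r s := by
        ext
        · simp
        · simp
          simp only [Algebra.smul_def, mul_one] }
  have hφ : ∀ r : nonZeroDivisors R, IsUnit (φ r) := fun r => by
    rw [TrivSqZeroExt.isUnit_iff_isUnit_fst, isUnit_iff_ne_zero]
    simp [φ]
  let ψ : L →+* TrivSqZeroExt L L := IsLocalization.lift hφ
  have hψ : ∀ r, ψ (algebraMap R L r) = φ r := fun r => IsLocalization.lift_eq hφ r
  have hfst : ∀ x, (ψ x).fst = x := by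
    have : (TrivSqZeroExt.fstHom L L L).toRingHom.comp ψ = RingHom.id L := by
      refine IsLocalization.ringHom_ext (nonZeroDivisors R) ?_
      ext r
      simp [hψ, φ]
    exact fun x => RingHom.congr_fun this x
  have hmul : ∀ x y, (ψ (x * y)).snd = x * (ψ y).snd + y * (ψ x).snd := fun x y => by
    rw [map_mul, TrivSqZeroExt.snd_mul, hfst, hfst]
    simp [mul_comm]
  have hsnd : ∀ r, (ψ (algebraMap R L r)).snd = algebraMap R L (D r) := fun r => by
    rw [hψ]
    exact zero_add _
  refine ⟨Derivation.mk' { toFun x := (ψ x).snd, map_add' x y := ?_, map_smul' c x := ?_ }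
    fun x y => hmul x y, hsnd⟩
  · rw [map_add, TrivSqZeroExt.snd_add]
  · rw [Algebra.smul_def, hmul, IsScalarTower.algebraMap_apply k R L, hsnd, D.map_algebraMap,
      map_zero, mul_zero, add_zero, ← IsScalarTower.algebraMap_apply, RingHom.id_apply,
      Algebra.smul_def]

/-- The numerator of the `2 × 2` determinant of the derivatives of `a / b` and `a' / b'`. -/
def wedgeNumerator {R : Type*} [CommRing R] (D₁ D₂ : R → R) (a b a' b' : R) : R :=
  (b * D₁ a - a * D₁ b) * (b' * D₂ a' - a' * D₂ b') -
    (b * D₂ a - a * D₂ b) * (b' * D₁ a' - a' * D₁ b')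

/-- A field of quotients that contains two functionally independent ones contains, for every ideal
`J` of codimension one, a quotient that has no pole along `J` and is not constant modulo `J`. -/
theorem exists_quotient_notMem {k R L : Type*} [Field k] [CommRing R] [IsDomain R]
    [IsNoetherianRing R] [IsLocalRing R] [IsIntegrallyClosed R] [Field L] [Algebra k R]
    [Algebra R L] [IsFractionRing R L] [Algebra k L] [IsScalarTower k R L] {J : Ideal R}
    (hJ : ringKrullDim R = ringKrullDim (R ⧸ J) + 1)
    (K : Subfield L) (hK : ∀ c : k, algebraMap k L c ∈ K) (D₁ D₂ : Derivation k R R)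
    {a b a' b' : R} (hb : b ≠ 0) (hb' : b' ≠ 0) (hf : algebraMap R L a / algebraMap R L b ∈ K)
    (hg : algebraMap R L a' / algebraMap R L b' ∈ K)
    (hW : wedgeNumerator D₁ D₂ a b a' b' ≠ 0) :
    ∃ x s : R, s ∉ J ∧ algebraMap R L x / algebraMap R L s ∈ K ∧
      ∀ c : k, (x - algebraMap k R c * s) * s ∉ J := by
  obtain ⟨P, hP, hJP, hP0, hmin⟩ := exists_isPrime_of_ringKrullDim_eq hJ
  have hdvr := isDiscreteValuationRing_of_height_one P hP0 hmin
  let _ : Algebra (Localization.AtPrime P) L := (IsLocalization.lift (M := P.primeCompl)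
    (g := algebraMap R L) (fun s => by
      rw [isUnit_iff_ne_zero]
      simpa using (P.primeCompl_le_nonZeroDivisors s.2 |> nonZeroDivisors.ne_zero))).toAlgebra
  have hAL : ∀ r : R, algebraMap (Localization.AtPrime P) L (algebraMap R _ r) = algebraMap R L r :=
    fun r => IsLocalization.lift_eq _ r
  have htower : IsScalarTower R (Localization.AtPrime P) L :=
    IsScalarTower.of_algebraMap_eq fun r => (hAL r).symm
  have htower' : IsScalarTower k (Localization.AtPrime P) L := by
    refine IsScalarTower.of_algebraMap_eq fun c => ?_
    rw [IsScalarTower.algebraMap_apply k R (Localization.AtPrime P), hAL,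
      ← IsScalarTower.algebraMap_apply]
  have hfrac : IsFractionRing (Localization.AtPrime P) L :=
    IsFractionRing.isFractionRing_of_isDomain_of_isLocalization P.primeCompl _ L
  have hne : ∀ s : R, s ∉ P → algebraMap R L s ≠ 0 := fun s hs h0 => by
    rw [map_eq_zero_iff _ (IsFractionRing.injective R L)] at h0
    exact hs (h0 ▸ P.zero_mem)
  -- derivations of `R` preserve the localization
  have hext : ∀ D : Derivation k R R, ∃ D' : Derivation k L L,
      (∀ r, D' (algebraMap R L r) = algebraMap R L (D r)) ∧
      ∀ y : Localization.AtPrime P, ∃ z : Localization.AtPrime P,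
        D' (algebraMap _ L y) = algebraMap _ L z := by
    intro D
    obtain ⟨D', hD'⟩ := D.exists_extend L
    refine ⟨D', hD', fun y => ?_⟩
    obtain ⟨r, s, rfl⟩ := IsLocalization.exists_mk'_eq P.primeCompl y
    have hs := hne s s.2
    have hmk : ∀ (r : R) (s : P.primeCompl), algebraMap _ L (IsLocalization.mk'
        (Localization.AtPrime P) r s) = algebraMap R L r / algebraMap R L s := by
      intro r s
      rw [eq_div_iff (hne s s.2), ← hAL s, ← map_mul, IsLocalization.mk'_spec, hAL]
    refine ⟨IsLocalization.mk' _ (s * D r - r * D s) (s * s), ?_⟩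
    rw [hmk, hmk, Derivation.leibniz_div, hD', hD']
    simp only [smul_eq_mul, Submonoid.coe_mul, map_mul, map_sub]
    field_simp
  obtain ⟨D₁', hD₁, hD₁'⟩ := hext D₁
  obtain ⟨D₂', hD₂, hD₂'⟩ := hext D₂
  have hbL : algebraMap R L b ≠ 0 := by simpa using hb
  have hbL' : algebraMap R L b' ≠ 0 := by simpa using hb'
  obtain ⟨y, hyK, hy⟩ := exists_forall_isUnit_sub (k := k) K hK D₁' D₂' hD₁' hD₂' hf hg (by
    have h1 : algebraMap R L (wedgeNumerator D₁ D₂ a b a' b') ≠ 0 := by simpa using hW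
    intro h0
    refine h1 ?_
    rw [Derivation.leibniz_div, Derivation.leibniz_div, Derivation.leibniz_div,
      Derivation.leibniz_div] at h0
    simp only [hD₁, hD₂, smul_eq_mul] at h0
    simp only [wedgeNumerator, map_sub, map_mul]
    field_simp at h0
    linear_combination h0)
  obtain ⟨x, s, rfl⟩ := IsLocalization.exists_mk'_eq P.primeCompl y
  refine ⟨x, s, fun h => s.2 (hJP h), ?_, fun c h => ?_⟩
  · convert hyK using 1
    rw [div_eq_iff (hne s s.2), ← hAL s, ← map_mul, IsLocalization.mk'_spec, hAL]
  · have h1 := (hP.mem_or_mem (hJP h)).resolve_right s.2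
    have h2 : IsLocalization.mk' (Localization.AtPrime P) x s - algebraMap k _ c =
        IsLocalization.mk' (Localization.AtPrime P) (x - algebraMap k R c * s) s := by
      rw [IsLocalization.eq_mk'_iff_mul_eq, sub_mul, IsLocalization.mk'_spec, map_sub, map_mul,
        ← IsScalarTower.algebraMap_apply]
    have h3 := hy c
    rw [h2, IsLocalization.AtPrime.isUnit_mk'_iff] at h3
    exact h3 h1

end Derivation

/-! ### Derivations along a zero locus -/

namespace AnalyticGerm

open Filter

variable {E : Type*} [NormedAddCommGroup E] [NormedSpace ℂ E]

/-- The complex numbers act on germs as constants. -/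
noncomputable instance : Algebra ℂ (AnalyticGerm E) := const.toAlgebra

theorem rep_algebraMap (c : ℂ) : (algebraMap ℂ (AnalyticGerm E) c).rep =ᶠ[𝓝 0] fun _ => c :=
  rep_mk (fun _ => c) analyticAt_const

theorem ext_rep {F G : AnalyticGerm E} (h : F.rep =ᶠ[𝓝 0] G.rep) : F = G := by
  rw [← F.mk_rep, ← G.mk_rep]
  exact mk_eq_mk_iff.2 h

theorem eventually_rep_mul_sub_mul (a b c d : AnalyticGerm E) :
    (a * b - c * d).rep =ᶠ[𝓝 0] fun x => a.rep x * b.rep x - c.rep x * d.rep x := by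
  have h1 : a * b = (a * b - c * d) + c * d := by ring
  filter_upwards [eventually_rep_mul a b, eventually_rep_mul c d,
    eventually_rep_add (a * b - c * d) (c * d)] with x h2 h3 h4
  rw [← h1, h2, h3] at h4
  rw [h4, add_sub_cancel_right]

/-- The derivative of a germ along a vector field. -/
noncomputable def alongField {X : E → E} (hX : AnalyticAt ℂ X 0) (F : AnalyticGerm E) :
    AnalyticGerm E :=
  mk (fun y => fderiv ℂ F.rep y (X y))
    ((ContinuousLinearMap.analyticAt_bilinear (ContinuousLinearMap.id ℂ (E →L[ℂ] ℂ)) _).comp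
      (F.analyticAt_rep.fderiv.prod hX))

theorem rep_alongField {X : E → E} (hX : AnalyticAt ℂ X 0) (F : AnalyticGerm E) :
    (alongField hX F).rep =ᶠ[𝓝 0] fun y => fderiv ℂ F.rep y (X y) :=
  rep_mk _ _

/-- The derivative of germs along a vector field, as a derivation. -/
noncomputable def fieldDerivation {X : E → E} (hX : AnalyticAt ℂ X 0) :
    Derivation ℂ (AnalyticGerm E) (AnalyticGerm E) :=
  Derivation.mk'
    { toFun := alongField hX
      map_add' F G := by
        refine ext_rep ?_
        filter_upwards [(eventually_rep_add F G).fderiv (𝕜 := ℂ),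
          F.analyticAt_rep.eventually_analyticAt,
          G.analyticAt_rep.eventually_analyticAt, rep_alongField hX F, rep_alongField hX G,
          rep_alongField hX (F + G), eventually_rep_add (alongField hX F) (alongField hX G)]
          with y h2 h3 h4 h5 h6 h7 h8
        rw [h7, h8, h5, h6, h2, fderiv_fun_add h3.differentiableAt h4.differentiableAt]
        rfl
      map_smul' c F := by
        rw [RingHom.id_apply, Algebra.smul_def, Algebra.smul_def]
        refine ext_rep ?_
        filter_upwards [(eventually_rep_mul (algebraMap ℂ (AnalyticGerm E) c) F).fderiv (𝕜 := ℂ),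
          F.analyticAt_rep.eventually_analyticAt, rep_alongField hX F,
          rep_alongField hX (algebraMap ℂ (AnalyticGerm E) c * F), rep_algebraMap (E := E) c,
          eventually_rep_mul (algebraMap ℂ (AnalyticGerm E) c) (alongField hX F),
          (rep_algebraMap (E := E) c).fderiv (𝕜 := ℂ),
          (algebraMap ℂ (AnalyticGerm E) c).analyticAt_rep.eventually_analyticAt]
          with y h2 h3 h4 h5 h6 h7 h8 h9
        rw [h5, h7, h4, h2, h6, fderiv_fun_mul h9.differentiableAt h3.differentiableAt, h8, h6]
        simp }
    (by
      intro F G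
      refine ext_rep ?_
      rw [smul_eq_mul, smul_eq_mul]
      filter_upwards [(eventually_rep_mul F G).fderiv (𝕜 := ℂ),
          F.analyticAt_rep.eventually_analyticAt,
          G.analyticAt_rep.eventually_analyticAt, rep_alongField hX F, rep_alongField hX G,
          rep_alongField hX (F * G), eventually_rep_mul F (alongField hX G),
          eventually_rep_mul G (alongField hX F),
          eventually_rep_add (F * alongField hX G) (G * alongField hX F)]
          with y h2 h3 h4 h5 h6 h7 h8 h9 h10
      refine h7.trans (Eq.trans ?_ h10.symm)
      rw [h8, h9, h5, h6, h2, fderiv_fun_mul h3.differentiableAt h4.differentiableAt]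
      rfl)

theorem rep_fieldDerivation {X : E → E} (hX : AnalyticAt ℂ X 0) (F : AnalyticGerm E) :
    (fieldDerivation hX F).rep =ᶠ[𝓝 0] fun y => fderiv ℂ F.rep y (X y) :=
  rep_alongField hX F

/-- The determinant of the derivatives of `F` and `G` in the directions `v` and `w`, i.e. the value
of the form `dF ∧ dG` at `x`. -/
noncomputable def wedge {V : Type*} [NormedAddCommGroup V] [NormedSpace ℂ V] (F G : V → ℂ) (x : V)
    (v w : V) : ℂ :=
  fderiv ℂ F x v * fderiv ℂ G x w - fderiv ℂ F x w * fderiv ℂ G x v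

/-- The values of the numerator of a determinant of derivatives of quotients of germs. -/
theorem eventually_rep_wedgeNumerator {X Y : E → E} (hX : AnalyticAt ℂ X 0)
    (hY : AnalyticAt ℂ Y 0) (a b a' b' : AnalyticGerm E) :
    (wedgeNumerator (fieldDerivation hX) (fieldDerivation hY) a b a' b').rep =ᶠ[𝓝 0] fun y =>
      (b.rep y * fderiv ℂ a.rep y (X y) - a.rep y * fderiv ℂ b.rep y (X y)) *
        (b'.rep y * fderiv ℂ a'.rep y (Y y) - a'.rep y * fderiv ℂ b'.rep y (Y y)) -
      (b.rep y * fderiv ℂ a.rep y (Y y) - a.rep y * fderiv ℂ b.rep y (Y y)) *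
        (b'.rep y * fderiv ℂ a'.rep y (X y) - a'.rep y * fderiv ℂ b'.rep y (X y)) := by
  have h : ∀ {X : E → E} (hX : AnalyticAt ℂ X 0) (a b : AnalyticGerm E),
      (b * fieldDerivation hX a - a * fieldDerivation hX b).rep =ᶠ[𝓝 0] fun y =>
        b.rep y * fderiv ℂ a.rep y (X y) - a.rep y * fderiv ℂ b.rep y (X y) := by
    intro X hX a b
    filter_upwards [eventually_rep_mul_sub_mul b (fieldDerivation hX a) a (fieldDerivation hX b),
      rep_fieldDerivation hX a, rep_fieldDerivation hX b] with y h1 h2 h3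
    rw [h1, h2, h3]
  filter_upwards [eventually_rep_mul_sub_mul (b * fieldDerivation hX a - a * fieldDerivation hX b)
    (b' * fieldDerivation hY a' - a' * fieldDerivation hY b')
    (b * fieldDerivation hY a - a * fieldDerivation hY b)
    (b' * fieldDerivation hX a' - a' * fieldDerivation hX b'), h hX a b, h hY a b, h hX a' b',
    h hY a' b'] with y h1 h2 h3 h4 h5
  rw [wedgeNumerator, h1, h2, h3, h4, h5]

/-- Derivations `D i` that generically span the tangent spaces of a zero locus, and the
parametrizations that compute them. -/
theorem IsZeroLocus.exists_derivations [FiniteDimensional ℂ E] {I : Ideal (AnalyticGerm E)}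
    [I.IsPrime] {Z : Set E} (hZ : IsZeroLocus Z I) :
    ∃ (d : ℕ) (Δ : AnalyticGerm E) (D : Fin d → Derivation ℂ (AnalyticGerm E) (AnalyticGerm E)),
      Δ ∉ I ∧ (∀ i, ∀ F ∈ I, D i F ∈ I) ∧ ∀ a b a' b' : AnalyticGerm E, ∀ᶠ y in 𝓝[Z] 0,
        Δ.rep y ≠ 0 → ∃ (π : E →L[ℂ] (Fin d → ℂ)) (ψ : (Fin d → ℂ) → E), AnalyticAt ℂ ψ 0 ∧
          ψ 0 = y ∧ (∀ᶠ v in 𝓝 0, π (ψ v) = π y + v) ∧ map ψ (𝓝 0) = 𝓝[Z] y ∧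
          ∀ F G : E → ℂ, AnalyticAt ℂ F y → AnalyticAt ℂ G y →
            (∀ᶠ u in 𝓝[Z] y, F u * b.rep u = a.rep u) →
            (∀ᶠ u in 𝓝[Z] y, G u * b'.rep u = a'.rep u) → ∀ i j,
              (wedgeNumerator (D i) (D j) a b a' b').rep y =
                Δ.rep y ^ 2 * b.rep y ^ 2 * b'.rep y ^ 2 *
                  wedge (F ∘ ψ) (G ∘ ψ) 0 (Pi.single i 1) (Pi.single j 1) := by
  obtain ⟨d, ι, _, Φ, hΦ⟩ := hasNormalizations I ‹_›
  obtain ⟨Δ, X, hΔ, hX, hψ⟩ := hΦ.exists_parametrizations hZ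
  have hder : ∀ {F : E → ℂ} {ψ : (Fin d → ℂ) → E} {y : E}, AnalyticAt ℂ F y → AnalyticAt ℂ ψ 0 →
      ψ 0 = y → ∀ v, fderiv ℂ (F ∘ ψ) 0 v = fderiv ℂ F y (fderiv ℂ ψ 0 v) := by
    rintro F ψ y hF hψ rfl v
    rw [fderiv_comp _ hF.differentiableAt hψ.differentiableAt]
    rfl
  refine ⟨d, Δ, fun i => fieldDerivation (hX (Pi.single i 1)), hΔ, fun i F hF => ?_,
    fun a b a' b' => ?_⟩
  · -- a derivative along `Z` of a function that vanishes on `Z`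
    suffices Δ * fieldDerivation (hX (Pi.single i 1)) F ∈ I from
      (Ideal.IsPrime.mem_or_mem ‹_› this).resolve_left hΔ
    rw [hZ.mem_iff]
    filter_upwards [hψ, eventually_eventually_nhdsWithin.2 ((hZ.mem_iff F).1 hF),
      nhdsWithin_le_nhds (eventually_rep_mul Δ (fieldDerivation (hX (Pi.single i 1)) F)),
      nhdsWithin_le_nhds (rep_fieldDerivation (hX (Pi.single i 1)) F),
      nhdsWithin_le_nhds F.analyticAt_rep.eventually_analyticAt] with y h1 h2 h3 h4 h5
    rw [h3, h4]
    by_cases hy : Δ.rep y = 0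
    · rw [hy, zero_mul]
    obtain ⟨ψ, g1, g2, -, g4, g5⟩ := h1 hy
    rw [← g5, map_smul, ← hder h5 g1 g2]
    have h6 : F.rep ∘ ψ =ᶠ[𝓝 0] fun _ => 0 := by
      rw [← g4] at h2
      exact h2
    rw [h6.fderiv_eq]
    simp
  · have hW := eventually_all.2 fun i => eventually_all.2 fun j =>
      eventually_rep_wedgeNumerator (hX (Pi.single i 1)) (hX (Pi.single j 1)) a b a' b'
    filter_upwards [hψ, nhdsWithin_le_nhds hW,
      nhdsWithin_le_nhds a.analyticAt_rep.eventually_analyticAt,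
      nhdsWithin_le_nhds b.analyticAt_rep.eventually_analyticAt,
      nhdsWithin_le_nhds a'.analyticAt_rep.eventually_analyticAt,
      nhdsWithin_le_nhds b'.analyticAt_rep.eventually_analyticAt] with y h1 h2 ha hb ha' hb' hy
    obtain ⟨ψ, g1, g2, g3, g4, g5⟩ := h1 hy
    refine ⟨prBase Φ, ψ, g1, g2, g3, g4, fun F G hF hG hFb hGb i j => ?_⟩
    -- the quotient rule along the parametrization
    have hquot : ∀ {F : E → ℂ} {a b : AnalyticGerm E}, AnalyticAt ℂ F y → AnalyticAt ℂ a.rep y →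
        AnalyticAt ℂ b.rep y → (∀ᶠ u in 𝓝[Z] y, F u * b.rep u = a.rep u) → ∀ v,
        b.rep y * fderiv ℂ a.rep y (X v y) - a.rep y * fderiv ℂ b.rep y (X v y) =
          Δ.rep y * b.rep y ^ 2 * fderiv ℂ (F ∘ ψ) 0 v := by
      intro F a b hF ha hb h v
      rw [← g4] at h
      have h' : a.rep ∘ ψ =ᶠ[𝓝 0] fun v => (F ∘ ψ) v * (b.rep ∘ ψ) v := by
        filter_upwards [h] with v hv
        exact hv.symm
      have h0 := h'.self_of_nhds
      simp only [Function.comp_apply, g2] at h0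
      have hF' : DifferentiableAt ℂ (F ∘ ψ) 0 :=
        (AnalyticAt.comp (g := F) (by rwa [g2]) g1).differentiableAt
      have hb' : DifferentiableAt ℂ (b.rep ∘ ψ) 0 :=
        (AnalyticAt.comp (g := b.rep) (by rwa [g2]) g1).differentiableAt
      rw [← g5, map_smul, map_smul, ← hder ha g1 g2, ← hder hb g1 g2, h'.fderiv_eq,
        fderiv_fun_mul hF' hb']
      simp only [Function.comp_apply, g2, add_apply, smul_apply, smul_eq_mul]
      rw [h0]
      ring
    rw [h2 i j, hquot hF ha hb hFb, hquot hF ha hb hFb, hquot hG ha' hb' hGb, hquot hG ha' hb' hGb,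
      wedge]
    ring

/-- A form that does not vanish in one parametrization does not vanish in another one, and then
not on all pairs of basis vectors. -/
theorem exists_wedge_ne_zero {V : Type*} [NormedAddCommGroup V] [NormedSpace ℂ V] {d : ℕ}
    {Z : Set E} {y : E} {π : E →L[ℂ] (Fin d → ℂ)} {ψ : (Fin d → ℂ) → E} (hψ : AnalyticAt ℂ ψ 0)
    (hψ0 : ψ 0 = y) (hπ : ∀ᶠ v in 𝓝 0, π (ψ v) = π y + v) (hmap : map ψ (𝓝 0) = 𝓝[Z] y)
    {F G : E → ℂ} (hF : AnalyticAt ℂ F y) (hG : AnalyticAt ℂ G y) {φ : V → E} {x : V}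
    (hφ : AnalyticAt ℂ φ x) (hφx : φ x = y) (hφZ : ∀ᶠ v in 𝓝 x, φ v ∈ Z) {v w : V}
    (h : wedge (F ∘ φ) (G ∘ φ) x v w ≠ 0) :
    ∃ i j, wedge (F ∘ ψ) (G ∘ ψ) 0 (Pi.single i 1) (Pi.single j 1) ≠ 0 := by
  have hψφ : ∀ᶠ v in 𝓝 x, ψ (π (φ v) - π y) = φ v := by
    have h1 : ∀ᶠ u in 𝓝[Z] y, ψ (π u - π y) = u := by
      rw [← hmap, eventually_map]
      filter_upwards [hπ] with v hv
      rw [hv, add_sub_cancel_left]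
    have h2 : Tendsto φ (𝓝 x) (𝓝[Z] y) :=
      tendsto_nhdsWithin_iff.2 ⟨hφx ▸ hφ.continuousAt, hφZ⟩
    exact h2.eventually h1
  let g : V → (Fin d → ℂ) := fun v => π (φ v) - π y
  have hg : HasFDerivAt g (π.comp (fderiv ℂ φ x)) x :=
    (HasFDerivAt.comp x π.hasFDerivAt hφ.differentiableAt.hasFDerivAt).sub_const _
  have hgx : g x = 0 := by simp [g, hφx]
  have hcomp : ∀ {F : E → ℂ}, AnalyticAt ℂ F y → ∀ v, fderiv ℂ (F ∘ φ) x v =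
      fderiv ℂ (F ∘ ψ) 0 (π (fderiv ℂ φ x v)) := by
    intro F hF v
    have h1 : F ∘ φ =ᶠ[𝓝 x] (F ∘ ψ) ∘ g := by
      filter_upwards [hψφ] with u hu
      exact congrArg F hu.symm
    have h2 : DifferentiableAt ℂ (F ∘ ψ) (g x) := by
      rw [hgx]
      exact (AnalyticAt.comp (g := F) (by rwa [hψ0]) hψ).differentiableAt
    rw [h1.fderiv_eq, fderiv_comp _ h2 hg.differentiableAt, hg.fderiv, hgx]
    rfl
  by_contra! hcon
  refine h ?_
  have hexp : ∀ (L : (Fin d → ℂ) →L[ℂ] ℂ) (v : Fin d → ℂ),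
      L v = ∑ i, v i * L (Pi.single i 1) := by
    intro L v
    conv_lhs => rw [← Finset.univ_sum_single v, map_sum]
    refine Finset.sum_congr rfl fun i _ => ?_
    have : Pi.single i (v i) = v i • Pi.single (M := fun _ : Fin d => ℂ) i 1 := by
      rw [← Pi.single_smul, smul_eq_mul, mul_one]
    rw [this, map_smul, smul_eq_mul]
  rw [wedge, hcomp hF, hcomp hF, hcomp hG, hcomp hG]
  set v' := π (fderiv ℂ φ x v)
  set w' := π (fderiv ℂ φ x w)
  rw [hexp (fderiv ℂ (F ∘ ψ) 0) v', hexp (fderiv ℂ (F ∘ ψ) 0) w', hexp (fderiv ℂ (G ∘ ψ) 0) v',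
    hexp (fderiv ℂ (G ∘ ψ) 0) w', Finset.sum_mul_sum, Finset.sum_mul_sum, Finset.sum_comm,
    ← Finset.sum_sub_distrib]
  refine Finset.sum_eq_zero fun i _ => ?_
  rw [← Finset.sum_sub_distrib]
  refine Finset.sum_eq_zero fun j _ => ?_
  have := hcon j i
  rw [wedge] at this
  linear_combination v' j * w' i * this

end AnalyticGerm

/-! ### Generic behaviour along a zero locus -/

namespace AnalyticGerm

open Filter

variable {E : Type*} [NormedAddCommGroup E] [NormedSpace ℂ E]

/-- A germ that does not vanish on `Z` near `0` does not vanish on `Z` near the points close to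
`0`. -/
theorem IsZeroLocus.eventually_frequently_ne_zero [FiniteDimensional ℂ E]
    {I : Ideal (AnalyticGerm E)} [I.IsPrime] {Z : Set E} (hZ : IsZeroLocus Z I) {γ : AnalyticGerm E}
    (hγ : γ ∉ I) : ∀ᶠ y in 𝓝[Z] 0, ∃ᶠ u in 𝓝[Z] y, γ.rep u ≠ 0 := by
  obtain ⟨d, ι, _, Φ, hΦ⟩ := hasNormalizations I ‹_›
  exact hΦ.eventually_frequently_ne_zero hZ hγ

/-- The form `dF ∧ dG` does not vanish at the point `y` of `Z` on two vectors tangent to `Z`, where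
`Z` has at `y` the parametrization that computes it. -/
def HasNonzeroWedgeAt (Z : Set E) (y : E) (F G : E → ℂ) : Prop :=
  ∃ (V : Type) (_ : NormedAddCommGroup V) (_ : NormedSpace ℂ V) (φ : V → E) (v w : V),
    φ 0 = y ∧ AnalyticAt ℂ φ 0 ∧ map φ (𝓝 0) = 𝓝[Z] y ∧ wedge (F ∘ φ) (G ∘ φ) 0 v w ≠ 0

/-- Whether `df ∧ dg` vanishes identically, for two quotients `f = a / b`, `g = a' / b'` of germs,
can be tested by derivations, and it can be seen near every point of `Z` close to `0`. -/
theorem IsZeroLocus.exists_derivations_wedge [FiniteDimensional ℂ E] {I : Ideal (AnalyticGerm E)}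
    [I.IsPrime] {Z : Set E} (hZ : IsZeroLocus Z I) :
    ∃ (d : ℕ) (D : Fin d → Derivation ℂ (AnalyticGerm E) (AnalyticGerm E)),
      (∀ i, ∀ F ∈ I, D i F ∈ I) ∧ ∀ a b a' b' : AnalyticGerm E, b ∉ I → b' ∉ I →
        (∀ᶠ y in 𝓝[Z] 0, ∀ F G : E → ℂ, AnalyticAt ℂ F y → AnalyticAt ℂ G y →
          (∀ᶠ u in 𝓝[Z] y, F u * b.rep u = a.rep u) →
          (∀ᶠ u in 𝓝[Z] y, G u * b'.rep u = a'.rep u) → HasNonzeroWedgeAt Z y F G →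
          ∃ i j, wedgeNumerator (D i) (D j) a b a' b' ∉ I) ∧
        ∀ i j, wedgeNumerator (D i) (D j) a b a' b' ∉ I →
          ∀ᶠ y in 𝓝[Z] 0, ∃ᶠ u in 𝓝[Z] y, ∃ F G : E → ℂ, AnalyticAt ℂ F u ∧ AnalyticAt ℂ G u ∧
            (∀ᶠ p in 𝓝[Z] u, F p * b.rep p = a.rep p) ∧
            (∀ᶠ p in 𝓝[Z] u, G p * b'.rep p = a'.rep p) ∧ HasNonzeroWedgeAt Z u F G := by
  have hI : I.IsPrime := ‹_›
  obtain ⟨d, Δ, D, hΔ, hD, hψ⟩ := hZ.exists_derivations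
  refine ⟨d, D, hD, fun a b a' b' hb hb' => ⟨?_, fun i j hW => ?_⟩⟩
  · by_cases hW : ∃ i j, wedgeNumerator (D i) (D j) a b a' b' ∉ I
    · exact Eventually.of_forall fun _ _ _ _ _ _ _ _ => hW
    push Not at hW
    have hγ : Δ * b * b' ∉ I := hI.mul_notMem (hI.mul_notMem hΔ hb) hb'
    have hW' := eventually_all.2 fun i => eventually_all.2 fun j => (hZ.mem_iff _).1 (hW i j)
    have hγ' : (Δ * b * b').rep =ᶠ[𝓝 0] fun u => Δ.rep u * b.rep u * b'.rep u := by
      filter_upwards [eventually_rep_mul (Δ * b) b', eventually_rep_mul Δ b] with u h1 h2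
      rw [h1, h2]
    filter_upwards [hZ.eventually_frequently_ne_zero hγ,
      eventually_eventually_nhdsWithin.2 (hψ a b a' b'), eventually_eventually_nhdsWithin.2 hW',
      eventually_eventually_nhdsWithin.2 (nhdsWithin_le_nhds hγ')]
      with y h1 h2 h3 h4 F G hF hG hFb hGb hwedge
    exfalso
    obtain ⟨V, _, _, φ, v, w, hφ0, hφ, hφZ, hne⟩ := hwedge
    -- the form does not vanish at the points of the parametrization near the given one
    have hcont : ∀ᶠ t in 𝓝 0, wedge (F ∘ φ) (G ∘ φ) t v w ≠ 0 := by
      have hF' : AnalyticAt ℂ (F ∘ φ) 0 := AnalyticAt.comp (g := F) (by rwa [hφ0]) hφ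
      have hG' : AnalyticAt ℂ (G ∘ φ) 0 := AnalyticAt.comp (g := G) (by rwa [hφ0]) hφ
      have h : ContinuousAt (fun t => wedge (F ∘ φ) (G ∘ φ) t v w) 0 :=
        (((hF'.fderiv.continuousAt.clm_apply continuousAt_const).mul
          (hG'.fderiv.continuousAt.clm_apply continuousAt_const)).sub
          ((hF'.fderiv.continuousAt.clm_apply continuousAt_const).mul
          (hG'.fderiv.continuousAt.clm_apply continuousAt_const)))
      exact h.eventually_ne hne
    have hev : ∀ᶠ t in 𝓝 0, φ t ∈ Z := by
      have : ∀ᶠ u in 𝓝[Z] y, u ∈ Z := self_mem_nhdsWithin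
      rwa [← hφZ] at this
    have htend : Tendsto φ (𝓝 0) (𝓝[Z] y) := hφZ.le
    rw [← hφZ, frequently_map] at h1
    obtain ⟨t, ht1, ht2, ht3, ht4, ht5, ht6, ht7, ht8, ht9, ht10, ht11⟩ :=
      (h1.and_eventually
        (hcont.and ((eventually_eventually_nhds.2 hev).and ((htend.eventually h2).and
        ((htend.eventually h3).and ((htend.eventually h4).and ((htend.eventually
        (eventually_eventually_nhdsWithin.2 hFb)).and ((htend.eventually
        (eventually_eventually_nhdsWithin.2 hGb)).and ((htend.eventually (nhdsWithin_le_nhds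
        hF.eventually_analyticAt)).and ((htend.eventually (nhdsWithin_le_nhds
        hG.eventually_analyticAt)).and hφ.eventually_analyticAt)))))))))).exists
    rw [ht6] at ht1
    have hΔ' := left_ne_zero_of_mul (left_ne_zero_of_mul ht1)
    obtain ⟨π, ψ, g1, g2, g3, g4, g5⟩ := ht4 hΔ'
    obtain ⟨i, j, hij⟩ := exists_wedge_ne_zero g1 g2 g3 g4 ht9 ht10 ht11 rfl ht3 ht2
    have h0 := g5 F G ht9 ht10 ht7 ht8 i j
    rw [ht5 i j] at h0
    have hb0 := right_ne_zero_of_mul (left_ne_zero_of_mul ht1)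
    have hb0' := right_ne_zero_of_mul ht1
    exact mul_ne_zero (mul_ne_zero (mul_ne_zero (pow_ne_zero 2 hΔ') (pow_ne_zero 2 hb0))
      (pow_ne_zero 2 hb0')) hij h0.symm
  · set Y := wedgeNumerator (D i) (D j) a b a' b'
    have hγ : Δ * b * b' * Y ∉ I :=
      hI.mul_notMem (hI.mul_notMem (hI.mul_notMem hΔ hb) hb') hW
    have hγ' : (Δ * b * b' * Y).rep =ᶠ[𝓝 0] fun u => Δ.rep u * b.rep u * b'.rep u * Y.rep u := by
      filter_upwards [eventually_rep_mul (Δ * b * b') Y, eventually_rep_mul (Δ * b) b',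
        eventually_rep_mul Δ b] with u h1 h2 h3
      rw [h1, h2, h3]
    filter_upwards [hZ.eventually_frequently_ne_zero hγ,
      eventually_eventually_nhdsWithin.2 (hψ a b a' b'),
      eventually_eventually_nhdsWithin.2 (nhdsWithin_le_nhds hγ'),
      eventually_eventually_nhdsWithin.2
        (nhdsWithin_le_nhds a.analyticAt_rep.eventually_analyticAt),
      eventually_eventually_nhdsWithin.2
        (nhdsWithin_le_nhds b.analyticAt_rep.eventually_analyticAt),
      eventually_eventually_nhdsWithin.2
        (nhdsWithin_le_nhds a'.analyticAt_rep.eventually_analyticAt),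
      eventually_eventually_nhdsWithin.2
        (nhdsWithin_le_nhds b'.analyticAt_rep.eventually_analyticAt)] with y h1 h2 h3 h4 h5 h6 h7
    refine (h1.and_eventually (h2.and (h3.and (h4.and (h5.and (h6.and h7)))))).mono ?_
    rintro u ⟨k1, k2, k3, k4, k5, k6, k7⟩
    rw [k3] at k1
    have hb0 := right_ne_zero_of_mul (left_ne_zero_of_mul (left_ne_zero_of_mul k1))
    have hb0' := right_ne_zero_of_mul (left_ne_zero_of_mul k1)
    have hY0 := right_ne_zero_of_mul k1
    have hΔ0 := left_ne_zero_of_mul (left_ne_zero_of_mul (left_ne_zero_of_mul k1))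
    obtain ⟨π, ψ, g1, g2, -, g4, g5⟩ := k2 hΔ0
    have hquot : ∀ {a b : AnalyticGerm E}, AnalyticAt ℂ b.rep u → b.rep u ≠ 0 →
        ∀ᶠ p in 𝓝[Z] u, a.rep p / b.rep p * b.rep p = a.rep p := fun hb h0 => by
      filter_upwards [nhdsWithin_le_nhds (hb.continuousAt.eventually_ne h0)] with p hp
      exact div_mul_cancel₀ _ hp
    have hF := k4.fun_div k5 hb0
    have hG := k6.fun_div k7 hb0'
    refine ⟨_, _, hF, hG, hquot k5 hb0, hquot k7 hb0', Fin d → ℂ, inferInstance, inferInstance, ψ,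
      Pi.single i 1, Pi.single j 1, g2, g1, g4, fun h0 => hY0 ?_⟩
    rw [g5 _ _ hF hG (hquot k5 hb0) (hquot k7 hb0') i j, h0, mul_zero]

end AnalyticGerm

/-! ### The local rings of an analytic set in a chart -/

namespace AnalyticVariety

open Filter

section Chart

variable {E : Type*} [NormedAddCommGroup E]
  {M : Type*} [TopologicalSpace M] [ChartedSpace E M]

/-- The chart at `x`, translated so that it maps `x` to `0`. -/
noncomputable def centeredChart (x : M) : OpenPartialHomeomorph M E :=
  (chartAt E x).transHomeomorph (Homeomorph.addRight (-chartAt E x x))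

theorem centeredChart_apply (x p : M) :
    (centeredChart x : M → E) p = chartAt E x p - chartAt E x x :=
  (sub_eq_add_neg _ _).symm

theorem centeredChart_symm_apply (x : M) (v : E) :
    (centeredChart x).symm v = (chartAt E x).symm (v + chartAt E x x) := by
  change (chartAt E x).symm (v + - -chartAt E x x) = _
  rw [neg_neg]

theorem centeredChart_self (x : M) : centeredChart (E := E) x x = 0 := by
  rw [centeredChart_apply, sub_self]

theorem mem_centeredChart_source (x : M) : x ∈ (centeredChart (E := E) x).source :=
  mem_chart_source E x

theorem mem_centeredChart_target {x : M} {v : E} :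
    v ∈ (centeredChart x).target ↔ v + chartAt E x x ∈ (chartAt E x).target := by
  change v + - -chartAt E x x ∈ (chartAt E x).target ↔ _
  rw [neg_neg]

theorem zero_mem_centeredChart_target (x : M) : (0 : E) ∈ (centeredChart x).target := by
  rw [← centeredChart_self x]
  exact (centeredChart x).map_source (mem_centeredChart_source x)

theorem centeredChart_symm_zero (x : M) : (centeredChart x).symm (0 : E) = x := by
  rw [← centeredChart_self x]
  exact (centeredChart x).left_inv (mem_centeredChart_source x)

theorem map_centeredChart_symm {x : M} {v : E} (hv : v ∈ (centeredChart x).target) (A : Set M) :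
    map (centeredChart (E := E) x).symm (𝓝[(centeredChart x).symm ⁻¹' A] v) =
      𝓝[A] (centeredChart (E := E) x).symm v :=
  (centeredChart x).symm.map_nhdsWithin_preimage_eq hv A

theorem map_centeredChart {x p : M} (hp : p ∈ (centeredChart (E := E) x).source) (A : Set M) :
    map (centeredChart (E := E) x) (𝓝[A] p) =
      𝓝[(centeredChart x).symm ⁻¹' A] (centeredChart x p) := by
  have hv := (centeredChart (E := E) x).map_source hp
  have h1 := map_centeredChart_symm hv A
  rw [(centeredChart x).left_inv hp] at h1
  rw [← h1, map_map]
  refine (map_congr ?_).trans map_id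
  exact nhdsWithin_le_nhds ((centeredChart x).eventually_right_inverse hv)

theorem eventually_centeredChart {x : M} {P : E → Prop} (A : Set M) :
    (∀ᶠ p in 𝓝[A] x, P (centeredChart x p)) ↔
      ∀ᶠ u in 𝓝[(centeredChart x).symm ⁻¹' A] (0 : E), P u := by
  rw [← centeredChart_self x, ← map_centeredChart (mem_centeredChart_source x), eventually_map]

variable [NormedSpace ℂ E] [IsManifold 𝓘(ℂ, E) ω M]

theorem contMDiffAt_centeredChart {x p : M} (hp : p ∈ (centeredChart (E := E) x).source) :
    ContMDiffAt 𝓘(ℂ, E) 𝓘(ℂ, E) ω (centeredChart (E := E) x) p := by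
  have h1 : ContMDiffAt 𝓘(ℂ, E) 𝓘(ℂ, E) ω (chartAt E x) p :=
    contMDiffOn_chart.contMDiffAt ((chartAt E x).open_source.mem_nhds hp)
  have h2 : ContMDiffAt 𝓘(ℂ, E) 𝓘(ℂ, E) ω (fun v : E => v - chartAt E x x) (chartAt E x p) :=
    (contDiffAt_id.sub contDiffAt_const).contMDiffAt
  exact (h2.comp p h1).congr_of_eventuallyEq
    (Eventually.of_forall fun q => centeredChart_apply x q)

theorem contMDiffAt_centeredChart_symm {x : M} {v : E} (hv : v ∈ (centeredChart x).target) :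
    ContMDiffAt 𝓘(ℂ, E) 𝓘(ℂ, E) ω (centeredChart (E := E) x).symm v := by
  have h1 : ContMDiffAt 𝓘(ℂ, E) 𝓘(ℂ, E) ω (chartAt E x).symm (v + chartAt E x x) :=
    contMDiffOn_chart_symm.contMDiffAt
      ((chartAt E x).open_target.mem_nhds (mem_centeredChart_target.1 hv))
  have h2 : ContMDiffAt 𝓘(ℂ, E) 𝓘(ℂ, E) ω (fun v : E => v + chartAt E x x) v :=
    (contDiffAt_id.add contDiffAt_const).contMDiffAt
  exact (h1.comp v h2).congr_of_eventuallyEq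
    (Eventually.of_forall fun q => centeredChart_symm_apply x q)

theorem HolAt.analyticAt_comp_symm {x : M} {v : E} (hv : v ∈ (centeredChart x).target) {F : M → ℂ}
    (hF : HolAt E F ((centeredChart x).symm v)) :
    AnalyticAt ℂ (F ∘ (centeredChart (E := E) x).symm) v :=
  (contMDiffAt_iff_contDiffAt.1 (ContMDiffAt.comp v hF
    (contMDiffAt_centeredChart_symm hv))).analyticAt

theorem holAt_comp_centeredChart {x p : M} (hp : p ∈ (centeredChart (E := E) x).source) {G : E → ℂ}
    (hG : AnalyticAt ℂ G (centeredChart x p)) : HolAt E (G ∘ centeredChart (E := E) x) p :=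
  ContMDiffAt.comp p (contMDiffAt_iff_contDiffAt.2 hG.contDiffAt) (contMDiffAt_centeredChart hp)

end Chart

end AnalyticVariety

/-! ### Analytic sets with normal local rings -/

namespace AnalyticVariety

open Filter AnalyticGerm

section Stalk

variable {E : Type*} [NormedAddCommGroup E] [NormedSpace ℂ E]
  {M : Type*} [TopologicalSpace M] [ChartedSpace E M]

/-- The element of the local ring given by a holomorphic function. -/
def toStalk (A : Set M) {x : M} {F : M → ℂ} (hF : HolAt E F x) : stalk E A x :=
  ⟨(F : Germ (𝓝[A] x) ℂ), F, hF, rfl⟩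

theorem exists_toStalk_eq {A : Set M} {x : M} (φ : stalk E A x) :
    ∃ (F : M → ℂ) (hF : HolAt E F x), toStalk A hF = φ := by
  obtain ⟨_, F, hF, rfl⟩ := φ
  exact ⟨F, hF, rfl⟩

theorem toStalk_eq_iff {A : Set M} {x : M} {F G : M → ℂ} {hF : HolAt E F x} {hG : HolAt E G x} :
    toStalk A hF = toStalk A hG ↔ ∀ᶠ p in 𝓝[A] x, F p = G p :=
  Subtype.ext_iff.trans Germ.coe_eq

theorem toStalk_eq_zero_iff {A : Set M} {x : M} {F : M → ℂ} {hF : HolAt E F x} :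
    toStalk A hF = 0 ↔ ∀ᶠ p in 𝓝[A] x, F p = 0 :=
  Subtype.ext_iff.trans Germ.coe_eq

theorem toStalk_mul {A : Set M} {x : M} {F G : M → ℂ} (hF : HolAt E F x) (hG : HolAt E G x) :
    toStalk A (hF.mul hG) = toStalk A hF * toStalk A hG :=
  rfl

variable [IsManifold 𝓘(ℂ, E) ω M]

theorem holAt_rep_comp (x : M) (F : AnalyticGerm E) :
    HolAt E (F.rep ∘ centeredChart (E := E) x) x :=
  holAt_comp_centeredChart (mem_centeredChart_source x)
    (by rw [centeredChart_self]; exact F.analyticAt_rep)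

/-- In a chart, the local ring of an analytic set is a quotient of the ring of germs of analytic
functions. -/
noncomputable def stalkMap (A : Set M) (x : M) : AnalyticGerm E →ₐ[ℂ] stalk E A x where
  toFun F := toStalk A (holAt_rep_comp x F)
  map_one' := Subtype.ext <| Germ.coe_eq.2 <| (eventually_centeredChart
    (P := fun u => rep 1 u = 1) A).2 <|
    nhdsWithin_le_nhds (rep_mk (fun _ => 1) analyticAt_const)
  map_zero' := Subtype.ext <| Germ.coe_eq.2 <| (eventually_centeredChart
    (P := fun u => rep 0 u = 0) A).2 <|
    nhdsWithin_le_nhds (rep_mk (fun _ => 0) analyticAt_const)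
  map_mul' F G := Subtype.ext <| Germ.coe_eq.2 <| (eventually_centeredChart
    (P := fun u => (F * G).rep u = F.rep u * G.rep u) A).2 <|
    nhdsWithin_le_nhds (eventually_rep_mul F G)
  map_add' F G := Subtype.ext <| Germ.coe_eq.2 <| (eventually_centeredChart
    (P := fun u => (F + G).rep u = F.rep u + G.rep u) A).2 <|
    nhdsWithin_le_nhds (eventually_rep_add F G)
  commutes' c := Subtype.ext <| Germ.coe_eq.2 <| (eventually_centeredChart
    (P := fun u => (algebraMap ℂ (AnalyticGerm E) c).rep u = c) A).2 <|
    nhdsWithin_le_nhds (rep_algebraMap c)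

theorem stalkMap_apply (A : Set M) (x : M) (F : AnalyticGerm E) :
    stalkMap A x F = toStalk A (holAt_rep_comp x F) :=
  rfl

theorem stalkMap_eq_zero_iff {A : Set M} {x : M} {F : AnalyticGerm E} :
    stalkMap A x F = 0 ↔ ∀ᶠ u in 𝓝[(centeredChart x).symm ⁻¹' A] (0 : E), F.rep u = 0 := by
  rw [stalkMap_apply, toStalk_eq_zero_iff]
  exact eventually_centeredChart (P := fun u => F.rep u = 0) A

/-- The germ in the chart at `x` of a function that is holomorphic at `x`. -/
noncomputable def inChart {x : M} {F : M → ℂ} (hF : HolAt E F x) : AnalyticGerm E :=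
  AnalyticGerm.mk (F ∘ (centeredChart x).symm)
    (HolAt.analyticAt_comp_symm (zero_mem_centeredChart_target x)
      (by rwa [centeredChart_symm_zero]))

theorem rep_inChart {x : M} {F : M → ℂ} (hF : HolAt E F x) :
    (inChart hF).rep =ᶠ[𝓝 0] F ∘ (centeredChart (E := E) x).symm :=
  rep_mk _ _

theorem rep_inChart_comp {x : M} {F : M → ℂ} (hF : HolAt E F x) :
    ∀ᶠ p in 𝓝 x, (inChart hF).rep (centeredChart x p) = F p := by
  have h1 : Tendsto (centeredChart (E := E) x) (𝓝 x) (𝓝 0) := by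
    have := (centeredChart (E := E) x).continuousAt (mem_centeredChart_source x)
    rwa [ContinuousAt, centeredChart_self] at this
  filter_upwards [h1.eventually (rep_inChart hF),
    (centeredChart (E := E) x).eventually_left_inverse (mem_centeredChart_source x)] with p hp h2
  rw [hp, Function.comp_apply, h2]

theorem stalkMap_inChart (A : Set M) {x : M} {F : M → ℂ} (hF : HolAt E F x) :
    stalkMap A x (inChart hF) = toStalk A hF := by
  rw [stalkMap_apply]
  exact toStalk_eq_iff.2 (nhdsWithin_le_nhds (rep_inChart_comp hF))

theorem stalkMap_surjective (A : Set M) (x : M) :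
    Function.Surjective (stalkMap (E := E) A x) := fun φ => by
  obtain ⟨F, hF, rfl⟩ := exists_toStalk_eq φ
  exact ⟨_, stalkMap_inChart A hF⟩

/-- The restriction of the local ring of `A` to a subset `B`. -/
theorem exists_restriction {A B : Set M} (hBA : B ⊆ A) (x : M) :
    ∃ r : stalk E A x →+* stalk E B x, Function.Surjective r ∧
      ∀ (F : M → ℂ) (hF : HolAt E F x), r (toStalk A hF) = toStalk B hF := by
  have hle : RingHom.ker (stalkMap (E := E) A x) ≤
      RingHom.ker (stalkMap (E := E) B x : AnalyticGerm E →+* stalk E B x) := fun F hF =>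
    stalkMap_eq_zero_iff.2 ((stalkMap_eq_zero_iff.1 hF).filter_mono
      (nhdsWithin_mono _ (Set.preimage_mono hBA)))
  let r := RingHom.liftOfSurjective (stalkMap (E := E) A x : AnalyticGerm E →+* stalk E A x)
    (stalkMap_surjective A x) ⟨(stalkMap (E := E) B x : AnalyticGerm E →+* stalk E B x), hle⟩
  have hr : ∀ F : AnalyticGerm E, r (stalkMap A x F) = stalkMap B x F := fun F =>
    RingHom.liftOfRightInverse_comp_apply _ _ _ _ F
  refine ⟨r, fun φ => ?_, fun F hF => ?_⟩
  · obtain ⟨F, rfl⟩ := stalkMap_surjective B x φ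
    exact ⟨_, hr F⟩
  · rw [← stalkMap_inChart A hF, hr, stalkMap_inChart]

/-- The local ring at `x` of a set depends only on the set near `x`. -/
theorem nonempty_stalk_equiv {A B : Set M} {x : M} (h : 𝓝[A] x = 𝓝[B] x) :
    Nonempty (stalk E A x ≃+* stalk E B x) := by
  have hker : RingHom.ker (stalkMap (E := E) A x) = RingHom.ker (stalkMap (E := E) B x) := by
    ext F
    rw [RingHom.mem_ker, RingHom.mem_ker, stalkMap_apply, stalkMap_apply, toStalk_eq_zero_iff,
      toStalk_eq_zero_iff, h]
  exact ⟨((RingHom.quotientKerEquivOfSurjective (stalkMap_surjective A x)).symm.trans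
    (Ideal.quotEquivOfEq hker)).trans
    (RingHom.quotientKerEquivOfSurjective (stalkMap_surjective B x))⟩

variable (E) in
/-- The set `U` is a locally closed analytic subset of `M`, and it is normal. -/
structure IsLocallyNormal (U : Set M) : Prop where
  exists_eq : ∀ x ∈ U, ∃ (k : ℕ) (F : Fin k → M → ℂ), (∀ i, HolAt E (F i) x) ∧
    ∀ᶠ y in 𝓝 x, y ∈ U ↔ ∀ i, F i y = 0
  isDomain : ∀ x ∈ U, IsDomain (stalk E U x)
  isIntegrallyClosed : ∀ x ∈ U, IsIntegrallyClosed (stalk E U x)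

/-- The local rings of an analytic set at a point do not change on passing to an open subset. -/
theorem IsNormalAnalytic.isLocallyNormal_inter {S : Set M} (hS : IsAnalyticSubset E Set.univ S)
    (hSnormal : IsNormalAnalytic E S) {W : Set M} (hW : IsOpen W) : IsLocallyNormal E (S ∩ W) := by
  have heq : ∀ x ∈ S ∩ W, 𝓝[S] x = 𝓝[S ∩ W] x := fun x hx =>
    (nhdsWithin_inter_of_mem' (nhdsWithin_le_nhds (hW.mem_nhds hx.2))).symm
  refine ⟨fun x hx => ?_, fun x hx => ?_, fun x hx => ?_⟩
  · obtain ⟨k, F, hF, h⟩ := hS.2 x (Set.mem_univ x)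
    rw [nhdsWithin_univ] at h
    refine ⟨k, F, hF, ?_⟩
    filter_upwards [h, hW.mem_nhds hx.2] with y hy hyW
    rw [← hy]
    exact and_iff_left hyW
  · obtain ⟨e⟩ := nonempty_stalk_equiv (E := E) (heq x hx)
    have := (hSnormal x hx.1).1
    exact e.symm.toMulEquiv.isDomain _
  · obtain ⟨e⟩ := nonempty_stalk_equiv (E := E) (heq x hx)
    have := (hSnormal x hx.1).2
    exact IsIntegrallyClosed.of_equiv e

variable {U : Set M}

/-- In the chart at `x`, the germs that vanish on `U` are the kernel of the map to the local ring.
-/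
theorem IsLocallyNormal.isZeroLocus (hU : IsLocallyNormal E U) {x : M} (hx : x ∈ U) :
    IsZeroLocus ((centeredChart (E := E) x).symm ⁻¹' U) (RingHom.ker (stalkMap (E := E) U x)) := by
  refine ⟨fun F => stalkMap_eq_zero_iff, ?_⟩
  obtain ⟨k, F, hF, h⟩ := hU.exists_eq x hx
  refine ⟨k, fun i => inChart (hF i), ?_⟩
  have h1 : Tendsto (centeredChart x).symm (𝓝 (0 : E)) (𝓝 x) := by
    have := (centeredChart (E := E) x).symm.continuousAt (zero_mem_centeredChart_target x)
    rwa [ContinuousAt, centeredChart_symm_zero] at this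
  filter_upwards [h1.eventually h, eventually_all.2 fun i => rep_inChart (hF i)] with v h2 h3
  rw [Set.mem_preimage, h2]
  exact forall_congr' fun i => by rw [h3 i, Function.comp_apply]

theorem IsLocallyNormal.isPrime_ker (hU : IsLocallyNormal E U) {x : M} (hx : x ∈ U) :
    (RingHom.ker (stalkMap (E := E) U x)).IsPrime := by
  have := hU.isDomain x hx
  exact RingHom.ker_isPrime _

/-- A holomorphic function that does not vanish identically on `U` near `x` does not vanish
identically on `U` near the points of `U` close to `x`. -/
theorem IsLocallyNormal.eventually_frequently_ne_zero [FiniteDimensional ℂ E]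
    (hU : IsLocallyNormal E U) {x : M} (hx : x ∈ U) {F : M → ℂ} (hF : HolAt E F x)
    (h : ∃ᶠ p in 𝓝[U] x, F p ≠ 0) : ∀ᶠ y in 𝓝[U] x, ∃ᶠ p in 𝓝[U] y, F p ≠ 0 := by
  have := hU.isPrime_ker hx
  have h1 : inChart hF ∉ RingHom.ker (stalkMap (E := E) U x) := by
    rw [RingHom.mem_ker, stalkMap_inChart, toStalk_eq_zero_iff]
    exact fun h0 => h (h0.mono fun p hp hne => hne hp)
  have h2 := (eventually_centeredChart U).2 ((hU.isZeroLocus hx).eventually_frequently_ne_zero h1)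
  filter_upwards [h2, nhdsWithin_le_nhds ((centeredChart (E := E) x).open_source.mem_nhds
    (mem_centeredChart_source x)),
    nhdsWithin_le_nhds (eventually_eventually_nhds.2 (rep_inChart_comp hF))] with y h3 hy h4
  rw [← map_centeredChart hy, frequently_map] at h3
  refine (h3.and_eventually (nhdsWithin_le_nhds h4)).mono ?_
  rintro p ⟨h5, h6⟩
  rwa [h6] at h5

end Stalk

end AnalyticVariety

/-! ### Meromorphic functions on a connected normal analytic set -/

namespace AnalyticVariety

open Filter AnalyticGerm

section Meromorphic

variable {E : Type*} [NormedAddCommGroup E] [NormedSpace ℂ E]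
  {M : Type*} [TopologicalSpace M] [ChartedSpace E M] {U : Set M}

theorem isQuotientAt_iff {y : U} {s : FractionRing (stalk E U y)} {a b : M → ℂ}
    (ha : HolAt E a (y : M)) (hb : HolAt E b (y : M)) :
    IsQuotientAt E s a b ↔ toStalk U hb ∈ nonZeroDivisors (stalk E U y) ∧
      s * algebraMap (stalk E U y) _ (toStalk U hb) =
        algebraMap (stalk E U y) _ (toStalk U ha) := by
  refine ⟨?_, fun h => ⟨_, _, rfl, rfl, h⟩⟩
  rintro ⟨α, β, h1, h2, h3⟩
  obtain rfl : α = toStalk U ha := Subtype.ext h1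
  obtain rfl : β = toStalk U hb := Subtype.ext h2
  exact h3

theorem representedAt_iff {h : meromorphic E U} {x : U} {F : M → ℂ} (hF : HolAt E F (x : M)) :
    RepresentedAt h x F ↔ h.1 x = algebraMap (stalk E U x) _ (toStalk U hF) := by
  refine ⟨?_, fun h => ⟨hF, _, rfl, h⟩⟩
  rintro ⟨-, φ, h1, h2⟩
  obtain rfl : φ = toStalk U hF := Subtype.ext h1
  exact h2

/-- A quotient `a / b` is represented by `F` at `x` if and only if `F * b = a` on `U` near `x`. -/
theorem IsQuotientAt.representedAt_iff {h : meromorphic E U} {x : U} {a b F : M → ℂ}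
    (hab : IsQuotientAt E (h.1 x) a b) (ha : HolAt E a (x : M)) (hb : HolAt E b (x : M))
    (hF : HolAt E F (x : M)) :
    RepresentedAt h x F ↔ ∀ᶠ p in 𝓝[U] (x : M), F p * b p = a p := by
  obtain ⟨h1, h2⟩ := (isQuotientAt_iff ha hb).1 hab
  refine Iff.trans ?_ (toStalk_eq_iff (hF := hF.mul hb) (hG := ha))
  rw [AnalyticVariety.representedAt_iff hF, toStalk_mul hF hb,
    ← (IsFractionRing.injective (stalk E U x) (FractionRing (stalk E U x))).eq_iff, map_mul, ← h2]
  exact (IsUnit.mul_left_inj (IsLocalization.map_units (FractionRing (stalk E U x))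
    (⟨_, h1⟩ : nonZeroDivisors (stalk E U x)))).symm.trans eq_comm

/-- A quotient vanishes if and only if its numerator vanishes on `U` near `x`. -/
theorem IsLocallyNormal.eq_zero_iff_of_isQuotientAt (hU : IsLocallyNormal E U) {x : U}
    {s : FractionRing (stalk E U x)} {a b : M → ℂ} (ha : HolAt E a (x : M))
    (hb : HolAt E b (x : M)) (hab : IsQuotientAt E s a b) :
    s = 0 ↔ ∀ᶠ p in 𝓝[U] (x : M), a p = 0 := by
  have := hU.isDomain x x.2
  obtain ⟨h1, h2⟩ := (isQuotientAt_iff ha hb).1 hab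
  have hb0 : algebraMap (stalk E U x) (FractionRing (stalk E U x)) (toStalk U hb) ≠ 0 := by
    simpa using nonZeroDivisors.ne_zero h1
  rw [← toStalk_eq_zero_iff (hF := ha), ← map_eq_zero_iff _
    (IsFractionRing.injective (stalk E U x) (FractionRing (stalk E U x))), ← h2, mul_eq_zero,
    or_iff_left hb0]

variable [IsManifold 𝓘(ℂ, E) ω M]

theorem HolAt.eventually {F : M → ℂ} {x : M} (hF : HolAt E F x) : ∀ᶠ y in 𝓝 x, HolAt E F y :=
  (contMDiffAt_iff_contMDiffAt_nhds (by simp)).1 hF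

/-- A meromorphic function is, near every point, a quotient of two functions that are holomorphic
there. -/
theorem exists_isQuotientAt (h : meromorphic E U) (x : U) :
    ∃ a b : M → ℂ, HolAt E a (x : M) ∧ HolAt E b (x : M) ∧ IsQuotientAt E (h.1 x) a b ∧
      ∀ᶠ y : U in 𝓝 x, IsQuotientAt E (h.1 y) a b ∧ HolAt E a (y : M) ∧ HolAt E b (y : M) := by
  obtain ⟨a, b, ha, hb, hab⟩ := h.2 x
  refine ⟨a, b, ha, hb, hab.self_of_nhds, ?_⟩
  filter_upwards [hab, continuous_subtype_val.continuousAt.eventually ha.eventually,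
    continuous_subtype_val.continuousAt.eventually hb.eventually] with y h1 h2 h3
  exact ⟨h1, h2, h3⟩

variable [FiniteDimensional ℂ E]

/-- The identity theorem: a meromorphic function that is not identically zero is invertible. -/
theorem IsLocallyNormal.exists_mul_eq_one (hU : IsLocallyNormal E U) (hconn : IsConnected U)
    {h : meromorphic E U} {x : U} (hx : h.1 x ≠ 0) : ∃ k : meromorphic E U, h * k = 1 := by
  have hdom := fun y : U => hU.isDomain y y.2
  have : PreconnectedSpace U := isPreconnected_iff_preconnectedSpace.1 hconn.isPreconnected
  have hconst : IsLocallyConstant fun y : U => h.1 y = 0 := by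
    rw [IsLocallyConstant.iff_eventually_eq]
    intro x
    obtain ⟨a, b, ha, hb, hab, hev⟩ := exists_isQuotientAt h x
    by_cases h0 : ∀ᶠ p in 𝓝[U] (x : M), a p = 0
    · filter_upwards [hev, (eventually_nhds_subtype_iff U x _).2
        (eventually_eventually_nhdsWithin.2 h0)] with y hy h1
      exact propext (iff_of_true ((hU.eq_zero_iff_of_isQuotientAt hy.2.1 hy.2.2 hy.1).2 h1)
        ((hU.eq_zero_iff_of_isQuotientAt ha hb hab).2 h0))
    · filter_upwards [hev, (eventually_nhds_subtype_iff U x _).2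
        (hU.eventually_frequently_ne_zero x.2 ha (not_eventually.1 h0))] with y hy h1
      exact propext (iff_of_false (fun h2 => h1 (((hU.eq_zero_iff_of_isQuotientAt hy.2.1 hy.2.2
        hy.1).1 h2).mono fun p hp hne => hne hp))
        fun h2 => h0 ((hU.eq_zero_iff_of_isQuotientAt ha hb hab).1 h2))
  have hne : ∀ y : U, h.1 y ≠ 0 := fun y hy =>
    hx ((hconst.apply_eq_of_preconnectedSpace x y).mpr hy)
  refine ⟨⟨fun y => (h.1 y)⁻¹, fun y => ?_⟩, Subtype.ext (funext fun y => mul_inv_cancel₀ (hne y))⟩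
  obtain ⟨a, b, ha, hb, -, hev⟩ := exists_isQuotientAt h y
  refine ⟨b, a, hb, ha, ?_⟩
  filter_upwards [hev] with z hz
  obtain ⟨h1, h2⟩ := (isQuotientAt_iff hz.2.1 hz.2.2).1 hz.1
  have hb0 : algebraMap (stalk E U z) (FractionRing (stalk E U z)) (toStalk U hz.2.2) ≠ 0 := by
    simpa using nonZeroDivisors.ne_zero h1
  rw [isQuotientAt_iff hz.2.2 hz.2.1, ← h2, inv_mul_cancel_left₀ (hne z)]
  refine ⟨mem_nonZeroDivisors_of_ne_zero fun h0 => ?_, rfl⟩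
  rw [h0, map_zero] at h2
  exact mul_ne_zero (hne z) hb0 h2

/-- The germs at `x` of the functions in the field generated by `f` and `g`. -/
theorem IsLocallyNormal.exists_subfield (hU : IsLocallyNormal E U) (hconn : IsConnected U)
    (f g : meromorphic E U) (x : U) [IsDomain (stalk E U x)] :
    ∃ K : Subfield (FractionRing (stalk E U x)),
      ∀ s, s ∈ K ↔ ∃ h ∈ generatedField f g, h.1 x = s := by
  let A : Subalgebra ℂ (FractionRing (stalk E U x)) :=
    (generatedField f g).map ((Pi.evalAlgHom ℂ _ x).comp (meromorphic E U).val)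
  refine ⟨{ A.toSubring with inv_mem' := ?_ }, fun s => Iff.rfl⟩
  rintro _ ⟨h, hh, rfl⟩
  by_cases h0 : h.1 x = 0
  · refine ⟨0, zero_mem _, ?_⟩
    change (0 : FractionRing (stalk E U x)) = (h.1 x)⁻¹
    rw [h0, inv_zero]
  obtain ⟨k, hk⟩ := hU.exists_mul_eq_one hconn h0
  refine ⟨k, Algebra.mem_sInf.2 fun K hK => hK.2.2 h (Algebra.mem_sInf.1 hh K hK) k hk, ?_⟩
  exact eq_inv_of_mul_eq_one_right (congrFun (congrArg Subtype.val hk) x)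

end Meromorphic

end AnalyticVariety

/-! ### The locus where `df ∧ dg` does not vanish -/

namespace AnalyticGerm

open Filter

theorem wedge_congr {V : Type*} [NormedAddCommGroup V] [NormedSpace ℂ V] {F G F' G' : V → ℂ} {x : V}
    (hF : F =ᶠ[𝓝 x] F') (hG : G =ᶠ[𝓝 x] G') (v w : V) : wedge F G x v w = wedge F' G' x v w := by
  rw [wedge, wedge, hF.fderiv_eq, hG.fderiv_eq]

end AnalyticGerm

namespace AnalyticVariety

open Filter AnalyticGerm

section Wedge

variable {E : Type*} [NormedAddCommGroup E] [NormedSpace ℂ E]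
  {M : Type*} [TopologicalSpace M] [ChartedSpace E M] {U : Set M}

variable (E) in
/-- The form `dF ∧ dG` does not vanish at the point `y` of `U`, where `U` has at `y` the
parametrization that computes it. -/
def WedgeNeZeroAt (U : Set M) (y : M) (F G : M → ℂ) : Prop :=
  ∃ (V : Type) (_ : NormedAddCommGroup V) (_ : NormedSpace ℂ V) (φ : V → M) (v w : V),
    φ 0 = y ∧ ContMDiffAt 𝓘(ℂ, V) 𝓘(ℂ, E) ω φ 0 ∧ map φ (𝓝 0) = 𝓝[U] y ∧
      wedge (F ∘ φ) (G ∘ φ) 0 v w ≠ 0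

/-- The points at which `f` and `g` are holomorphic and `df ∧ dg` does not vanish. -/
def wedgeLocus (f g : meromorphic E U) : Set U :=
  {y | ∃ F G : M → ℂ, RepresentedAt f y F ∧ RepresentedAt g y G ∧ WedgeNeZeroAt E U y F G}

theorem WedgeNotIdenticallyZero.nonempty_wedgeLocus {f g : meromorphic E U}
    (h : WedgeNotIdenticallyZero f g) : (wedgeLocus f g).Nonempty := by
  obtain ⟨x, d, φ, F, G, hφ, hF, hG, v, w, hne⟩ := h
  exact ⟨x, F, G, hF, hG, _, _, _, φ, v, w, hφ.1, hφ.2.1, hφ.2.2.2, hne⟩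

variable [IsManifold 𝓘(ℂ, E) ω M]

/-- Non-vanishing of the wedge product passes from the manifold to the chart at `x`. -/
theorem WedgeNeZeroAt.inChart {x y : M} (hy : y ∈ (centeredChart (E := E) x).source) {F G : M → ℂ}
    (h : WedgeNeZeroAt E U y F G) :
    HasNonzeroWedgeAt ((centeredChart (E := E) x).symm ⁻¹' U) (centeredChart x y)
      (F ∘ (centeredChart x).symm) (G ∘ (centeredChart x).symm) := by
  obtain ⟨V, _, _, φ, v, w, hφ0, hφ, hmap, hne⟩ := h
  refine ⟨V, inferInstance, inferInstance, centeredChart (E := E) x ∘ φ, v, w, congrArg _ hφ0,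
    ?_, ?_, ?_⟩
  · exact (contMDiffAt_iff_contDiffAt.1 (ContMDiffAt.comp (0 : V)
      (contMDiffAt_centeredChart (by rwa [hφ0])) hφ)).analyticAt
  · rw [← map_map, hmap, map_centeredChart hy]
  · have h1 : ∀ᶠ t in 𝓝 (0 : V), (centeredChart (E := E) x).symm (centeredChart x (φ t)) = φ t :=
      hφ.continuousAt.eventually
        (by rw [hφ0]; exact (centeredChart (E := E) x).eventually_left_inverse hy)
    exact (wedge_congr (h1.mono fun t ht => congrArg F ht)
      (h1.mono fun t ht => congrArg G ht) v w).trans_ne hne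

variable [FiniteDimensional ℂ E]

/-- Non-vanishing of the wedge product passes from the chart at `x` to the manifold. -/
theorem wedgeNeZeroAt_of_inChart {x y : M} (hy : y ∈ (centeredChart (E := E) x).source)
    {F G : E → ℂ} (h : HasNonzeroWedgeAt ((centeredChart (E := E) x).symm ⁻¹' U)
      (centeredChart x y) F G) :
    WedgeNeZeroAt E U y (F ∘ centeredChart (E := E) x) (G ∘ centeredChart (E := E) x) := by
  obtain ⟨V, _, _, φ, v, w, hφ0, hφ, hmap, hne⟩ := h
  have hv := (centeredChart (E := E) x).map_source hy
  have := FiniteDimensional.complete ℂ E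
  refine ⟨V, inferInstance, inferInstance, (centeredChart (E := E) x).symm ∘ φ, v, w,
    ?_, ?_, ?_, ?_⟩
  · rw [Function.comp_apply, hφ0, (centeredChart x).left_inv hy]
  · exact ContMDiffAt.comp (0 : V) (contMDiffAt_centeredChart_symm (by rwa [hφ0]))
      (contMDiffAt_iff_contDiffAt.2 hφ.contDiffAt)
  · rw [← map_map, hmap, map_centeredChart_symm hv, (centeredChart x).left_inv hy]
  · have h1 : ∀ᶠ t in 𝓝 (0 : V), centeredChart (E := E) x ((centeredChart x).symm (φ t)) = φ t :=
      hφ.continuousAt.eventually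
        (by rw [hφ0]; exact (centeredChart (E := E) x).eventually_right_inverse hv)
    exact (wedge_congr (h1.mono fun t ht => congrArg F ht)
      (h1.mono fun t ht => congrArg G ht) v w).trans_ne hne

/-- Near a point `x` of `U`, whether `df ∧ dg` vanishes identically can be tested by derivations of
the local ring at `x`. -/
theorem IsLocallyNormal.exists_derivations (hU : IsLocallyNormal E U) (f g : meromorphic E U)
    (x : U) : ∃ (a b a' b' : stalk E U x) (d : ℕ)
      (D : Fin d → Derivation ℂ (stalk E U x) (stalk E U x)), b ≠ 0 ∧ b' ≠ 0 ∧
      f.1 x * algebraMap _ _ b = algebraMap _ _ a ∧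
      g.1 x * algebraMap _ _ b' = algebraMap _ _ a' ∧
      (x ∈ closure (wedgeLocus f g) → ∃ i j, wedgeNumerator (D i) (D j) a b a' b' ≠ 0) ∧
      ((∃ i j, wedgeNumerator (D i) (D j) a b a' b' ≠ 0) →
        ∀ᶠ y in 𝓝 x, y ∈ closure (wedgeLocus f g)) := by
  have := hU.isPrime_ker x.2
  have := hU.isDomain x x.2
  obtain ⟨a, b, ha, hb, hab, hf⟩ := exists_isQuotientAt f x
  obtain ⟨a', b', ha', hb', hab', hg⟩ := exists_isQuotientAt g x
  rw [isQuotientAt_iff ha hb] at hab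
  rw [isQuotientAt_iff ha' hb'] at hab'
  have hb0 := nonZeroDivisors.ne_zero hab.1
  have hb0' := nonZeroDivisors.ne_zero hab'.1
  obtain ⟨d, D, hD, h⟩ := (hU.isZeroLocus x.2).exists_derivations_wedge
  obtain ⟨h1, h2⟩ := h (inChart ha) (inChart hb) (inChart ha') (inChart hb')
    (by rwa [RingHom.mem_ker, stalkMap_inChart]) (by rwa [RingHom.mem_ker, stalkMap_inChart])
  let D' : Fin d → Derivation ℂ (stalk E U x) (stalk E U x) := fun i =>
    Derivation.liftOfSurjective (f := stalkMap U (x : M)) (stalkMap_surjective U (x : M))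
      (d := D i) (fun F hF => hD i F hF)
  have hD' : ∀ i F, D' i (stalkMap U (x : M) F) = stalkMap U (x : M) (D i F) := fun i F =>
    Derivation.liftOfSurjective_apply _ _ F
  have hW : ∀ i j, wedgeNumerator (D' i) (D' j) (toStalk U ha) (toStalk U hb) (toStalk U ha')
      (toStalk U hb') ≠ 0 ↔ wedgeNumerator (D i) (D j) (inChart ha) (inChart hb) (inChart ha')
      (inChart hb') ∉ RingHom.ker (stalkMap (E := E) U (x : M)) := by
    intro i j
    rw [RingHom.mem_ker, Ne, not_iff_not]
    simp only [← stalkMap_inChart, wedgeNumerator, hD', map_sub, map_mul]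
  -- the data that are available at all points of `U` near `x`
  have hev : ∀ᶠ y : U in 𝓝 x, (y : M) ∈ (centeredChart (E := E) (x : M)).source ∧
      (IsQuotientAt E (f.1 y) a b ∧ HolAt E a (y : M) ∧ HolAt E b (y : M)) ∧
      (IsQuotientAt E (g.1 y) a' b' ∧ HolAt E a' (y : M) ∧ HolAt E b' (y : M)) ∧
      ∀ᶠ p in 𝓝[U] (y : M), (inChart ha).rep (centeredChart (x : M) p) = a p ∧
        (inChart hb).rep (centeredChart (x : M) p) = b p ∧
        (inChart ha').rep (centeredChart (x : M) p) = a' p ∧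
        (inChart hb').rep (centeredChart (x : M) p) = b' p := by
    have hc : Tendsto ((↑) : U → M) (𝓝 x) (𝓝 x) := continuous_subtype_val.continuousAt
    filter_upwards [hc.eventually ((centeredChart (E := E) (x : M)).open_source.mem_nhds
      (mem_centeredChart_source (x : M))), hf, hg, hc.eventually (eventually_eventually_nhds.2
      ((rep_inChart_comp ha).and ((rep_inChart_comp hb).and
      ((rep_inChart_comp ha').and (rep_inChart_comp hb')))))] with y k1 k2 k3 k4
    exact ⟨k1, k2, k3, nhdsWithin_le_nhds k4⟩
  refine ⟨_, _, _, _, d, D', hb0, hb0', hab.2, hab'.2, fun hx => ?_, ?_⟩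
  · rw [mem_closure_iff_frequently] at hx
    obtain ⟨y, ⟨F, G, hF, hG, hFG⟩, ⟨k1, k2, k3, k4⟩, k5⟩ := (hx.and_eventually (hev.and
      ((eventually_nhds_subtype_iff U x _).2 ((eventually_centeredChart U).2 h1)))).exists
    have hy := (centeredChart (E := E) (x : M)).left_inv k1
    have hinv := (centeredChart (E := E) (x : M)).eventually_left_inverse k1
    have hFy := (k2.1.representedAt_iff k2.2.1 k2.2.2 hF.1).1 hF
    have hGy := (k3.1.representedAt_iff k3.2.1 k3.2.2 hG.1).1 hG
    obtain ⟨i, j, hij⟩ := k5 (F ∘ (centeredChart (x : M)).symm) (G ∘ (centeredChart (x : M)).symm)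
      (HolAt.analyticAt_comp_symm ((centeredChart (x : M)).map_source k1) (by rw [hy]; exact hF.1))
      (HolAt.analyticAt_comp_symm ((centeredChart (x : M)).map_source k1) (by rw [hy]; exact hG.1))
      (by
        rw [← map_centeredChart k1, eventually_map]
        filter_upwards [hFy, k4, nhdsWithin_le_nhds hinv] with p e1 e2 e3
        rw [Function.comp_apply, e3, e2.2.1, e2.1, e1])
      (by
        rw [← map_centeredChart k1, eventually_map]
        filter_upwards [hGy, k4, nhdsWithin_le_nhds hinv] with p e1 e2 e3
        rw [Function.comp_apply, e3, e2.2.2.2, e2.2.2.1, e1])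
      (hFG.inChart k1)
    exact ⟨i, j, (hW i j).2 hij⟩
  · rintro ⟨i, j, hij⟩
    filter_upwards [eventually_eventually_nhds.2 hev, hev, (eventually_nhds_subtype_iff U x _).2
      ((eventually_centeredChart U).2 (h2 i j ((hW i j).1 hij)))] with y k1 k2 k3
    rw [mem_closure_iff_frequently]
    rw [← map_centeredChart k2.1, frequently_map] at k3
    refine (((frequently_nhds_subtype_iff U y _).2 k3).and_eventually k1).mono ?_
    rintro z ⟨⟨F, G, hF, hG, hFz, hGz, hFG⟩, e1, e2, e3, e4⟩
    rw [← map_centeredChart e1, eventually_map] at hFz hGz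
    have hF' := holAt_comp_centeredChart e1 hF
    have hG' := holAt_comp_centeredChart e1 hG
    refine ⟨_, _, (e2.1.representedAt_iff e2.2.1 e2.2.2 hF').2 ?_,
      (e3.1.representedAt_iff e3.2.1 e3.2.2 hG').2 ?_, wedgeNeZeroAt_of_inChart e1 hFG⟩
    · filter_upwards [hFz, e4] with p q1 q2
      rwa [q2.1, q2.2.1] at q1
    · filter_upwards [hGz, e4] with p q1 q2
      rwa [q2.2.2.1, q2.2.2.2] at q1

/-- The form `df ∧ dg` vanishes identically near no point of `U`. -/
theorem IsLocallyNormal.closure_wedgeLocus (hU : IsLocallyNormal E U) (hconn : IsConnected U)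
    {f g : meromorphic E U} (h : (wedgeLocus f g).Nonempty) :
    closure (wedgeLocus f g) = Set.univ := by
  have : PreconnectedSpace U := isPreconnected_iff_preconnectedSpace.1 hconn.isPreconnected
  refine IsClopen.eq_univ ⟨isClosed_closure, isOpen_iff_mem_nhds.2 fun x hx => ?_⟩ h.closure
  obtain ⟨a, b, a', b', d, D, -, -, -, -, h1, h2⟩ := hU.exists_derivations f g x
  exact h2 (h1 hx)

end Wedge

end AnalyticVariety

/-! ### Non-constancy on a hypersurface -/

namespace AnalyticVariety

open Filter AnalyticGerm

variable {E : Type*} [NormedAddCommGroup E] [NormedSpace ℂ E]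
  {M : Type*} [TopologicalSpace M] [ChartedSpace E M] {U : Set M}

theorem holAt_div {F G : M → ℂ} {x : M} (hF : HolAt E F x) (hG : HolAt E G x) (h : G x ≠ 0) :
    HolAt E (F / G) x :=
  ContMDiffAt.div₀ hF hG h

theorem exists_toStalk_eq_sub_mul (S : Set M) {A B : M → ℂ} {x : M} (hA : HolAt E A x)
    (hB : HolAt E B x) (c : ℂ) : ∃ h : HolAt E (fun p => (A p - c * B p) * B p) x,
      toStalk S h = (toStalk S hA - algebraMap ℂ (stalk E S x) c * toStalk S hB) * toStalk S hB :=
  ⟨ContMDiffAt.mul (ContMDiffAt.sub hA (ContMDiffAt.mul contMDiffAt_const hB)) hB, rfl⟩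

variable [IsManifold 𝓘(ℂ, E) ω M]

theorem isNoetherianRing_stalk [FiniteDimensional ℂ E] (A : Set M) (x : M) :
    IsNoetherianRing (stalk E A x) :=
  isNoetherianRing_of_surjective (AnalyticGerm E) _
    (stalkMap (E := E) A x : AnalyticGerm E →+* stalk E A x) (stalkMap_surjective A x)

theorem isLocalRing_stalk (A : Set M) (x : M) [Nontrivial (stalk E A x)] :
    IsLocalRing (stalk E A x) :=
  .of_surjective' (stalkMap (E := E) A x : AnalyticGerm E →+* stalk E A x) (stalkMap_surjective A x)

/-- A member `a / s` of the field generated by `f` and `g` is non-constant on `H` as soon as neither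
`s` nor any `(a - c * s) * s` with `c` constant vanishes identically on `H` near `x`. -/
theorem nonconstantOn_of_quotient {H : Set M} (hHU : H ⊆ U) {x : U} {h : meromorphic E U}
    {A B : M → ℂ} (hA : HolAt E A (x : M)) (hB : HolAt E B (x : M)) (hBU : toStalk U hB ≠ 0)
    [IsDomain (stalk E U x)]
    (hh : h.1 x = algebraMap (stalk E U x) (FractionRing (stalk E U x)) (toStalk U hA) /
      algebraMap (stalk E U x) (FractionRing (stalk E U x)) (toStalk U hB))
    (hBH : ∃ᶠ p in 𝓝[H] (x : M), B p ≠ 0)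
    (hAH : ∀ c : ℂ, ∃ᶠ p in 𝓝[H] (x : M), (A p - c * B p) * B p ≠ 0) : NonconstantOn h H := by
  obtain ⟨a, b, ha, hb, hab, hev⟩ := exists_isQuotientAt h x
  -- `h` is represented by `A / B` at all points of `U` near `x` where `B` does not vanish
  have hrep : ∀ᶠ p in 𝓝[H] (x : M), ∀ hp : p ∈ U, B p ≠ 0 → RepresentedAt h ⟨p, hp⟩ (A / B) := by
    have h1 : ∀ᶠ p in 𝓝[U] (x : M), A p * b p = a p * B p := by
      rw [isQuotientAt_iff ha hb, hh, div_mul_eq_mul_div, div_eq_iff (by simpa using hBU),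
        ← map_mul, ← map_mul] at hab
      exact (toStalk_eq_iff (hF := hA.mul hb) (hG := ha.mul hB)).1
        (IsFractionRing.injective (stalk E U x) (FractionRing (stalk E U x)) hab.2)
    have h2 : ∀ᶠ p in 𝓝[U] (x : M), ∀ hp : p ∈ U, IsQuotientAt E (h.1 ⟨p, hp⟩) a b ∧
        HolAt E a p ∧ HolAt E b p := by
      rw [← map_nhds_subtype_val, eventually_map]
      filter_upwards [hev] with y hy _ using hy
    refine nhdsWithin_mono _ hHU ?_
    filter_upwards [eventually_eventually_nhdsWithin.2 h1, h2,
      nhdsWithin_le_nhds hA.eventually, nhdsWithin_le_nhds hB.eventually]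
      with p h1 h2 hA hB hp hBp
    obtain ⟨h2, ha, hb⟩ := h2 hp
    refine (h2.representedAt_iff (x := ⟨p, hp⟩) ha hb (holAt_div hA hB hBp)).2 ?_
    filter_upwards [h1, nhdsWithin_le_nhds (ContMDiffAt.continuousAt hB |>.eventually_ne hBp)]
      with q hq hBq
    rw [Pi.div_apply, div_mul_eq_mul_div, hq, mul_div_cancel_right₀ _ hBq]
  have hmem : ∀ᶠ p in 𝓝[H] (x : M), p ∈ H := self_mem_nhdsWithin
  obtain ⟨p, hp, hpH, hpr⟩ := (hBH.and_eventually (hmem.and hrep)).exists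
  obtain ⟨q, hq, hqH, hqr⟩ := ((hAH (A p / B p)).and_eventually (hmem.and hrep)).exists
  have hBq := right_ne_zero_of_mul hq
  refine ⟨⟨p, hHU hpH⟩, ⟨q, hHU hqH⟩, hpH, hqH, A / B, A / B, hpr _ hp, hqr _ hBq, fun heq => ?_⟩
  refine left_ne_zero_of_mul hq (sub_eq_zero.2 ?_)
  change A p / B p = A q / B q at heq
  rw [heq, div_mul_cancel₀ _ hBq]

/-- If `df ∧ dg` does not vanish identically and `H` has codimension one at its point `x`, then the
field generated by `f` and `g` contains a function that is non-constant on `H` near `x`. -/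
theorem IsLocallyNormal.exists_nonconstantOn [FiniteDimensional ℂ E] (hU : IsLocallyNormal E U)
    (hconn : IsConnected U) {f g : meromorphic E U} (hfg : (wedgeLocus f g).Nonempty)
    {H : Set M} (hHU : H ⊆ U) {x : M} (hx : x ∈ H) (hdim : localDim E U x = localDim E H x + 1) :
    ∃ h ∈ generatedField f g, NonconstantOn h H := by
  let y : U := ⟨x, hHU hx⟩
  have hdom : IsDomain (stalk E U y) := hU.isDomain x y.2
  have hclosed : IsIntegrallyClosed (stalk E U y) := hU.isIntegrallyClosed x y.2
  have hnoeth : IsNoetherianRing (stalk E U y) := isNoetherianRing_stalk U x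
  have hlocal : IsLocalRing (stalk E U y) := isLocalRing_stalk U (y : M)
  obtain ⟨r, hr, hrF⟩ := exists_restriction (E := E) hHU x
  obtain ⟨a, b, a', b', d, D, hb, hb', hf, hg, hW, -⟩ := hU.exists_derivations f g y
  obtain ⟨i, j, hij⟩ := hW (by rw [hU.closure_wedgeLocus hconn hfg]; trivial)
  obtain ⟨K, hK⟩ := hU.exists_subfield hconn f g y
  have hquot : ∀ {a b : stalk E U y} {h : meromorphic E U}, h ∈ generatedField f g → b ≠ 0 →
      h.1 y * algebraMap _ _ b = algebraMap _ _ a →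
      algebraMap (stalk E U y) (FractionRing (stalk E U y)) a / algebraMap _ _ b ∈ K :=
    fun hh hb heq => (hK _).2 ⟨_, hh, (eq_div_iff (by simpa using hb)).2 heq⟩
  obtain ⟨ξ, s, hs, hξs, hc⟩ := exists_quotient_notMem (k := ℂ) (J := RingHom.ker r)
    (hdim.trans (congrArg (· + 1) (ringKrullDim_eq_of_ringEquiv (S := stalk E U x ⧸ RingHom.ker r)
      (RingHom.quotientKerEquivOfSurjective hr).symm)))
    K (fun c => (hK _).2 ⟨algebraMap ℂ _ c, Subalgebra.algebraMap_mem _ c, rfl⟩) (D i) (D j) hb hb'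
    (hquot (Algebra.mem_sInf.2 fun _ h => h.1) hb hf)
    (hquot (Algebra.mem_sInf.2 fun _ h => h.2.1) hb' hg) hij
  obtain ⟨h, hh, hhy⟩ := (hK _).1 hξs
  obtain ⟨A, hA, rfl⟩ := exists_toStalk_eq ξ
  obtain ⟨B, hB, rfl⟩ := exists_toStalk_eq s
  refine ⟨h, hh, nonconstantOn_of_quotient hHU hA hB
    (fun h0 => hs (by rw [h0]; exact zero_mem _)) hhy ?_ fun c => ?_⟩
  · rw [RingHom.mem_ker, hrF, toStalk_eq_zero_iff] at hs
    exact fun h0 => hs (h0.mono fun p hp => not_not.1 hp)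
  · obtain ⟨hAB, heq⟩ := exists_toStalk_eq_sub_mul U hA hB c
    have hc' := hc c
    rw [← heq, RingHom.mem_ker, hrF, toStalk_eq_zero_iff] at hc'
    exact fun h0 => hc' (h0.mono fun p hp => not_not.1 hp)

end AnalyticVariety

open AnalyticVariety in
theorem mainTheorem7
    {E : Type*} [NormedAddCommGroup E] [NormedSpace ℂ E] [FiniteDimensional ℂ E]
    {M : Type*} [TopologicalSpace M] [T2Space M] [ChartedSpace E M] [IsManifold 𝓘(ℂ, E) ω M]
    (S : Set M) (hS : IsAnalyticSubset E Set.univ S) (hSnormal : IsNormalAnalytic E S)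
    (W : Set M) (hW : IsOpen W) (U : Set M) (hU : U = S ∩ W) (hUconn : IsConnected U)
    (f g : meromorphic E U) (hfg : WedgeNotIdenticallyZero f g)
    (H : Set M) (hH : IsAnalyticSubset E U H) (hHirr : IsIrreducibleAnalytic E H)
    (hHcodim : HasCodimOne E U H) :
    ∃ h ∈ generatedField f g, NonconstantOn h H := by
  subst hU
  obtain ⟨x, hx⟩ := hHirr.1
  exact (hSnormal.isLocallyNormal_inter hS hW).exists_nonconstantOn hUconn
    hfg.nonempty_wedgeLocus hH.1 hx (hHcodim x hx)
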